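/- Let $\mathbb K$ be a field of characteristic zero. A DGL is a $\mathbb Z$-graded Lie algebra $L$ over $\mathbb K$ with a derivation $\partial$ of degree $-1$ and $\partial^2=0$. A Maurer–Cartan (flat) element is $u\in L_{-1}$ with $\partial u=-\frac12[u,u]$. For a graded vector space $V$ let $\widehat{\mathbb L}(V)$ be the complete free Lie algebra on $V$: in each degree it consists of the formal series $\sum_{n\ge1}\phi_n$, where $\phi_n$ is an element of that degree and of bracket length $n$ of the free Lie algebra $\mathbb L(V)\subset T(V)$. A complete free DGL is $\widehat{\mathbb L}(V)$ with a differential that is continuous for (does not lower) the filtration by bracket length. The Lawrence–Sullivan construction $\mathfrak L$ is the complete free DGL $(\widehat{\mathbb L}(a,b,z),\partial)$, with $a,b$ of degree $-1$ and $z$ of degree $0$, in which $a,b$ are flat and $$\partial z=[z,b]+\sum_{i\ge0}\frac{B_i}{i!}\,\mathrm{ad}_z^i(b-a),\qquad \sum_{i\ge 0}\frac{B_i}{i!}x^i=\frac{x}{e^x-1}.$$ Let $\Lambda(t,dt)=\mathbb K[t]\oplus\mathbb K[t]dt$, where $t$ has degree $0$, $dt=d(t)$ lowers the (homological) degree by one,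 and $(dt)^2=0$. Two Maurer–Cartan elements $u,v$ of $L$ are homotopic if there is a Maurer–Cartan element $\phi$ of $L\otimes\Lambda(t,dt)$ with $\varepsilon_0(\phi)=u$ and $\varepsilon_1(\phi)=v$, where $\varepsilon_c$ is evaluation at $t=c$, $dt=0$; if $L$ is a complete free DGL, $\otimes$ is the completed tensor product $\varprojlim_n (L/F^n)\otimes\Lambda(t,dt)$, where $F^n$ consists of the series without terms of length less than $n$. For $w\in L_0$ and a flat $v$, whenever the sums make sense, put $$w*v=\sum_{i\ge0}\frac{\mathrm{ad}_w^i(v)}{i!}-\sum_{i\ge0}\frac{\mathrm{ad}_w^i(\partial w)}{(i+1)!}.$$ (1) Let $L$ be a DGL such that for any $w\in L_0$ there is an $i$ with $\mathrm{ad}_w^i=0$ on $L$, and let $u,v\in L_{-1}$ be Maurer–Cartan elements. If the adjoint action of $L_0$ on $L$ is locally nilpotent (for every finite $S\subset L_0$ there is $N$ such that $\mathrm{ad}_{x_1}\cdots\mathrm{ad}_{x_N}=0$ for all $x_1,\dots,x_N\in S$), then $u$ and $v$ are homotopic if and only if there is a DGL morphism $\Phi\colon\mathfrak L\to L$ with $\Phi(a)=u$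 and $\Phi(b)=v$. The existence of such a $\Phi$ implies that $u$ and $v$ are homotopic even without local nilpotency. Moreover, for every $w\in L_0$, one has $w*v=u$ if and only if there is a DGL morphism $\Phi\colon\mathfrak L\to L$ with $\Phi(a)=u$, $\Phi(b)=v$ and $\Phi(z)=w$. (2) Let $L$ be a complete free DGL and let $u,v\in L_{-1}$ be Maurer–Cartan elements. Then $u$ and $v$ are homotopic if and only if there is a DGL morphism $\Phi\colon\mathfrak L\to L$ with $\Phi(a)=u$ and $\Phi(b)=v$; and for every $w\in L_0$, one has $w*v=u$ if and only if there is a DGL morphism $\Phi\colon\mathfrak L\to L$ with $\Phi(a)=u$, $\Phi(b)=v$ and $\Phi(z)=w$. (3) The differential of $\mathfrak L$ is the only continuous differential on $\widehat{\mathbb L}(a,b,z)$ for which $a$ and $b$ are flat that satisfies $z*b=a$. -/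

import Mathlib

universe u v w

/-- A `ℤ`-graded Lie algebra over `K`: the family of its homogeneous components with the graded
bracket. -/
structure GradedLie (K : Type u) [Field K] where
  obj : ℤ → Type v
  [acg : ∀ i, AddCommGroup (obj i)]
  [mod : ∀ i, Module K (obj i)]
  br : ∀ i j k : ℤ, i + j = k → obj i →ₗ[K] obj j →ₗ[K] obj k
  antisymm : ∀ (i j k : ℤ) (h : i + j = k) (h' : j + i = k) (x : obj i) (y : obj j),
    br i j k h x y = -((-1 : K) ^ (i * j) • br j i k h' y x)
  jacobi : ∀ (i j l ij jl il n : ℤ) (h₁ : i + j = ij) (h₂ : j + l = jl) (h₃ : i + l = il)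
    (h₄ : i + jl = n) (h₅ : ij + l = n) (h₆ : j + il = n) (x : obj i) (y : obj j) (z : obj l),
    br i jl n h₄ x (br j l jl h₂ y z) =
      br ij l n h₅ (br i j ij h₁ x y) z + (-1 : K) ^ (i * j) • br j il n h₆ y (br i l il h₃ x z)

attribute [instance] GradedLie.acg GradedLie.mod

/-- A differential on a graded Lie algebra: a graded derivation of degree `-1` and square zero. -/
structure GradedLie.Differential {K : Type u} [Field K] (G : GradedLie.{u, v} K) where
  d : ∀ i j : ℤ, j + 1 = i → G.obj i →ₗ[K] G.obj j
  leibniz : ∀ (i j k i' j' k' : ℤ) (h : i + j = k) (hi : i' + 1 = i) (hj : j' + 1 = j)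
    (hk : k' + 1 = k) (h₁ : i' + j = k') (h₂ : i + j' = k') (x : G.obj i) (y : G.obj j),
    d k k' hk (G.br i j k h x y) =
      G.br i' j k' h₁ (d i i' hi x) y + (-1 : K) ^ i • G.br i j' k' h₂ x (d j j' hj y)
  sq : ∀ (i j l : ℤ) (h : j + 1 = i) (h' : l + 1 = j) (x : G.obj i), d j l h' (d i j h x) = 0

/-- A differential graded Lie algebra (DGL). -/
structure DGL (K : Type u) [Field K] where
  lie : GradedLie.{u, v} K
  diff : lie.Differential

namespace DGL

variable {K : Type u} [Field K]

abbrev obj (L : DGL.{u, v} K) (i : ℤ) : Type v := L.lie.obj i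

abbrev br (L : DGL.{u, v} K) (i j k : ℤ) (h : i + j = k) :
    L.obj i →ₗ[K] L.obj j →ₗ[K] L.obj k := L.lie.br i j k h

abbrev d (L : DGL.{u, v} K) (i j : ℤ) (h : j + 1 = i) : L.obj i →ₗ[K] L.obj j := L.diff.d i j h

/-- Maurer–Cartan (flat) elements: `∂x = -½[x,x]` with `x` of degree `-1`. -/
def IsMC (L : DGL.{u, v} K) (x : L.obj (-1)) : Prop :=
  L.d (-1) (-2) (by norm_num) x = -((1 / 2 : K) • L.br (-1) (-1) (-2) (by norm_num) x x)

/-- The operator `ad_x`, for `x` of degree `0`, on the component of degree `k`. -/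
def ad (L : DGL.{u, v} K) (x : L.obj 0) (k : ℤ) : Module.End K (L.obj k) :=
  L.br 0 k k (zero_add k) x

/-- Every element of `L₀` is ad-nilpotent: for any `x ∈ L₀` there is `N` with `ad_xᴺ = 0` on `L`. -/
def AdNilpotent (L : DGL.{u, v} K) : Prop :=
  ∀ x : L.obj 0, ∃ N : ℕ, ∀ k : ℤ, (L.ad x k) ^ N = 0

/-- The adjoint action of `L₀` on `L` is locally nilpotent: for every finite set `S ⊆ L₀`, all
sufficiently long products of operators `ad_x`, `x ∈ S`, vanish on `L`. -/
def AdLocallyNilpotent (L : DGL.{u, v} K) : Prop :=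
  ∀ S : Finset (L.obj 0), ∃ N : ℕ, ∀ l : List (L.obj 0), l.length = N → (∀ x ∈ l, x ∈ S) →
    ∀ k : ℤ, (l.map fun x => L.ad x k).prod = 0

/-- Morphisms of DGL's. -/
structure Hom (L : DGL.{u, v} K) (M : DGL.{u, w} K) where
  toFun : ∀ i : ℤ, L.obj i →ₗ[K] M.obj i
  map_br : ∀ (i j k : ℤ) (h : i + j = k) (x : L.obj i) (y : L.obj j),
    toFun k (L.br i j k h x y) = M.br i j k h (toFun i x) (toFun j y)
  map_d : ∀ (i j : ℤ) (h : j + 1 = i) (x : L.obj i),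
    toFun j (L.d i j h x) = M.d i j h (toFun i x)

/-- A decreasing filtration of a DGL by differential ideals; it defines a linear topology. -/
structure Filtration (L : DGL.{u, v} K) where
  F : ℕ → ∀ k : ℤ, Submodule K (L.obj k)
  anti : ∀ (n : ℕ) (k : ℤ), F (n + 1) k ≤ F n k
  br_mem : ∀ (n : ℕ) (i j k : ℤ) (h : i + j = k) (x : L.obj i) (y : L.obj j),
    x ∈ F n i → L.br i j k h x y ∈ F n k
  d_mem : ∀ (n : ℕ) (i j : ℤ) (h : j + 1 = i) (x : L.obj i), x ∈ F n i → L.d i j h x ∈ F n j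

/-- The zero filtration `Fₙ = 0`; it defines the discrete topology. -/
def Filtration.discrete (L : DGL.{u, v} K) : L.Filtration where
  F _ _ := ⊥
  anti _ _ := le_rfl
  br_mem n i j k h x y hx := by
    rw [Submodule.mem_bot] at hx ⊢; simp [hx]
  d_mem n i j h x hx := by
    rw [Submodule.mem_bot] at hx ⊢; simp [hx]

variable {L : DGL.{u, v} K} (F : L.Filtration)

namespace Filtration

theorem br_mem_right (n : ℕ) (i j k : ℤ) (h : i + j = k) (x : L.obj i) (y : L.obj j)
    (hy : y ∈ F.F n j) : L.br i j k h x y ∈ F.F n k := by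
  have h' : j + i = k := by omega
  show L.lie.br i j k h x y ∈ F.F n k
  rw [L.lie.antisymm i j k h h']
  exact Submodule.neg_mem _ (Submodule.smul_mem _ _ (F.br_mem n j i k h' y x hy))

/-- `s = ∑ pᵢ` in the topology of the filtration. -/
def IsSum {k : ℤ} (p : ℕ → L.obj k) (s : L.obj k) : Prop :=
  ∀ n : ℕ, ∃ N : ℕ, ∀ m ≥ N, (∑ i ∈ Finset.range m, p i) - s ∈ F.F n k

/-- The series `∑ pᵢ tⁱ` with coefficients in the component of degree `k` that tend to `0`.
For the discrete filtration these are the polynomials in `t`, that is `L_k ⊗ K[t]`. -/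
def series (k : ℤ) : Submodule K (ℕ → L.obj k) where
  carrier := {p | ∀ n : ℕ, ∃ N : ℕ, ∀ i ≥ N, p i ∈ F.F n k}
  zero_mem' n := ⟨0, fun i _ => (F.F n k).zero_mem⟩
  add_mem' {p q} hp hq n := by
    obtain ⟨N, hN⟩ := hp n
    obtain ⟨M, hM⟩ := hq n
    exact ⟨max N M, fun i hi => (F.F n k).add_mem (hN i (le_of_max_le_left hi))
      (hM i (le_of_max_le_right hi))⟩
  smul_mem' c p hp n := by
    obtain ⟨N, hN⟩ := hp n
    exact ⟨N, fun i hi => (F.F n k).smul_mem c (hN i hi)⟩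

/-- `[∑ pₐ tᵃ, ∑ q_b tᵇ] = ∑ [pₐ, q_b] tᵃ⁺ᵇ`. -/
def seriesBr (i j k : ℤ) (h : i + j = k) : F.series i →ₗ[K] F.series j →ₗ[K] F.series k :=
  LinearMap.mk₂ K
    (fun p q => ⟨fun n => ∑ c ∈ Finset.HasAntidiagonal.antidiagonal n, L.br i j k h (p.1 c.1) (q.1 c.2), by
      intro n
      obtain ⟨N, hN⟩ := p.2 n
      obtain ⟨M, hM⟩ := q.2 n
      refine ⟨N + M, fun m hm => Submodule.sum_mem _ fun c hc => ?_⟩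
      rw [Finset.HasAntidiagonal.mem_antidiagonal] at hc
      by_cases hcN : N ≤ c.1
      · exact F.br_mem n i j k h _ _ (hN _ hcN)
      · exact F.br_mem_right n i j k h _ _ (hM _ (by omega))⟩)
    (fun p p' q => by ext n; simp [Finset.sum_add_distrib])
    (fun c p q => by ext n; simp [Finset.smul_sum])
    (fun p q q' => by ext n; simp [Finset.sum_add_distrib])
    (fun c p q => by ext n; simp [Finset.smul_sum])

/-- `∂` applied to the coefficients of a series. -/
def seriesD (i j : ℤ) (h : j + 1 = i) : F.series i →ₗ[K] F.series j where
  toFun p := ⟨fun n => L.d i j h (p.1 n), fun n => by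
    obtain ⟨N, hN⟩ := p.2 n
    exact ⟨N, fun m hm => F.d_mem n i j h _ (hN m hm)⟩⟩
  map_add' p q := by ext n; simp
  map_smul' c p := by ext n; simp

/-- The derivative `d/dt` of a series (with an identification of two equal degrees). -/
def seriesDeriv (i j : ℤ) (h : i = j) : F.series i →ₗ[K] F.series j := by
  subst h
  exact
  { toFun := fun p => ⟨fun n => ((n : K) + 1) • p.1 (n + 1), fun n => by
      obtain ⟨N, hN⟩ := p.2 n
      exact ⟨N, fun m hm => (F.F n i).smul_mem _ (hN _ (by omega))⟩⟩
    map_add' := fun p q => by ext n; simp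
    map_smul' := fun c p => by
      ext n
      simp [smul_comm c] }

theorem seriesBr_apply (i j k : ℤ) (h : i + j = k) (p : F.series i) (q : F.series j) (n : ℕ) :
    (F.seriesBr i j k h p q).1 n =
      ∑ c ∈ Finset.HasAntidiagonal.antidiagonal n, L.br i j k h (p.1 c.1) (q.1 c.2) := rfl

theorem seriesD_apply (i j : ℤ) (h : j + 1 = i) (p : F.series i) (n : ℕ) :
    (F.seriesD i j h p).1 n = L.d i j h (p.1 n) := rfl

theorem seriesDeriv_apply (i : ℤ) (p : F.series i) (n : ℕ) :
    (F.seriesDeriv i i rfl p).1 n = ((n : K) + 1) • p.1 (n + 1) := rfl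

theorem seriesBr_antisymm (i j k : ℤ) (h : i + j = k) (h' : j + i = k)
    (p : F.series i) (q : F.series j) :
    F.seriesBr i j k h p q = -((-1 : K) ^ (i * j) • F.seriesBr j i k h' q p) := by
  ext n
  simp only [Submodule.coe_neg, Submodule.coe_smul, Pi.neg_apply, Pi.smul_apply, seriesBr_apply]
  rw [← Finset.Nat.sum_antidiagonal_swap, Finset.smul_sum, ← Finset.sum_neg_distrib]
  exact Finset.sum_congr rfl fun c _ => L.lie.antisymm i j k h h' _ _

theorem seriesBr_jacobi (i j l ij jl il n : ℤ) (h₁ : i + j = ij) (h₂ : j + l = jl)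
    (h₃ : i + l = il) (h₄ : i + jl = n) (h₅ : ij + l = n) (h₆ : j + il = n)
    (x : F.series i) (y : F.series j) (z : F.series l) :
    F.seriesBr i jl n h₄ x (F.seriesBr j l jl h₂ y z) =
      F.seriesBr ij l n h₅ (F.seriesBr i j ij h₁ x y) z +
        (-1 : K) ^ (i * j) • F.seriesBr j il n h₆ y (F.seriesBr i l il h₃ x z) := by
  ext m
  simp only [Submodule.coe_add, Submodule.coe_smul, Pi.add_apply, Pi.smul_apply, seriesBr_apply,
    map_sum, LinearMap.sum_apply, Finset.smul_sum]
  simp only [L.lie.jacobi i j l ij jl il n h₁ h₂ h₃ h₄ h₅ h₆, Finset.sum_add_distrib]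
  congr 1
  · rw [Finset.sum_sigma', Finset.sum_sigma']
    refine Finset.sum_nbij' (fun s => ⟨(s.1.1 + s.2.1, s.2.2), (s.1.1, s.2.1)⟩)
      (fun s => ⟨(s.2.1, s.2.2 + s.1.2), (s.2.2, s.1.2)⟩) ?_ ?_ ?_ ?_ ?_
    all_goals
      rintro ⟨⟨a, b⟩, ⟨c, e⟩⟩ hs
      simp only [Finset.mem_sigma, Finset.HasAntidiagonal.mem_antidiagonal] at hs ⊢
      try
        obtain ⟨hs1, rfl⟩ := hs
        first
          | rfl
          | exact ⟨by omega, trivial⟩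
  · rw [Finset.sum_sigma', Finset.sum_sigma']
    refine Finset.sum_nbij' (fun s => ⟨(s.2.1, s.1.1 + s.2.2), (s.1.1, s.2.2)⟩)
      (fun s => ⟨(s.2.1, s.1.1 + s.2.2), (s.1.1, s.2.2)⟩) ?_ ?_ ?_ ?_ ?_
    all_goals
      rintro ⟨⟨a, b⟩, ⟨c, e⟩⟩ hs
      simp only [Finset.mem_sigma, Finset.HasAntidiagonal.mem_antidiagonal] at hs ⊢
      try
        obtain ⟨hs1, rfl⟩ := hs
        first
          | rfl
          | exact ⟨by omega, trivial⟩

theorem seriesD_br (i j k i' j' k' : ℤ) (h : i + j = k) (hi : i' + 1 = i) (hj : j' + 1 = j)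
    (hk : k' + 1 = k) (h₁ : i' + j = k') (h₂ : i + j' = k') (x : F.series i) (y : F.series j) :
    F.seriesD k k' hk (F.seriesBr i j k h x y) =
      F.seriesBr i' j k' h₁ (F.seriesD i i' hi x) y +
        (-1 : K) ^ i • F.seriesBr i j' k' h₂ x (F.seriesD j j' hj y) := by
  ext m
  simp only [Submodule.coe_add, Submodule.coe_smul, Pi.add_apply, Pi.smul_apply, seriesBr_apply,
    seriesD_apply, map_sum, Finset.smul_sum]
  rw [← Finset.sum_add_distrib]
  exact Finset.sum_congr rfl fun c _ => L.diff.leibniz i j k i' j' k' h hi hj hk h₁ h₂ _ _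

theorem seriesD_sq (i j l : ℤ) (h : j + 1 = i) (h' : l + 1 = j) (x : F.series i) :
    F.seriesD j l h' (F.seriesD i j h x) = 0 := by
  ext m
  exact L.diff.sq i j l h h' _

theorem seriesDeriv_D (i j i' j' : ℤ) (h : j + 1 = i) (h' : j' + 1 = i') (hi : i = i')
    (hj : j = j') (x : F.series i) :
    F.seriesD i' j' h' (F.seriesDeriv i i' hi x) = F.seriesDeriv j j' hj (F.seriesD i j h x) := by
  subst hi hj
  ext m
  simp [seriesD_apply, seriesDeriv_apply]

theorem seriesDeriv_br (i j k i' j' k' : ℤ) (h : i + j = k) (hi : i = i') (hj : j = j')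
    (hk : k = k') (h₁ : i' + j = k') (h₂ : i + j' = k') (x : F.series i) (y : F.series j) :
    F.seriesDeriv k k' hk (F.seriesBr i j k h x y) =
      F.seriesBr i' j k' h₁ (F.seriesDeriv i i' hi x) y +
        F.seriesBr i j' k' h₂ x (F.seriesDeriv j j' hj y) := by
  subst hi hj hk
  ext m
  simp only [Submodule.coe_add, Pi.add_apply, seriesBr_apply, seriesDeriv_apply]
  have e1 : ∑ c ∈ Finset.HasAntidiagonal.antidiagonal (m + 1), (c.1 : K) • L.br i j k h (x.1 c.1) (y.1 c.2) =
      ∑ c ∈ Finset.HasAntidiagonal.antidiagonal m, ((c.1 : K) + 1) • L.br i j k h (x.1 (c.1 + 1)) (y.1 c.2) := by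
    rw [Finset.Nat.antidiagonal_succ]
    simp
  have e2 : ∑ c ∈ Finset.HasAntidiagonal.antidiagonal (m + 1), (c.2 : K) • L.br i j k h (x.1 c.1) (y.1 c.2) =
      ∑ c ∈ Finset.HasAntidiagonal.antidiagonal m, ((c.2 : K) + 1) • L.br i j k h (x.1 c.1) (y.1 (c.2 + 1)) := by
    rw [Finset.Nat.antidiagonal_succ']
    simp
  simp only [map_smul, LinearMap.smul_apply]
  rw [← e1, ← e2, ← Finset.sum_add_distrib, Finset.smul_sum]
  refine Finset.sum_congr rfl fun c hc => ?_
  rw [← add_smul]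
  congr 1
  rw [Finset.HasAntidiagonal.mem_antidiagonal] at hc
  rw [← Nat.cast_add, hc, Nat.cast_succ]

theorem sign_cases (n : ℤ) : (-1 : K) ^ n = 1 ∨ (-1 : K) ^ n = -1 := by
  rcases Int.even_or_odd n with h | h
  · exact Or.inl h.neg_one_zpow
  · exact Or.inr h.neg_one_zpow

set_option maxHeartbeats 1000000 in
/-- The DGL of forms `p + q dt`, where `p`, `q` are series in `t` with coefficients in `L` that tend
to `0`; `t` has degree `0` and `dt = d(t)` lowers the degree by one, as `∂` does. Here
`[x ⊗ α, y ⊗ β] = (-1)^(|α||y|) [x, y] ⊗ αβ` and `∂(x ⊗ α) = ∂x ⊗ α + (-1)^|x| x ⊗ dα`.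
For the discrete filtration this is the tensor product `L ⊗ Λ(t, dt) = L[t] ⊕ L[t] dt`; for a
complete filtration it is the completed tensor product, the limit of the `L / Fₙ ⊗ Λ(t, dt)`. -/
def forms : DGL.{u, v} K where
  lie :=
  { obj := fun k => F.series k × F.series (k + 1)
    br := fun i j k h => LinearMap.mk₂ K
      (fun ω η => (F.seriesBr i j k h ω.1 η.1,
        F.seriesBr i (j + 1) (k + 1) (by omega) ω.1 η.2 +
          (-1 : K) ^ j • F.seriesBr (i + 1) j (k + 1) (by omega) ω.2 η.1))
      (fun ω ω' η => by ext1 <;> simp; abel)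
      (fun c ω η => by ext1 <;> simp [smul_comm c])
      (fun ω η η' => by ext1 <;> simp; abel)
      (fun c ω η => by ext1 <;> simp [smul_comm c])
    antisymm := fun i j k h h' ω η => by
      have hz : (-1 : K) ≠ 0 := by simp
      ext1
      · exact F.seriesBr_antisymm i j k h h' ω.1 η.1
      · simp only [LinearMap.mk₂_apply, Prod.snd_neg, Prod.smul_snd]
        rw [F.seriesBr_antisymm i (j + 1) (k + 1) (by omega) (by omega),
          F.seriesBr_antisymm (i + 1) j (k + 1) (by omega) (by omega)]
        simp only [mul_add, add_mul, mul_one, one_mul, zpow_add₀ hz]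
        rcases sign_cases (K := K) i with h1 | h1 <;> rcases sign_cases (K := K) j with h2 | h2 <;>
        rcases sign_cases (K := K) (i * j) with h3 | h3 <;>
        simp only [h1, h2, h3] <;> module
    jacobi := fun i j l ij jl il n h₁ h₂ h₃ h₄ h₅ h₆ x y z => by
      have hz : (-1 : K) ≠ 0 := by simp
      ext1
      · exact F.seriesBr_jacobi i j l ij jl il n h₁ h₂ h₃ h₄ h₅ h₆ x.1 y.1 z.1
      · simp only [LinearMap.mk₂_apply, Prod.snd_add, Prod.smul_snd, map_add, map_smul,
          LinearMap.add_apply, LinearMap.smul_apply]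
        rw [F.seriesBr_jacobi i j (l + 1) ij (jl + 1) (il + 1) (n + 1) (by omega) (by omega)
            (by omega) (by omega) (by omega) (by omega),
          F.seriesBr_jacobi i (j + 1) l (ij + 1) (jl + 1) il (n + 1) (by omega) (by omega)
            (by omega) (by omega) (by omega) (by omega),
          F.seriesBr_jacobi (i + 1) j l (ij + 1) jl (il + 1) (n + 1) (by omega) (by omega)
            (by omega) (by omega) (by omega) (by omega)]
        subst h₁ h₂ h₃
        simp only [mul_add, add_mul, mul_one, one_mul, zpow_add₀ hz]
        rcases sign_cases (K := K) i with h1 | h1 <;> rcases sign_cases (K := K) j with h2 | h2 <;>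
        rcases sign_cases (K := K) l with h4 | h4 <;>
        rcases sign_cases (K := K) (i * j) with h3 | h3 <;>
        simp only [h1, h2, h3, h4] <;> module }
  diff :=
  { d := fun i j h =>
      { toFun := fun ω => (F.seriesD i j h ω.1,
          F.seriesD (i + 1) (j + 1) (by omega) ω.2 +
            (-1 : K) ^ i • F.seriesDeriv i (j + 1) h.symm ω.1)
        map_add' := fun ω η => by ext1 <;> simp; abel
        map_smul' := fun c ω => by ext1 <;> simp [smul_comm c] }
    leibniz := fun i j k i' j' k' h hi hj hk h₁ h₂ x y => by
      have hz : (-1 : K) ≠ 0 := by simp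
      ext1
      · exact F.seriesD_br i j k i' j' k' h hi hj hk h₁ h₂ x.1 y.1
      · simp only [LinearMap.mk₂_apply, LinearMap.coe_mk, AddHom.coe_mk, Prod.snd_add,
          Prod.smul_snd, map_add, map_smul, LinearMap.add_apply, LinearMap.smul_apply]
        rw [F.seriesD_br i (j + 1) (k + 1) i' (j' + 1) (k' + 1) (by omega) (by omega) (by omega)
            (by omega) (by omega) (by omega),
          F.seriesD_br (i + 1) j (k + 1) (i' + 1) j' (k' + 1) (by omega) (by omega) (by omega)
            (by omega) (by omega) (by omega),
          F.seriesDeriv_br i j k (i' + 1) (j' + 1) (k' + 1) (by omega) (by omega) (by omega)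
            (by omega) (by omega) (by omega)]
        subst hi hj h
        simp only [zpow_add₀ hz]
        rcases sign_cases (K := K) i' with h1 | h1 <;>
        rcases sign_cases (K := K) j' with h2 | h2 <;>
        simp only [h1, h2, zpow_one] <;> module
    sq := fun i j l h h' x => by
      have hz : (-1 : K) ≠ 0 := by simp
      ext1
      · exact F.seriesD_sq i j l h h' x.1
      · simp only [LinearMap.coe_mk, AddHom.coe_mk, map_add, map_smul, Prod.snd_zero]
        rw [F.seriesD_sq, F.seriesDeriv_D i j (j + 1) (l + 1) h (by omega) (by omega) (by omega)]
        subst h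
        simp only [zpow_add₀ hz, zpow_one]
        module }

/-- `s` is the value at `t = c`, `dt = 0` of the form `ω`. -/
def EvalsTo {k : ℤ} (c : K) (ω : F.forms.obj k) (s : L.obj k) : Prop :=
  F.IsSum (fun i => c ^ i • (ω : F.series k × F.series (k + 1)).1.1 i) s

/-- The elements `u`, `v` of degree `-1` are homotopic: some Maurer–Cartan element of the DGL of
forms with coefficients in `L` has the values `u` at `t = 0` and `v` at `t = 1`. -/
def Homotopic (u v : L.obj (-1)) : Prop :=
  ∃ ω : F.forms.obj (-1), F.forms.IsMC ω ∧ F.EvalsTo 0 ω u ∧ F.EvalsTo 1 ω v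

/-- The gauge action: `x * y = u`, where
`x * y = ∑ ad_xⁱ(y) / i! - ∑ ad_xⁱ(∂x) / (i + 1)!` for `x` of degree `0` and `y` of degree `-1`. -/
def Gauge (x : L.obj 0) (y u : L.obj (-1)) : Prop :=
  F.IsSum (fun i => (1 / (i.factorial : K)) • ((L.ad x (-1)) ^ i) y -
    (1 / ((i + 1).factorial : K)) • ((L.ad x (-1)) ^ i) (L.d 0 (-1) (by norm_num) x)) u

end Filtration
end DGL

/-- Iterated graded brackets `[f, g] = fg - (-1)^(|f||g|) gf` of the generators `x ∈ X`, `x` being of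
degree `deg x`, in the tensor algebra on `X`, with their bracket length and degree. -/
inductive IsLieMonomial (K : Type u) [Field K] {X : Type w} (deg : X → ℤ) :
    ℕ → ℤ → FreeAlgebra K X → Prop
  | gen (x : X) : IsLieMonomial K deg 1 (deg x) (FreeAlgebra.ι K x)
  | br {m n : ℕ} {i j : ℤ} {f g : FreeAlgebra K X} (hf : IsLieMonomial K deg m i f)
      (hg : IsLieMonomial K deg n j g) :
      IsLieMonomial K deg (m + n) (i + j) (f * g - (-1 : K) ^ (i * j) • (g * f))

section Free

variable (K : Type u) [Field K] {X : Type w} (deg : X → ℤ)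

/-- The part of length `n` and degree `k` of the free graded Lie algebra on the graded vector space
with homogeneous basis `X`, inside the tensor algebra. -/
noncomputable def freeLie (n : ℕ) (k : ℤ) : Submodule K (FreeAlgebra K X) :=
  Submodule.span K {f | IsLieMonomial K deg n k f}

variable {K deg} in
theorem freeLie_br {m n : ℕ} {i j : ℤ} {f g : FreeAlgebra K X} (hf : f ∈ freeLie K deg m i)
    (hg : g ∈ freeLie K deg n j) :
    f * g - (-1 : K) ^ (i * j) • (g * f) ∈ freeLie K deg (m + n) (i + j) := by
  induction hf, hg using Submodule.span_induction₂ with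
  | mem_mem f g hf hg => exact Submodule.subset_span (.br hf hg)
  | zero_left g hg => simp
  | zero_right f hf => simp
  | add_left f f' g _ _ _ h h' =>
    convert add_mem h h' using 1
    simp only [add_mul, mul_add]
    module
  | add_right f g g' _ _ _ h h' =>
    convert add_mem h h' using 1
    simp only [add_mul, mul_add]
    module
  | smul_left c f g _ _ h =>
    convert Submodule.smul_mem _ c h using 1
    simp only [smul_mul_assoc, mul_smul_comm]
    module
  | smul_right c f g _ _ h =>
    convert Submodule.smul_mem _ c h using 1
    simp only [smul_mul_assoc, mul_smul_comm]
    module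

/-- The part of degree `k` of the complete free Lie algebra: the formal series `∑ₙ φₙ` with `φₙ` in
the part of length `n` and degree `k` of the free Lie algebra. The formal variable of the power
series only records the length. -/
noncomputable def hatLie (k : ℤ) : Submodule K (PowerSeries (FreeAlgebra K X)) where
  carrier := {φ | ∀ n : ℕ, PowerSeries.coeff n φ ∈ freeLie K deg n k}
  zero_mem' n := by simp
  add_mem' hφ hψ n := by simpa using add_mem (hφ n) (hψ n)
  smul_mem' c φ hφ n := by simpa using Submodule.smul_mem _ c (hφ n)

variable {K deg} in
theorem hatLie_br {i j k : ℤ} (h : i + j = k) {φ ψ : PowerSeries (FreeAlgebra K X)}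
    (hφ : φ ∈ hatLie K deg i) (hψ : ψ ∈ hatLie K deg j) :
    φ * ψ - (-1 : K) ^ (i * j) • (ψ * φ) ∈ hatLie K deg k := by
  intro n
  rw [map_sub, PowerSeries.coeff_smul, PowerSeries.coeff_mul, PowerSeries.coeff_mul,
    ← Finset.Nat.sum_antidiagonal_swap (f := fun c => PowerSeries.coeff c.1 ψ * _),
    Finset.smul_sum, ← Finset.sum_sub_distrib]
  refine Submodule.sum_mem _ fun c hc => ?_
  rw [Finset.HasAntidiagonal.mem_antidiagonal] at hc
  subst h hc
  exact freeLie_br (hφ c.1) (hψ c.2)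

/-- The complete free graded Lie algebra on the graded vector space with homogeneous basis `X`. -/
noncomputable def completeFreeLie : GradedLie.{u, max u w} K where
  obj k := hatLie K deg k
  br i j k h := LinearMap.mk₂ K
    (fun φ ψ => ⟨φ.1 * ψ.1 - (-1 : K) ^ (i * j) • (ψ.1 * φ.1), hatLie_br h φ.2 ψ.2⟩)
    (fun φ φ' ψ => by
      ext1
      simp only [Submodule.coe_add, add_mul, mul_add]
      module)
    (fun c φ ψ => by
      ext1
      simp only [Submodule.coe_smul, smul_mul_assoc, mul_smul_comm]
      module)
    (fun φ ψ ψ' => by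
      ext1
      simp only [Submodule.coe_add, add_mul, mul_add]
      module)
    (fun c φ ψ => by
      ext1
      simp only [Submodule.coe_smul, smul_mul_assoc, mul_smul_comm]
      module)
  antisymm i j k h h' x y := by
    ext1
    simp only [LinearMap.mk₂_apply, Submodule.coe_neg, Submodule.coe_smul, mul_comm j i]
    rcases DGL.Filtration.sign_cases (K := K) (i * j) with h3 | h3 <;> rw [h3] <;> module
  jacobi i j l ij jl il n h₁ h₂ h₃ h₄ h₅ h₆ x y z := by
    have hz : (-1 : K) ≠ 0 := by simp
    ext1
    subst h₁ h₂ h₃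
    simp only [LinearMap.mk₂_apply, Submodule.coe_add, Submodule.coe_smul, mul_add, add_mul,
      zpow_add₀ hz, mul_comm j i, mul_sub, sub_mul, smul_mul_assoc,
      mul_smul_comm, mul_assoc]
    rcases DGL.Filtration.sign_cases (K := K) (i * j) with h3 | h3 <;>
    rcases DGL.Filtration.sign_cases (K := K) (j * l) with h4 | h4 <;>
    rcases DGL.Filtration.sign_cases (K := K) (i * l) with h5 | h5 <;>
    rw [h3, h4, h5] <;> module

/-- The grading involution `f ↦ (-1)^|f| f` of the tensor algebra. -/
noncomputable def gradSign : FreeAlgebra K X →ₐ[K] FreeAlgebra K X :=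
  FreeAlgebra.lift K fun x => (-1 : K) ^ deg x • FreeAlgebra.ι K x

/-- Auxiliary: `f ↦ (σ f, D f; 0, f)` with `σ` the grading involution and `D` the graded derivation
that extends `δ`. -/
noncomputable def derHom (δ : X → FreeAlgebra K X) :
    FreeAlgebra K X →ₐ[K] Matrix (Fin 2) (Fin 2) (FreeAlgebra K X) :=
  FreeAlgebra.lift K fun x => !![gradSign K deg (FreeAlgebra.ι K x), δ x; 0, FreeAlgebra.ι K x]

/-- The graded derivation `D(fg) = D(f) g + (-1)^|f| f D(g)` of the tensor algebra that extends
`δ`. -/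
noncomputable def gradedDer (δ : X → FreeAlgebra K X) : FreeAlgebra K X →ₗ[K] FreeAlgebra K X where
  toFun f := derHom K deg δ f 0 1
  map_add' f g := by simp
  map_smul' c f := by simp

variable {K} (δ : X → FreeAlgebra K X)

theorem derHom_eq (f : FreeAlgebra K X) :
    derHom K deg δ f = !![gradSign K deg f, gradedDer K deg δ f; 0, f] := by
  have key : derHom K deg δ f 0 0 = gradSign K deg f ∧ derHom K deg δ f 1 0 = 0 ∧
      derHom K deg δ f 1 1 = f := by
    induction f using FreeAlgebra.induction with
    | grade0 r =>
      simp [Matrix.algebraMap_matrix_apply]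
    | grade1 x => simp [derHom]
    | mul f g hf hg =>
      simp [Matrix.mul_apply, Fin.sum_univ_two, hf, hg]
    | add f g hf hg => simp [hf, hg]
  ext i j
  fin_cases i <;> fin_cases j <;> simp [key, gradedDer]

theorem gradedDer_ι (x : X) : gradedDer K deg δ (FreeAlgebra.ι K x) = δ x := by
  simp [gradedDer, derHom]

theorem gradedDer_mul (f g : FreeAlgebra K X) : gradedDer K deg δ (f * g) =
    gradedDer K deg δ f * g + gradSign K deg f * gradedDer K deg δ g := by
  have h : derHom K deg δ (f * g) 0 1 = (derHom K deg δ f * derHom K deg δ g) 0 1 := by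
    rw [map_mul]
  rw [derHom_eq, derHom_eq, derHom_eq, Matrix.mul_apply] at h
  simp [Fin.sum_univ_two] at h
  rw [h, add_comm]

theorem gradedDer_one : gradedDer K deg δ 1 = 0 := by
  simp [gradedDer]

theorem gradSign_of_mem {n : ℕ} {k : ℤ} {f : FreeAlgebra K X} (hf : f ∈ freeLie K deg n k) :
    gradSign K deg f = (-1 : K) ^ k • f := by
  have hz : (-1 : K) ≠ 0 := by simp
  induction hf using Submodule.span_induction with
  | mem f hf =>
    induction hf with
    | gen x => simp [gradSign]
    | br _ _ h h' =>
      simp only [map_sub, map_smul, map_mul, h, h', smul_mul_assoc, mul_smul_comm, zpow_add₀ hz]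
      module
  | zero => simp
  | add f g _ _ h h' => simp [h, h']
  | smul c f _ h => simp [h, smul_comm c]

theorem gradedDer_mem {r : ℕ} (hδ : ∀ x, δ x ∈ freeLie K deg (1 + r) (deg x - 1)) {n : ℕ} {k : ℤ}
    {f : FreeAlgebra K X} (hf : f ∈ freeLie K deg n k) :
    gradedDer K deg δ f ∈ freeLie K deg (n + r) (k - 1) := by
  have hz : (-1 : K) ≠ 0 := by simp
  induction hf using Submodule.span_induction with
  | mem f hf =>
    induction hf with
    | gen x => rw [gradedDer_ι]; exact hδ x
    | @br m n i j f g hf hg h h' =>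
      have h1 := freeLie_br h (Submodule.subset_span hg : g ∈ freeLie K deg n j)
      have h2 := freeLie_br (Submodule.subset_span hf : f ∈ freeLie K deg m i) h'
      rw [show m + r + n = m + n + r by omega, show i - 1 + j = i + j - 1 by omega] at h1
      rw [show m + (n + r) = m + n + r by omega, show i + (j - 1) = i + j - 1 by omega] at h2
      convert add_mem h1 (Submodule.smul_mem _ ((-1 : K) ^ i) h2) using 1
      rw [map_sub, map_smul, gradedDer_mul, gradedDer_mul,
        gradSign_of_mem deg (Submodule.subset_span hf : f ∈ freeLie K deg m i),
        gradSign_of_mem deg (Submodule.subset_span hg : g ∈ freeLie K deg n j)]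
      simp only [mul_sub, sub_mul, mul_one, one_mul, zpow_sub₀ hz, smul_mul_assoc]
      rcases DGL.Filtration.sign_cases (K := K) (i * j) with h3 | h3 <;>
      rcases DGL.Filtration.sign_cases (K := K) i with h4 | h4 <;>
      rcases DGL.Filtration.sign_cases (K := K) j with h5 | h5 <;>
      rw [h3, h4, h5] <;> module
  | zero => simp
  | add f g _ _ h h' => simpa using add_mem h h'
  | smul c f _ h => simpa using Submodule.smul_mem _ c h

end Free

section Der

variable {K : Type u} [Field K] {X : Type w} (deg : X → ℤ) (δ : ℕ → X → FreeAlgebra K X)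

/-- The continuous derivation of the complete tensor algebra with `x ↦ ∑ᵣ δ r x`, where `δ r x` has
length `1 + r`. -/
noncomputable def seriesDer : PowerSeries (FreeAlgebra K X) →ₗ[K] PowerSeries (FreeAlgebra K X) where
  toFun φ := PowerSeries.mk fun n => ∑ c ∈ Finset.HasAntidiagonal.antidiagonal n,
    gradedDer K deg (δ c.2) (PowerSeries.coeff c.1 φ)
  map_add' φ ψ := by ext n; simp [Finset.sum_add_distrib]
  map_smul' c φ := by ext n; simp [Finset.smul_sum]

theorem coeff_seriesDer (φ : PowerSeries (FreeAlgebra K X)) (n : ℕ) :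
    PowerSeries.coeff n (seriesDer deg δ φ) = ∑ c ∈ Finset.HasAntidiagonal.antidiagonal n,
      gradedDer K deg (δ c.2) (PowerSeries.coeff c.1 φ) := by
  simp [seriesDer]

theorem sum_antidiagonal_assoc {M : Type*} [AddCommMonoid M] (f : ℕ → ℕ → ℕ → M) (n : ℕ) :
    ∑ c ∈ Finset.HasAntidiagonal.antidiagonal n, ∑ e ∈ Finset.HasAntidiagonal.antidiagonal c.1,
      f e.1 e.2 c.2 =
    ∑ c ∈ Finset.HasAntidiagonal.antidiagonal n, ∑ e ∈ Finset.HasAntidiagonal.antidiagonal c.2,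
      f c.1 e.1 e.2 := by
  rw [Finset.sum_sigma', Finset.sum_sigma']
  refine Finset.sum_nbij' (fun s => ⟨(s.2.1, s.2.2 + s.1.2), (s.2.2, s.1.2)⟩)
    (fun s => ⟨(s.1.1 + s.2.1, s.2.2), (s.1.1, s.2.1)⟩) ?_ ?_ ?_ ?_ ?_
  all_goals
    rintro ⟨⟨a, b⟩, ⟨c, e⟩⟩ hs
    simp only [Finset.mem_sigma, Finset.HasAntidiagonal.mem_antidiagonal] at hs ⊢
    try
      obtain ⟨hs1, rfl⟩ := hs
      first
        | rfl
        | exact ⟨by omega, trivial⟩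

theorem sum_antidiagonal_right {M : Type*} [AddCommMonoid M] (f : ℕ → ℕ → ℕ → M) (n : ℕ) :
    ∑ c ∈ Finset.HasAntidiagonal.antidiagonal n, ∑ e ∈ Finset.HasAntidiagonal.antidiagonal c.1,
      f e.1 c.2 e.2 =
    ∑ c ∈ Finset.HasAntidiagonal.antidiagonal n, ∑ e ∈ Finset.HasAntidiagonal.antidiagonal c.1,
      f e.1 e.2 c.2 := by
  rw [sum_antidiagonal_assoc (fun a b c => f a c b), sum_antidiagonal_assoc f]
  exact Finset.sum_congr rfl fun c _ => Finset.Nat.sum_antidiagonal_swap (f := fun e => f c.1 e.1 e.2)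

theorem seriesDer_mul (φ ψ : PowerSeries (FreeAlgebra K X)) :
    seriesDer deg δ (φ * ψ) = seriesDer deg δ φ * ψ +
      PowerSeries.map (gradSign K deg).toRingHom φ * seriesDer deg δ ψ := by
  ext n
  rw [map_add, coeff_seriesDer, PowerSeries.coeff_mul, PowerSeries.coeff_mul]
  simp only [PowerSeries.coeff_mul, coeff_seriesDer, map_sum, gradedDer_mul, PowerSeries.coeff_map,
    Finset.sum_add_distrib, Finset.sum_mul, Finset.mul_sum]
  congr 1
  · exact sum_antidiagonal_right (fun a b r => gradedDer K deg (δ b) (PowerSeries.coeff a φ) *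
      PowerSeries.coeff r ψ) n
  · exact sum_antidiagonal_assoc (fun a b r => gradSign K deg (PowerSeries.coeff a φ) *
      gradedDer K deg (δ r) (PowerSeries.coeff b ψ)) n

theorem coeff_seriesDer_C (f : FreeAlgebra K X) (n : ℕ) :
    PowerSeries.coeff n (seriesDer deg δ (PowerSeries.C f)) = gradedDer K deg (δ n) f := by
  rw [coeff_seriesDer, Finset.sum_eq_single (0, n)]
  · simp
  · rintro ⟨a, b⟩ hab hne
    rw [Finset.HasAntidiagonal.mem_antidiagonal] at hab
    rw [PowerSeries.coeff_C, if_neg, map_zero]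
    rintro rfl
    simp_all
  · simp

theorem coeff_seriesDer_sq (φ : PowerSeries (FreeAlgebra K X)) (n : ℕ) :
    PowerSeries.coeff n (seriesDer deg δ (seriesDer deg δ φ)) =
      ∑ c ∈ Finset.HasAntidiagonal.antidiagonal n, PowerSeries.coeff c.2
        (seriesDer deg δ (seriesDer deg δ (PowerSeries.C (PowerSeries.coeff c.1 φ)))) := by
  have h : ∀ (f : FreeAlgebra K X) (m : ℕ),
      PowerSeries.coeff m (seriesDer deg δ (seriesDer deg δ (PowerSeries.C f))) =
        ∑ c ∈ Finset.HasAntidiagonal.antidiagonal m,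
          gradedDer K deg (δ c.2) (gradedDer K deg (δ c.1) f) := by
    intro f m
    rw [coeff_seriesDer]
    simp only [coeff_seriesDer_C]
  rw [coeff_seriesDer]
  simp only [h, coeff_seriesDer, map_sum]
  exact sum_antidiagonal_assoc (fun a b r => gradedDer K deg (δ r) (gradedDer K deg (δ b)
    (PowerSeries.coeff a φ))) n

theorem seriesDer_one : seriesDer deg δ 1 = 0 := by
  ext n
  rw [← map_one PowerSeries.C, coeff_seriesDer_C]
  simp [gradedDer_one]

theorem seriesDer_X_mul (φ : PowerSeries (FreeAlgebra K X)) :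
    seriesDer deg δ (PowerSeries.X * φ) = PowerSeries.X * seriesDer deg δ φ := by
  have h : seriesDer deg δ PowerSeries.X = 0 := by
    ext n
    rw [coeff_seriesDer]
    refine Finset.sum_eq_zero fun c _ => ?_
    rw [PowerSeries.coeff_X]
    split_ifs <;> simp [gradedDer_one]
  rw [seriesDer_mul, h, PowerSeries.map_X, zero_mul, zero_add]

theorem seriesDer_mem
    (hδ : ∀ r x, δ r x ∈ freeLie K deg (1 + r) (deg x - 1))
    {i j : ℤ} (h : j + 1 = i) {φ : PowerSeries (FreeAlgebra K X)}
    (hφ : φ ∈ hatLie K deg i) : seriesDer deg δ φ ∈ hatLie K deg j := by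
  intro n
  rw [coeff_seriesDer]
  refine Submodule.sum_mem _ fun c hc => ?_
  rw [Finset.HasAntidiagonal.mem_antidiagonal] at hc
  subst h hc
  simpa using gradedDer_mem deg (δ c.2) (hδ c.2) (hφ c.1)

theorem map_gradSign_of_mem {k : ℤ} {φ : PowerSeries (FreeAlgebra K X)} (hφ : φ ∈ hatLie K deg k) :
    PowerSeries.map (gradSign K deg).toRingHom φ = (-1 : K) ^ k • φ := by
  ext n
  rw [PowerSeries.coeff_map, PowerSeries.coeff_smul]
  exact gradSign_of_mem deg (hφ n)

theorem gradSign_gradSign (f : FreeAlgebra K X) : gradSign K deg (gradSign K deg f) = f := by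
  induction f using FreeAlgebra.induction with
  | grade0 r => simp
  | grade1 x =>
    rcases DGL.Filtration.sign_cases (K := K) (deg x) with h | h <;> simp [gradSign, h]
  | mul f g hf hg => simp [hf, hg]
  | add f g hf hg => simp [hf, hg]

theorem gradedDer_gradSign
    (hδ : ∀ r x, δ r x ∈ freeLie K deg (1 + r) (deg x - 1))
    (r : ℕ) (f : FreeAlgebra K X) :
    gradedDer K deg (δ r) (gradSign K deg f) = -gradSign K deg (gradedDer K deg (δ r) f) := by
  have hz : (-1 : K) ≠ 0 := by simp
  induction f using FreeAlgebra.induction with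
  | grade0 c =>
    rw [Algebra.algebraMap_eq_smul_one]
    simp [gradedDer_one]
  | grade1 x =>
    rw [gradedDer_ι, gradSign_of_mem deg (hδ r x)]
    simp [gradSign, gradedDer_ι, zpow_sub₀ hz, div_neg]
  | mul f g hf hg =>
    rw [map_mul, gradedDer_mul, gradedDer_mul, hf, hg, map_add, map_mul, map_mul]
    simp [add_comm]
  | add f g hf hg => simp [hf, hg, add_comm]

theorem seriesDer_sq_mul
    (hδ : ∀ r x, δ r x ∈ freeLie K deg (1 + r) (deg x - 1))
    (φ ψ : PowerSeries (FreeAlgebra K X)) :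
    seriesDer deg δ (seriesDer deg δ (φ * ψ)) =
      seriesDer deg δ (seriesDer deg δ φ) * ψ + φ * seriesDer deg δ (seriesDer deg δ ψ) := by
  have h1 : ∀ φ, seriesDer deg δ (PowerSeries.map (gradSign K deg).toRingHom φ) =
      -PowerSeries.map (gradSign K deg).toRingHom (seriesDer deg δ φ) := by
    intro φ
    ext n
    simp only [coeff_seriesDer, map_neg, PowerSeries.coeff_map, map_sum, ← Finset.sum_neg_distrib]
    exact Finset.sum_congr rfl fun c _ => gradedDer_gradSign deg δ hδ _ _
  have h2 : ∀ φ, PowerSeries.map (gradSign K deg).toRingHom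
      (PowerSeries.map (gradSign K deg).toRingHom φ) = φ := by
    intro φ
    ext n
    simp only [PowerSeries.coeff_map]
    exact gradSign_gradSign deg _
  rw [seriesDer_mul, map_add, seriesDer_mul, seriesDer_mul, h1, h2]
  simp only [neg_mul]
  abel

theorem seriesDer_sq
    (hδ : ∀ r x, δ r x ∈ freeLie K deg (1 + r) (deg x - 1))
    (h0 : ∀ x, seriesDer deg δ (seriesDer deg δ
    (PowerSeries.C (FreeAlgebra.ι K x))) = 0) (φ : PowerSeries (FreeAlgebra K X)) :
    seriesDer deg δ (seriesDer deg δ φ) = 0 := by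
  have h : ∀ f, seriesDer deg δ (seriesDer deg δ (PowerSeries.C f)) = 0 := by
    intro f
    induction f using FreeAlgebra.induction with
    | grade0 c =>
      have : (PowerSeries.C (algebraMap K (FreeAlgebra K X) c)) =
          c • (1 : PowerSeries (FreeAlgebra K X)) := by
        ext n
        simp [PowerSeries.coeff_C, PowerSeries.coeff_one,
          Algebra.algebraMap_eq_smul_one]
      rw [this, map_smul, map_smul, seriesDer_one, map_zero, smul_zero]
    | grade1 x => exact h0 x
    | mul f g hf hg => rw [map_mul, seriesDer_sq_mul deg δ hδ, hf, hg, zero_mul, mul_zero, add_zero]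
    | add f g hf hg => rw [map_add, map_add, map_add, hf, hg, add_zero]
  ext n
  rw [coeff_seriesDer_sq]
  simp [h]

theorem seriesDer_br (i j : ℤ) {φ ψ : PowerSeries (FreeAlgebra K X)}
    (hφ : φ ∈ hatLie K deg (i + 1)) (hψ : ψ ∈ hatLie K deg (j + 1)) :
    seriesDer deg δ (φ * ψ - (-1 : K) ^ ((i + 1) * (j + 1)) • (ψ * φ)) =
      seriesDer deg δ φ * ψ - (-1 : K) ^ (i * (j + 1)) • (ψ * seriesDer deg δ φ) +
      (-1 : K) ^ (i + 1) • (φ * seriesDer deg δ ψ -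
        (-1 : K) ^ ((i + 1) * j) • (seriesDer deg δ ψ * φ)) := by
  have hz : (-1 : K) ≠ 0 := by simp
  rw [map_sub, map_smul, seriesDer_mul, seriesDer_mul, map_gradSign_of_mem deg hφ,
    map_gradSign_of_mem deg hψ]
  simp only [mul_add, add_mul, mul_one, one_mul, zpow_add₀ hz, smul_mul_assoc, zpow_one]
  rcases DGL.Filtration.sign_cases (K := K) (i * j) with h3 | h3 <;>
  rcases DGL.Filtration.sign_cases (K := K) i with h4 | h4 <;>
  rcases DGL.Filtration.sign_cases (K := K) j with h5 | h5 <;>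
  rw [h3, h4, h5] <;> module

/-- The differential of the complete free Lie algebra with `x ↦ ∑ᵣ δ r x` on generators. -/
noncomputable def derivationDifferential
    (hδ : ∀ r x, δ r x ∈ freeLie K deg (1 + r) (deg x - 1))
    (h0 : ∀ x, seriesDer deg δ (seriesDer deg δ
    (PowerSeries.C (FreeAlgebra.ι K x))) = 0) : (completeFreeLie K deg).Differential where
  d i j h := ((seriesDer deg δ).comp (hatLie K deg i).subtype).codRestrict (hatLie K deg j)
    fun φ => seriesDer_mem deg δ hδ h φ.2
  leibniz i j k i' j' k' h hi hj hk h₁ h₂ x y := by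
    subst hi hj
    exact Subtype.ext (seriesDer_br deg δ i' j' x.2 y.2)
  sq i j l h h' x := by
    apply Subtype.ext
    exact seriesDer_sq deg δ hδ h0 x.1

/-- The complete free DGL with the differential `∂`. -/
noncomputable def completeFreeDGL {deg : X → ℤ} (δ : (completeFreeLie K deg).Differential) :
    DGL.{u, max u w} K where
  lie := completeFreeLie K deg
  diff := δ

/-- Continuity of a differential of the complete free Lie algebra: it does not lower the length. -/
def IsContinuousDifferential {deg : X → ℤ} (δ : (completeFreeLie K deg).Differential) : Prop :=
  ∀ (n : ℕ) (i j : ℤ) (h : j + 1 = i) (φ : hatLie K deg i),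
    (∀ m < n, PowerSeries.coeff m φ.1 = 0) →
      ∀ m < n, PowerSeries.coeff m (δ.d i j h φ : hatLie K deg j).1 = 0

/-- The filtration of a complete free DGL by length: `Fₙ` consists of the series without terms of
length less than `n`. -/
noncomputable def lengthFiltration {deg : X → ℤ} (δ : (completeFreeLie K deg).Differential)
    (hδ : IsContinuousDifferential δ) : (completeFreeDGL δ).Filtration where
  F n k :=
    { carrier := {φ : hatLie K deg k | ∀ m < n, PowerSeries.coeff m φ.1 = 0}
      zero_mem' := fun m _ => map_zero (PowerSeries.coeff m)
      add_mem' := fun {φ ψ} hφ hψ m hm =>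
        (map_add (PowerSeries.coeff m) φ.1 ψ.1).trans (by rw [hφ m hm, hψ m hm, add_zero])
      smul_mem' := fun c φ hφ m hm =>
        (PowerSeries.coeff_smul m φ.1 c).trans (by rw [hφ m hm, smul_zero]) }
  anti n k φ hφ m hm := hφ m (by omega)
  br_mem n i j k h φ ψ hφ m hm := by
    show PowerSeries.coeff m (φ.1 * ψ.1 - (-1 : K) ^ (i * j) • (ψ.1 * φ.1)) = 0
    rw [map_sub, PowerSeries.coeff_smul, PowerSeries.coeff_mul, PowerSeries.coeff_mul,
      Finset.sum_eq_zero, Finset.sum_eq_zero, smul_zero, sub_zero]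
    · intro c hc
      rw [Finset.HasAntidiagonal.mem_antidiagonal] at hc
      rw [hφ c.2 (by omega), mul_zero]
    · intro c hc
      rw [Finset.HasAntidiagonal.mem_antidiagonal] at hc
      rw [hφ c.1 (by omega), zero_mul]
  d_mem n i j h φ hφ := hδ n i j h φ hφ

/-- The generator `x`, as an element of degree `deg x` of the complete free Lie algebra. -/
noncomputable def completeFreeGen (K : Type u) [Field K] (deg : X → ℤ) (x : X) :
    (completeFreeLie K deg).obj (deg x) :=
  (⟨PowerSeries.monomial 1 (FreeAlgebra.ι K x), fun n => by
    rw [PowerSeries.coeff_monomial]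
    split_ifs with h
    · subst h
      exact Submodule.subset_span (.gen x)
    · exact Submodule.zero_mem _⟩ : hatLie K deg (deg x))

end Der

/-- The generators `a`, `b` (of degree `-1`) and `z` (of degree `0`). -/
inductive LSGen | a | b | z

/-- The degrees of the generators. -/
def LSGen.deg : LSGen → ℤ
  | a => -1
  | b => -1
  | z => 0

section LS
variable (K : Type u) [Field K]

open FreeAlgebra in
/-- The component of length `1 + r` of the differential of a generator:
`∂a = -½[a, a] = -a²`, `∂b = -b²` and `∂z = [z, b] + ∑ᵣ B_r / r! ad_zʳ(b - a)`, with `B₁ = -½`. -/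
noncomputable def lsValue (r : ℕ) : LSGen → FreeAlgebra K LSGen
  | .a => if r = 1 then -(ι K .a * ι K .a) else 0
  | .b => if r = 1 then -(ι K .b * ι K .b) else 0
  | .z => ((bernoulli r / r.factorial : ℚ) : K) •
        (fun f => ι K .z * f - f * ι K .z)^[r] (ι K .b - ι K .a) +
      if r = 1 then ι K .z * ι K .b - ι K .b * ι K .z else 0

theorem lsGen_mem (x : LSGen) : FreeAlgebra.ι K x ∈ freeLie K LSGen.deg 1 x.deg :=
  Submodule.subset_span (.gen x)

theorem ls_adz_mem {n : ℕ} {k : ℤ} {f : FreeAlgebra K LSGen} (hf : f ∈ freeLie K LSGen.deg n k) :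
    FreeAlgebra.ι K .z * f - f * FreeAlgebra.ι K .z ∈ freeLie K LSGen.deg (n + 1) k := by
  simpa [LSGen.deg, add_comm] using freeLie_br (lsGen_mem K .z) hf

open FreeAlgebra in
theorem lsValue_mem [CharZero K] (r : ℕ) (x : LSGen) :
    lsValue K r x ∈ freeLie K LSGen.deg (1 + r) (x.deg - 1) := by
  have hsq : ∀ x : LSGen, x.deg = -1 → -(FreeAlgebra.ι K x * FreeAlgebra.ι K x) ∈
      freeLie K LSGen.deg (1 + 1) (x.deg - 1) := by
    intro x hx
    have h := Submodule.smul_mem _ (-(1 / 2) : K) (freeLie_br (lsGen_mem K x) (lsGen_mem K x))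
    rw [hx] at h ⊢
    rw [show (-1 : K) ^ ((-1 : ℤ) * -1) = -1 by norm_num] at h
    have e : -(ι K x * ι K x) = -(1 / 2 : K) • (ι K x * ι K x - (-1 : K) • (ι K x * ι K x)) := by
      rw [neg_one_smul, sub_neg_eq_add, ← two_smul K, smul_smul]
      norm_num
    rw [e]
    exact h
  cases x with
  | a =>
    unfold lsValue
    split_ifs with h
    · subst h; exact hsq .a rfl
    · simp
  | b =>
    unfold lsValue
    split_ifs with h
    · subst h; exact hsq .b rfl
    · simp
  | z =>
    unfold lsValue
    refine add_mem (Submodule.smul_mem _ _ ?_) ?_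
    · induction r with
      | zero => exact sub_mem (lsGen_mem K .b) (lsGen_mem K .a)
      | succ r ih =>
        rw [Function.iterate_succ_apply']
        exact ls_adz_mem K ih
    · split_ifs with h
      · subst h
        exact ls_adz_mem K (lsGen_mem K .b)
      · simp

open PowerSeries in
/-- A generating function identity for Bernoulli numbers. -/
theorem bernoulli_sum_identity {R : Type*} [CommRing R] [IsDomain R] [Algebra ℚ R] (l r : R)
    (hlr : l - r ≠ 0) (N : ℕ) :
    ∑ c ∈ Finset.HasAntidiagonal.antidiagonal (N + 1),
      algebraMap ℚ R (1 / c.1.factorial * (bernoulli c.2 / c.2.factorial)) *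
        ((∑ j ∈ Finset.range c.1, l ^ j * r ^ (c.1 - 1 - j)) * (l - r) ^ c.2) =
      algebraMap ℚ R (1 / N.factorial) * r ^ N := by
  have key : (rescale l (exp R) - rescale r (exp R)) *
      rescale (l - r) (bernoulliPowerSeries R) = rescale r (exp R) * (C (l - r) * X) := by
    have h1 : rescale l (exp R) = rescale r (exp R) * rescale (l - r) (exp R) := by
      rw [exp_mul_exp_eq_exp_add, add_sub_cancel]
    have h2 := congrArg (rescale (l - r)) (bernoulliPowerSeries_mul_exp_sub_one R)
    rw [map_mul, map_sub, map_one, rescale_X] at h2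
    rw [h1, ← h2]
    ring
  have hc := congrArg (coeff (N + 1)) key
  rw [coeff_mul, ← mul_assoc, coeff_succ_mul_X, mul_comm _ (C (l - r)), coeff_C_mul] at hc
  apply mul_left_cancel₀ hlr
  rw [show (l - r) * (algebraMap ℚ R (1 / N.factorial) * r ^ N) =
    (l - r) * coeff N (rescale r (exp R)) by simp [coeff_rescale, coeff_exp, mul_comm], ← hc,
    Finset.mul_sum]
  refine Finset.sum_congr rfl fun c _ => ?_
  have hg := (Commute.all l r).geom_sum₂_mul c.1
  simp only [map_sub, coeff_rescale, coeff_exp, bernoulliPowerSeries, coeff_mk]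
  rw [← sub_mul, ← hg, map_mul]
  ring

variable {K}

/-- The identity `∑ B_r / (m! r!) (∑ zʲ (ad_zʳ y) zᵐ⁻¹⁻ʲ) = y zᴺ / N!`, the sum over
`m + r = N + 1`. -/
theorem bernoulli_ad_identity [CharZero K] {A : Type*} [Ring A] [Algebra K A] (z y : A) (N : ℕ) :
    ∑ c ∈ Finset.HasAntidiagonal.antidiagonal (N + 1),
      ((1 / c.1.factorial * (bernoulli c.2 / c.2.factorial) : ℚ) : K) •
        ∑ j ∈ Finset.range c.1, z ^ j * (fun f => z * f - f * z)^[c.2] y * z ^ (c.1 - 1 - j) =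
      ((1 / N.factorial : ℚ) : K) • (y * z ^ N) := by
  have hcomm : ∀ p : Polynomial K, Commute (Polynomial.aeval (LinearMap.mulLeft K z) p)
      (LinearMap.mulRight K z) := by
    intro p
    induction p using Polynomial.induction_on' with
    | add p q hp hq => rw [map_add]; exact hp.add_left hq
    | monomial n a =>
      rw [Polynomial.aeval_monomial]
      exact (Algebra.commute_algebraMap_left a _).mul_left
        ((LinearMap.commute_mulLeft_right z z).pow_left n)
  let Θ : Polynomial (Polynomial K) →ₐ[K] Module.End K A :=
    Polynomial.eval₂AlgHom (Polynomial.aeval (LinearMap.mulLeft K z)) (LinearMap.mulRight K z)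
      hcomm
  have hΘ1 : Θ (Polynomial.C Polynomial.X) = LinearMap.mulLeft K z := by
    exact (Polynomial.eval₂_C _ _).trans (Polynomial.aeval_X _)
  have hΘ2 : Θ Polynomial.X = LinearMap.mulRight K z := by
    exact Polynomial.eval₂_X _ _
  have hne : (Polynomial.C Polynomial.X - Polynomial.X : Polynomial (Polynomial K)) ≠ 0 := by
    intro h
    have := congrArg (fun p => Polynomial.coeff p 1) h
    simp at this
  have key := congrArg Θ (bernoulli_sum_identity _ _ hne N)
  have hq : ∀ q : ℚ, Θ (algebraMap ℚ _ q) = algebraMap K _ (q : K) := by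
    intro q
    rw [IsScalarTower.algebraMap_apply ℚ K (Polynomial (Polynomial K)), AlgHom.commutes,
      eq_ratCast]
  have key2 := LinearMap.congr_fun key y
  have had : ∀ r : ℕ, ((LinearMap.mulLeft K z - LinearMap.mulRight K z) ^ r) y =
      (fun f => z * f - f * z)^[r] y := by
    intro r
    rw [Module.End.pow_apply]
    rfl
  simp only [map_sum, map_mul, map_pow, map_sub, hq, hΘ1, hΘ2, LinearMap.sum_apply,
    Module.End.mul_apply, Module.algebraMap_end_apply, had, LinearMap.pow_mulLeft,
    LinearMap.pow_mulRight, LinearMap.mulLeft_apply, LinearMap.mulRight_apply] at key2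
  rw [← key2]
  simp only [mul_assoc, Finset.smul_sum, smul_smul, Rat.cast_mul]

open FreeAlgebra PowerSeries

/-- The Lawrence–Sullivan differential on the complete tensor algebra. -/
noncomputable abbrev lsD :
    PowerSeries (FreeAlgebra K LSGen) →ₗ[K] PowerSeries (FreeAlgebra K LSGen) :=
  seriesDer LSGen.deg (lsValue K)

/-- The exponential `e^z`. -/
noncomputable def lsExp : PowerSeries (FreeAlgebra K LSGen) :=
  PowerSeries.mk fun n => ((1 / n.factorial : ℚ) : K) • ι K LSGen.z ^ n

theorem gradedDer_z_pow (r m : ℕ) : gradedDer K LSGen.deg (lsValue K r) (ι K LSGen.z ^ m) =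
    ∑ j ∈ Finset.range m, ι K LSGen.z ^ j * lsValue K r .z * ι K LSGen.z ^ (m - 1 - j) := by
  induction m with
  | zero => simp [gradedDer_one]
  | succ m ih =>
    have hs : gradSign K LSGen.deg (ι K LSGen.z ^ m) = ι K LSGen.z ^ m := by
      simp [gradSign, LSGen.deg]
    rw [pow_succ, gradedDer_mul, ih, gradedDer_ι, hs, Finset.sum_range_succ, Finset.sum_mul]
    congr 1
    · refine Finset.sum_congr rfl fun j hj => ?_
      rw [Finset.mem_range] at hj
      rw [mul_assoc, ← pow_succ, show m - 1 - j + 1 = m + 1 - 1 - j by omega]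
    · simp

theorem lsD_exp [CharZero K] : lsD (lsExp (K := K)) =
    lsExp * (C (ι K LSGen.b) * X) - (X * C (ι K LSGen.a)) * lsExp := by
  ext N
  cases N with
  | zero =>
    rw [coeff_seriesDer]
    simp [lsExp, gradedDer_one]
  | succ N =>
    have hb : ∀ N : ℕ, (∑ j ∈ Finset.range N, ι K LSGen.z ^ j *
        (ι K LSGen.z * ι K LSGen.b - ι K LSGen.b * ι K LSGen.z) * ι K LSGen.z ^ (N - 1 - j)) =
        ι K LSGen.z ^ N * ι K LSGen.b - ι K LSGen.b * ι K LSGen.z ^ N := by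
      intro N
      induction N with
      | zero => simp
      | succ N ih =>
        rw [Finset.sum_range_succ]
        have : ∑ j ∈ Finset.range N, ι K LSGen.z ^ j *
            (ι K LSGen.z * ι K LSGen.b - ι K LSGen.b * ι K LSGen.z) *
            ι K LSGen.z ^ (N + 1 - 1 - j) = (∑ j ∈ Finset.range N, ι K LSGen.z ^ j *
            (ι K LSGen.z * ι K LSGen.b - ι K LSGen.b * ι K LSGen.z) *
            ι K LSGen.z ^ (N - 1 - j)) * ι K LSGen.z := by
          rw [Finset.sum_mul]
          refine Finset.sum_congr rfl fun j hj => ?_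
          rw [Finset.mem_range] at hj
          rw [mul_assoc _ (_ ^ _) (ι K LSGen.z), ← pow_succ,
            show N - 1 - j + 1 = N + 1 - 1 - j by omega]
        rw [this, ih]
        simp only [Nat.add_sub_cancel, Nat.sub_self, pow_zero, mul_one, pow_succ]
        noncomm_ring
    have hsplit : ∀ c : ℕ × ℕ, gradedDer K LSGen.deg (lsValue K c.2)
        (coeff c.1 (lsExp (K := K))) =
        ((1 / c.1.factorial * (bernoulli c.2 / c.2.factorial) : ℚ) : K) •
          ∑ j ∈ Finset.range c.1, ι K LSGen.z ^ j *
            (fun f => ι K LSGen.z * f - f * ι K LSGen.z)^[c.2] (ι K LSGen.b - ι K LSGen.a) *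
            ι K LSGen.z ^ (c.1 - 1 - j) +
        if c.2 = 1 then ((1 / c.1.factorial : ℚ) : K) •
          (ι K LSGen.z ^ c.1 * ι K LSGen.b - ι K LSGen.b * ι K LSGen.z ^ c.1) else 0 := by
      intro c
      have h1 : coeff c.1 (lsExp (K := K)) =
          ((1 / c.1.factorial : ℚ) : K) • ι K LSGen.z ^ c.1 := coeff_mk _ _
      rw [h1, map_smul, gradedDer_z_pow, ← hb]
      simp only [lsValue, mul_add, add_mul, Finset.sum_add_distrib, smul_add]
      congr 1
      · simp only [mul_smul_comm, smul_mul_assoc, ← Finset.smul_sum, smul_smul, Rat.cast_mul]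
      · split_ifs <;> simp
    rw [coeff_seriesDer]
    simp only [hsplit, Finset.sum_add_distrib]
    rw [bernoulli_ad_identity, map_sub, ← mul_assoc, coeff_succ_mul_X, coeff_mul_C, mul_assoc,
      coeff_succ_X_mul, coeff_C_mul]
    rw [Finset.sum_eq_single (N, 1)]
    · simp only [lsExp, coeff_mk, if_true]
      simp only [smul_mul_assoc, mul_smul_comm, sub_mul]
      module
    · rintro ⟨p, q⟩ hpq hne
      rw [Finset.HasAntidiagonal.mem_antidiagonal] at hpq
      rw [if_neg]
      rintro rfl
      simp_all
    · simp

theorem lsD_C_sq_zero (x : LSGen) (hx : x.deg = -1)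
    (hv : ∀ r, lsValue K r x = if r = 1 then -(ι K x * ι K x) else 0) :
    lsD (X * C (ι K x)) = -((X * C (ι K x)) * (X * C (ι K x))) ∧
      lsD (lsD (C (ι K x))) = 0 := by
  have h1 : lsD (C (ι K x)) = -(C (ι K x) * (X * C (ι K x))) := by
    ext n
    rw [coeff_seriesDer_C, gradedDer_ι, hv, map_neg, coeff_C_mul]
    rcases n with _ | _ | n
    · simp
    · simp
    · simp [coeff_X]
  have hs : PowerSeries.map (gradSign K LSGen.deg).toRingHom (C (ι K x)) = -C (ι K x) := by
    ext n
    rw [coeff_map, map_neg, coeff_C]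
    split_ifs <;> simp [gradSign, hx]
  have hX : ∀ φ : PowerSeries (FreeAlgebra K LSGen), φ * X = X * φ := fun φ => commute_X φ
  refine ⟨?_, ?_⟩
  · rw [seriesDer_X_mul, h1]
    simp only [mul_neg, ← mul_assoc]
  · rw [h1, map_neg, seriesDer_mul, seriesDer_X_mul, h1, hs]
    simp only [mul_neg, neg_mul, neg_neg, ← mul_assoc, hX]
    simp only [mul_assoc]
    abel

theorem lsD_sq [CharZero K] (φ : PowerSeries (FreeAlgebra K LSGen)) : lsD (lsD φ) = 0 := by
  have ha := lsD_C_sq_zero (K := K) .a rfl fun r => rfl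
  have hb := lsD_C_sq_zero (K := K) .b rfl fun r => rfl
  have hm := seriesDer_sq_mul LSGen.deg (lsValue K) (lsValue_mem K)
  -- the square of the differential vanishes on the exponential of z
  have hE : lsD (lsD (lsExp (K := K))) = 0 := by
    have hsE : PowerSeries.map (gradSign K LSGen.deg).toRingHom (lsExp (K := K)) = lsExp := by
      ext n
      simp [lsExp, gradSign, LSGen.deg]
    have hsa : PowerSeries.map (gradSign K LSGen.deg).toRingHom (X * C (ι K LSGen.a)) =
        -(X * C (ι K LSGen.a)) := by
      rw [map_mul, map_X, ← mul_neg]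
      congr 1
      ext n
      rw [coeff_map, map_neg, coeff_C]
      split_ifs <;> simp [gradSign, LSGen.deg]
    have hD : lsD (lsExp (K := K)) =
        lsExp * (X * C (ι K LSGen.b)) - (X * C (ι K LSGen.a)) * lsExp := by
      rw [lsD_exp, show C (ι K LSGen.b) * X = X * C (ι K LSGen.b) from commute_X _]
    rw [hD, map_sub, seriesDer_mul _ _ lsExp, seriesDer_mul _ _ (X * C (ι K LSGen.a)), hsE, hsa,
      ha.1, hb.1, hD]
    noncomm_ring
  have hz : ∀ n, coeff n (lsD (lsD (C (ι K LSGen.z)))) = 0 := by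
    intro n
    induction n using Nat.strong_induction_on with
    | _ n ih =>
      have hpow : ∀ m t, t < n → coeff t (lsD (lsD (C (ι K LSGen.z ^ m)))) = 0 := by
        intro m
        induction m with
        | zero => intro t _; simp [seriesDer_one]
        | succ m ihm =>
          intro t ht
          rw [pow_succ, map_mul, hm, map_add, coeff_mul_C, coeff_C_mul, ihm t ht, ih t ht,
            zero_mul, mul_zero, add_zero]
      have h := congrArg (coeff (n + 1)) hE
      rw [coeff_seriesDer_sq, Finset.sum_eq_single (1, n)] at h
      · simpa [lsExp] using h
      · rintro ⟨p, q⟩ hpq hne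
        rw [Finset.HasAntidiagonal.mem_antidiagonal] at hpq
        have hC : C (coeff p (lsExp (K := K))) =
            ((1 / p.factorial : ℚ) : K) • C (ι K LSGen.z ^ p) := by
          ext k
          rw [coeff_smul, coeff_C, coeff_C]
          split_ifs <;> simp [lsExp]
        rw [hC, map_smul, map_smul, coeff_smul]
        rcases p with _ | _ | p
        · simp [seriesDer_one]
        · exact absurd (by simp at hpq ⊢; omega) hne
        · rw [hpow _ q (by simp at hpq; omega), smul_zero]
      · intro hn
        exact absurd (by simp [add_comm]) hn
  refine seriesDer_sq LSGen.deg (lsValue K) (lsValue_mem K) (fun x => ?_) φ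
  cases x with
  | a => exact ha.2
  | b => exact hb.2
  | z => ext n; simpa using hz n

end LS

section Model

variable (K : Type u) [Field K]

/-- The Lawrence–Sullivan differential. -/
noncomputable def lsDifferential [CharZero K] : (completeFreeLie K LSGen.deg).Differential :=
  derivationDifferential LSGen.deg (lsValue K) (lsValue_mem K) fun _ => lsD_sq _

/-- The Lawrence–Sullivan construction `𝔏`: the complete free DGL on `a`, `b`, `z` with the
Lawrence–Sullivan differential. -/
noncomputable def LSModel [CharZero K] : DGL.{u, u} K := completeFreeDGL (lsDifferential K)

/-- The generators `a`, `b`, `z` of the complete free Lie algebra, in their degrees. -/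
noncomputable def lsA : (completeFreeLie K LSGen.deg).obj (-1) :=
  completeFreeGen K LSGen.deg .a

/-- See `lsA`. -/
noncomputable def lsB : (completeFreeLie K LSGen.deg).obj (-1) :=
  completeFreeGen K LSGen.deg .b

/-- See `lsA`. -/
noncomputable def lsZ : (completeFreeLie K LSGen.deg).obj 0 :=
  completeFreeGen K LSGen.deg .z

end Model

/-! Write B(x) = x/(eˣ-1) and E(x) = (eˣ-1)/x. The equation w*v = u reads e^{ad_w}(v) - E(ad_w)(∂w)
= u. As BE = 1 and B eˣ = B + x, applying B(ad_w) turns it into ∂w = [w,v] + B(ad_w)(v-u)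
(`gaugeAct_eq_iff`). This is the formula for ∂z in 𝔏 with u, v, w in place of a, b, z. Hence (3):
z*b = a fixes ∂z, and a continuous differential is determined by its values on generators
(`map_d_of_gen`).

Gauge equations and morphisms. Since z*b = a in 𝔏, a morphism Φ yields Φ(z)*Φ(b) = Φ(a). No
continuity of Φ is needed: f(ad_z) is a polynomial in ad_z up to the image of a high power of ad_z,
and Φ carries that image into the image of the same power of ad_{Φ(z)}, which is small (`map_act`).
Conversely, a Lie morphism with prescribed values has to be built. The free Lie algebra is realised
inside the tensor algebra, so Lie elements are evaluated by Dynkin's right-normed bracketing divided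
by the length (`lieEval_br`). The series converge because a word of degree k has exactly -k letters
of degree -1, so a long word contains a long run of z (`dynkin_word_mem`).

From gauge to homotopy. The path p(t) = (-tw)*u satisfies p' = ∂w - [w,p], and its curvature ∂p +
½[p,p] solves a linear differential equation with initial value 0. So p + w dt is a Maurer–Cartan
form, from u to (-w)*u = v (`homotopic_of_gauge`).

From homotopy to gauge (`exists_gauge_of_homotopic`). Let p + q dt be a Maurer–Cartan form and solve
w' = (B+x)(ad_w)(q), w(0) = 0. Since E(B+x) = eˣ, the gauge transform of p + q dt by w(t) has no dt
component. It is still flat, which forces it to be constant in t, and at t = 0 it is u. At t = 1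
this says w(1)*v = u. The coefficients of w(t) are brackets of several different coefficients of q;
local nilpotency makes them tend to 0 and makes ad_{w(t)} topologically nilpotent on forms.

Both classes of DGL are handled together, as DGLs with a complete filtration: the zero filtration in
(1), bracket length in (2). What is used of them is `IsComplete`, `TopNilp` and, only for passing
from homotopy to gauge, `LocallyTopNilp`. -/

namespace DGL.Filtration

/-! ### Sums of null sequences in a complete DGL -/

variable {K : Type u} [Field K] {L : DGL.{u, v} K} (F : L.Filtration)

/-- A filtration is complete if its topology is Hausdorff and every null sequence is summable. -/
structure IsComplete : Prop where
  hausdorff : ∀ (k : ℤ) (x : L.obj k), (∀ n, x ∈ F.F n k) → x = 0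
  exists_sum : ∀ (k : ℤ) (p : F.series k), ∃ s, F.IsSum p.1 s

variable {F}

theorem IsSum.unique (hF : F.IsComplete) {k : ℤ} {p : ℕ → L.obj k} {s s' : L.obj k}
    (h : F.IsSum p s) (h' : F.IsSum p s') : s = s' := by
  rw [← sub_eq_zero]
  refine hF.hausdorff k _ fun n => ?_
  obtain ⟨N, hN⟩ := h n
  obtain ⟨M, hM⟩ := h' n
  have := (F.F n k).sub_mem (hM (max N M) (le_max_right _ _)) (hN (max N M) (le_max_left _ _))
  rwa [sub_sub_sub_cancel_left] at this

theorem IsSum.add {k : ℤ} {p p' : ℕ → L.obj k} {s s' : L.obj k}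
    (h : F.IsSum p s) (h' : F.IsSum p' s') : F.IsSum (p + p') (s + s') := by
  intro n
  obtain ⟨N, hN⟩ := h n
  obtain ⟨M, hM⟩ := h' n
  refine ⟨max N M, fun m hm => ?_⟩
  have := (F.F n k).add_mem (hN m (le_of_max_le_left hm)) (hM m (le_of_max_le_right hm))
  simpa [Finset.sum_add_distrib, add_sub_add_comm] using this

theorem IsSum.smul {k : ℤ} {p : ℕ → L.obj k} {s : L.obj k} (c : K)
    (h : F.IsSum p s) : F.IsSum (c • p) (c • s) := by
  intro n
  obtain ⟨N, hN⟩ := h n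
  refine ⟨N, fun m hm => ?_⟩
  have := (F.F n k).smul_mem c (hN m hm)
  simpa [Finset.smul_sum, smul_sub] using this

/-- The sum of a null sequence in a complete DGL, that is, the value of a series at `t = 1`. -/
noncomputable def sum (hF : F.IsComplete) (k : ℤ) : F.series k →ₗ[K] L.obj k where
  toFun p := (hF.exists_sum k p).choose
  map_add' p q := IsSum.unique hF (hF.exists_sum k (p + q)).choose_spec
    ((hF.exists_sum k p).choose_spec.add (hF.exists_sum k q).choose_spec)
  map_smul' c p := IsSum.unique hF (hF.exists_sum k (c • p)).choose_spec
    ((hF.exists_sum k p).choose_spec.smul c)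

theorem isSum_sum (hF : F.IsComplete) {k : ℤ} (p : F.series k) : F.IsSum p.1 (F.sum hF k p) :=
  (hF.exists_sum k p).choose_spec

theorem isSum_iff (hF : F.IsComplete) {k : ℤ} (p : F.series k) (s : L.obj k) :
    F.IsSum p.1 s ↔ F.sum hF k p = s :=
  ⟨fun h => (isSum_sum hF p).unique hF h, fun h => h ▸ isSum_sum hF p⟩

/-- The bound `N` is read off from the terms alone and not from the convergence to `s`. This gives
estimates that are uniform over families of sums. -/
theorem IsSum.mem_sub {k : ℤ} {p : ℕ → L.obj k} {s : L.obj k} (h : F.IsSum p s) {n N : ℕ}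
    (hN : ∀ i ≥ N, p i ∈ F.F n k) {m : ℕ} (hm : N ≤ m) :
    ∑ i ∈ Finset.range m, p i - s ∈ F.F n k := by
  obtain ⟨M, hM⟩ := h n
  have h1 := hM (max m M) (le_max_right _ _)
  have h2 : ∑ i ∈ Finset.Ico m (max m M), p i ∈ F.F n k :=
    Submodule.sum_mem _ fun i hi => hN i (hm.trans (Finset.mem_Ico.1 hi).1)
  rw [← Finset.sum_range_add_sum_Ico _ (le_max_left m M)] at h1
  have := (F.F n k).sub_mem h1 h2
  rwa [add_sub_right_comm, add_sub_cancel_right] at this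

theorem IsSum.mem {k : ℤ} {p : ℕ → L.obj k} {s : L.obj k} (h : F.IsSum p s) {n : ℕ}
    (hN : ∀ i, p i ∈ F.F n k) : s ∈ F.F n k := by
  simpa using h.mem_sub (N := 0) (m := 0) (fun i _ => hN i) le_rfl

theorem IsSum.succ {k : ℤ} {p : ℕ → L.obj k} {s : L.obj k} (h : F.IsSum p s) (h0 : p 0 = 0) :
    F.IsSum (fun i => p (i + 1)) s := by
  intro n
  obtain ⟨N, hN⟩ := h n
  refine ⟨N, fun m hm => ?_⟩
  have := hN (m + 1) (by omega)
  rwa [Finset.sum_range_succ', h0, add_zero] at this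

theorem isSum_of_eq_zero {k : ℤ} {p : ℕ → L.obj k} {N : ℕ} (h : ∀ i ≥ N, p i = 0) :
    F.IsSum p (∑ i ∈ Finset.range N, p i) := by
  intro n
  refine ⟨N, fun m hm => ?_⟩
  rw [← Finset.sum_range_add_sum_Ico _ hm, Finset.sum_eq_zero (s := Finset.Ico N m), add_zero,
    sub_self]
  · exact Submodule.zero_mem _
  · exact fun i hi => h i (Finset.mem_Ico.1 hi).1

theorem isSum_single {k : ℤ} {p : ℕ → L.obj k} (h : ∀ i, i ≠ 0 → p i = 0) :
    F.IsSum p (p 0) := by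
  simpa using isSum_of_eq_zero (F := F) (N := 1) fun i (hi : 1 ≤ i) => h i (by omega)

theorem sum_d (hF : F.IsComplete) (i j : ℤ) (h : j + 1 = i) (p : F.series i) :
    F.sum hF j (F.seriesD i j h p) = L.d i j h (F.sum hF i p) := by
  refine (isSum_iff hF _ _).1 fun n => ?_
  obtain ⟨N, hN⟩ := isSum_sum hF p n
  refine ⟨N, fun m hm => ?_⟩
  have := F.d_mem n i j h _ (hN m hm)
  simpa [seriesD_apply] using this

theorem sum_br (hF : F.IsComplete) (i j k : ℤ) (h : i + j = k) (p : F.series i)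
    (q : F.series j) :
    F.sum hF k (F.seriesBr i j k h p q) = L.br i j k h (F.sum hF i p) (F.sum hF j q) := by
  refine (isSum_iff hF _ _).1 fun n => ?_
  obtain ⟨N, hN⟩ := p.2 n
  obtain ⟨M, hM⟩ := q.2 n
  have hp : ∀ m, N ≤ m → _ := fun m => (isSum_sum hF p).mem_sub hN (m := m)
  have hq : ∀ m, M ≤ m → _ := fun m => (isSum_sum hF q).mem_sub hM (m := m)
  refine ⟨N + M, fun m hm => ?_⟩
  set P := ∑ a ∈ Finset.range m, p.1 a with hP
  set Q := ∑ b ∈ Finset.range m, q.1 b with hQ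
  have h1 : L.br i j k h P Q - L.br i j k h (F.sum hF i p) (F.sum hF j q) ∈ F.F n k := by
    have e1 := F.br_mem n i j k h _ Q (hp m (by omega))
    have e2 := F.br_mem_right n i j k h (F.sum hF i p) _ (hq m (by omega))
    have := add_mem e1 e2
    simpa [← hP, ← hQ] using this
  -- The Cauchy product sums over a triangle, the product of partial sums over a square. A pair
  -- outside the triangle has index sum at least `N + M`, so one of its factors is already in the
  -- `n`-th step.
  have h2 : ∑ l ∈ Finset.range m, (F.seriesBr i j k h p q).1 l - L.br i j k h P Q ∈ F.F n k := by
    have e1 : ∑ l ∈ Finset.range m, (F.seriesBr i j k h p q).1 l =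
        ∑ c ∈ (Finset.range m ×ˢ Finset.range m).filter (fun c => c.1 + c.2 < m),
          L.br i j k h (p.1 c.1) (q.1 c.2) := by
      simp only [seriesBr_apply]
      rw [Finset.sum_sigma']
      refine Finset.sum_nbij' (fun s => s.2) (fun c => ⟨c.1 + c.2, c⟩) ?_ ?_ ?_ ?_ ?_
      · rintro ⟨a, b, c⟩ hs
        simp only [Finset.mem_sigma, Finset.HasAntidiagonal.mem_antidiagonal, Finset.mem_filter,
          Finset.mem_product, Finset.mem_range] at hs ⊢
        omega
      · rintro ⟨b, c⟩ hs
        simp only [Finset.mem_sigma, Finset.HasAntidiagonal.mem_antidiagonal, Finset.mem_filter,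
          Finset.mem_product, Finset.mem_range] at hs ⊢
        exact ⟨hs.2, trivial⟩
      · rintro ⟨a, b, c⟩ hs
        simp only [Finset.mem_sigma, Finset.HasAntidiagonal.mem_antidiagonal] at hs
        obtain ⟨_, rfl⟩ := hs
        rfl
      · intros; rfl
      · intros; rfl
    have e2 : L.br i j k h P Q = ∑ c ∈ Finset.range m ×ˢ Finset.range m,
          L.br i j k h (p.1 c.1) (q.1 c.2) := by
      rw [hP, hQ, Finset.sum_product]
      simp only [map_sum, LinearMap.sum_apply]
      exact Finset.sum_comm
    rw [e1, e2, ← Finset.sum_filter_add_sum_filter_not (Finset.range m ×ˢ Finset.range m)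
      (fun c => c.1 + c.2 < m), sub_add_cancel_left]
    refine Submodule.neg_mem _ (Submodule.sum_mem _ fun c hc => ?_)
    simp only [Finset.mem_filter, Finset.mem_product, Finset.mem_range] at hc
    by_cases hcN : N ≤ c.1
    · exact F.br_mem n i j k h _ _ (hN _ hcN)
    · exact F.br_mem_right n i j k h _ _ (hM _ (by omega))
  have := add_mem h2 h1
  rwa [sub_add_sub_cancel] at this

/-! ### Power series in a topologically nilpotent operator -/

variable (F) in
/-- The powers of `ad_w` tend to `0`, uniformly on the DGL. -/
def TopNilp (w : L.obj 0) : Prop :=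
  ∀ n : ℕ, ∃ N : ℕ, ∀ (k : ℤ) (x : L.obj k), ((L.ad w k) ^ N) x ∈ F.F n k

theorem ad_mem (w : L.obj 0) {n : ℕ} {k : ℤ} {x : L.obj k} (hx : x ∈ F.F n k) :
    L.ad w k x ∈ F.F n k :=
  F.br_mem_right n 0 k k (zero_add k) w x hx

theorem TopNilp.exists_le {w : L.obj 0} (hw : F.TopNilp w) (n : ℕ) :
    ∃ N : ℕ, ∀ i ≥ N, ∀ (k : ℤ) (x : L.obj k), ((L.ad w k) ^ i) x ∈ F.F n k := by
  obtain ⟨N, hN⟩ := hw n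
  refine ⟨N, fun i hi k x => ?_⟩
  obtain ⟨j, rfl⟩ := Nat.exists_eq_add_of_le hi
  rw [pow_add, Module.End.mul_apply]
  exact hN k _

theorem TopNilp.neg {w : L.obj 0} (hw : F.TopNilp w) : F.TopNilp (-w) := by
  intro n
  obtain ⟨N, hN⟩ := hw n
  refine ⟨N, fun k x => ?_⟩
  have : L.ad (-w) k = -L.ad w k := map_neg (L.br 0 k k (zero_add k)) w
  rw [this, neg_pow]
  rcases neg_one_pow_eq_or (Module.End K (L.obj k)) N with h | h <;> rw [h]
  · simpa using hN k x
  · simpa using hN k x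

/-- The sequence `fᵢ ad_wⁱ(x)`. -/
noncomputable def actSeries {w : L.obj 0} (hw : F.TopNilp w) (f : PowerSeries K) (k : ℤ) :
    L.obj k →ₗ[K] F.series k where
  toFun x := ⟨fun i => PowerSeries.coeff i f • (L.ad w k ^ i) x, fun n => by
    obtain ⟨N, hN⟩ := hw.exists_le n
    exact ⟨N, fun i hi => Submodule.smul_mem _ _ (hN i hi k x)⟩⟩
  map_add' x y := by ext i; simp
  map_smul' c x := by ext i; simp [smul_comm c]

theorem actSeries_apply {w : L.obj 0} (hw : F.TopNilp w) (f : PowerSeries K) (k : ℤ)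
    (x : L.obj k) (i : ℕ) :
    (F.actSeries hw f k x).1 i = PowerSeries.coeff i f • (L.ad w k ^ i) x := rfl

/-- The operator `f(ad_w)`, for a power series `f`. -/
noncomputable def act (hF : F.IsComplete) {w : L.obj 0} (hw : F.TopNilp w) (f : PowerSeries K)
    (k : ℤ) : L.obj k →ₗ[K] L.obj k :=
  F.sum hF k ∘ₗ F.actSeries hw f k

section act

variable (hF : F.IsComplete) {w : L.obj 0} (hw : F.TopNilp w) (f g : PowerSeries K) (k : ℤ)

theorem isSum_act (x : L.obj k) :
    F.IsSum (fun i => PowerSeries.coeff i f • (L.ad w k ^ i) x) (F.act hF hw f k x) :=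
  isSum_sum hF (F.actSeries hw f k x)

theorem act_add : F.act hF hw (f + g) k = F.act hF hw f k + F.act hF hw g k := by
  have : F.actSeries hw (f + g) k = F.actSeries hw f k + F.actSeries hw g k := by
    ext x i; simp [actSeries_apply, add_smul]
  rw [act, this, LinearMap.comp_add]; rfl

theorem act_smul (c : K) : F.act hF hw (c • f) k = c • F.act hF hw f k := by
  have : F.actSeries hw (c • f) k = c • F.actSeries hw f k := by
    ext x i; simp [actSeries_apply, mul_smul]
  rw [act, this, LinearMap.comp_smul]; rfl

theorem act_one (x : L.obj k) : F.act hF hw 1 k x = x := by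
  refine (isSum_act hF hw 1 k x).unique hF ?_
  have := isSum_single (F := F)
    (p := fun i => PowerSeries.coeff i (1 : PowerSeries K) • (L.ad w k ^ i) x)
    (fun i hi => by simp [PowerSeries.coeff_one, hi])
  simpa using this

theorem act_X_mul (x : L.obj k) :
    F.act hF hw (PowerSeries.X * f) k x = L.ad w k (F.act hF hw f k x) := by
  refine ((isSum_act hF hw (PowerSeries.X * f) k x).succ (by simp)).unique hF ?_
  intro n
  obtain ⟨N, hN⟩ := isSum_act hF hw f k x n
  refine ⟨N, fun m hm => ?_⟩
  have := ad_mem w (hN m hm)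
  rw [map_sub, map_sum] at this
  simpa [PowerSeries.coeff_succ_X_mul, pow_succ'] using this

theorem act_X_pow_mul (n : ℕ) (x : L.obj k) :
    F.act hF hw (PowerSeries.X ^ n * f) k x = (L.ad w k ^ n) (F.act hF hw f k x) := by
  induction n with
  | zero => simp
  | succ n ih => rw [pow_succ', mul_assoc, act_X_mul, ih, pow_succ', Module.End.mul_apply]

theorem act_X (x : L.obj k) : F.act hF hw PowerSeries.X k x = L.ad w k x := by
  rw [← mul_one PowerSeries.X, act_X_mul, act_one]

theorem act_polynomial_mul (p : Polynomial K) (x : L.obj k) :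
    F.act hF hw (p * f) k x = Polynomial.aeval (L.ad w k) p (F.act hF hw f k x) := by
  induction p using Polynomial.induction_on' with
  | add p q hp hq => simp [add_mul, act_add, hp, hq]
  | monomial n a =>
    rw [← Polynomial.C_mul_X_pow_eq_monomial, Polynomial.coe_mul, Polynomial.coe_C,
      Polynomial.coe_pow, Polynomial.coe_X, ← PowerSeries.smul_eq_C_mul, smul_mul_assoc, act_smul,
      LinearMap.smul_apply, act_X_pow_mul]
    simp

/-- Splitting off X^N turns f(ad_w) into a polynomial in ad_w modulo the image of ad_wᴺ. Identities
that hold for polynomials then extend to power series without any continuity argument. -/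
theorem exists_act_eq_add (N : ℕ) : ∃ h : PowerSeries K, ∀ (k : ℤ) (x : L.obj k),
    F.act hF hw f k x = (L.ad w k ^ N) (F.act hF hw h k x) +
      Polynomial.aeval (L.ad w k) (f.trunc N) x := by
  refine ⟨PowerSeries.mk fun i => PowerSeries.coeff (i + N) f, fun k x => ?_⟩
  have h := congrArg (fun f => F.act hF hw f k x) (f.eq_X_pow_mul_shift_add_trunc N)
  simp only [act_add, LinearMap.add_apply, act_X_pow_mul] at h
  rw [h]
  congr 1
  rw [← mul_one ((f.trunc N : Polynomial K) : PowerSeries K), act_polynomial_mul, act_one]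

/-- For every N, both sides equal the same polynomial in ad_w applied to g(ad_w)(x), up to the image
of ad_wᴺ; for suitable N this image lies in the `n`-th step, and the topology is Hausdorff. -/
theorem act_mul (x : L.obj k) :
    F.act hF hw (f * g) k x = F.act hF hw f k (F.act hF hw g k x) := by
  rw [← sub_eq_zero]
  refine hF.hausdorff k _ fun n => ?_
  obtain ⟨N, hN⟩ := hw n
  obtain ⟨h, hh⟩ := exists_act_eq_add hF hw f N
  have e := congrArg (fun f => F.act hF hw (f * g) k x) (f.eq_X_pow_mul_shift_add_trunc N)
  simp only [add_mul, mul_assoc, act_add, LinearMap.add_apply, act_X_pow_mul,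
    act_polynomial_mul] at e
  rw [e, hh, add_sub_add_right_eq_sub]
  exact sub_mem (hN k _) (hN k _)

theorem act_neg_eq (hw' : F.TopNilp (-w)) (x : L.obj k) :
    F.act hF hw' f k x = F.act hF hw (PowerSeries.rescale (-1) f) k x := by
  refine (isSum_act hF hw' f k x).unique hF ?_
  convert isSum_act hF hw (PowerSeries.rescale (-1) f) k x using 2 with i
  have : L.ad (-w) k = -L.ad w k := map_neg (L.br 0 k k (zero_add k)) w
  rw [this, neg_pow, PowerSeries.coeff_rescale, mul_comm, mul_smul]
  rcases neg_one_pow_eq_or K i with h | h <;>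
    rcases Nat.even_or_odd i with h' | h' <;> simp [h'.neg_one_pow]

end act

/-- Morphisms commute with the operators `f(ad_w)`, even if they are not continuous. -/
theorem map_act {M : DGL.{u, w} K} {G : M.Filtration} (hF : F.IsComplete) (hG : G.IsComplete)
    (Φ : ∀ i : ℤ, L.obj i →ₗ[K] M.obj i)
    (hΦ : ∀ (i j k : ℤ) (h : i + j = k) (x : L.obj i) (y : L.obj j),
      Φ k (L.br i j k h x y) = M.br i j k h (Φ i x) (Φ j y))
    {w : L.obj 0} (hw : F.TopNilp w) (hw' : G.TopNilp (Φ 0 w)) (f : PowerSeries K) (k : ℤ)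
    (x : L.obj k) :
    Φ k (F.act hF hw f k x) = G.act hG hw' f k (Φ k x) := by
  have had : ∀ x, Φ k (L.ad w k x) = M.ad (Φ 0 w) k (Φ k x) := fun x => hΦ _ _ _ _ _ _
  have hpow : ∀ (n : ℕ) x, Φ k ((L.ad w k ^ n) x) = (M.ad (Φ 0 w) k ^ n) (Φ k x) := by
    intro n
    induction n with
    | zero => simp
    | succ n ih => intro x; rw [pow_succ', Module.End.mul_apply, had, ih, pow_succ',
        Module.End.mul_apply]
  have hpoly : ∀ (p : Polynomial K) x, Φ k (Polynomial.aeval (L.ad w k) p x) =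
      Polynomial.aeval (M.ad (Φ 0 w) k) p (Φ k x) := by
    intro p x
    simp [Polynomial.aeval_eq_sum_range, LinearMap.sum_apply, hpow]
  rw [← sub_eq_zero]
  refine hG.hausdorff k _ fun n => ?_
  -- Only the target has to be small: `Φ` carries the image of ad_wᴺ into the image of the N-th
  -- power of ad_{Φ(w)}, whatever the topology of the source.
  obtain ⟨N, hN⟩ := hw' n
  obtain ⟨h, hh⟩ := exists_act_eq_add hF hw f N
  obtain ⟨h', hh'⟩ := exists_act_eq_add hG hw' f N
  rw [hh, hh', map_add, hpow, hpoly, add_sub_add_right_eq_sub]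
  exact sub_mem (hN k _) (hN k _)

end DGL.Filtration

/-! ### Identities between eˣ, (eˣ-1)/x and x/(eˣ-1) -/

/-- The power series `(eˣ - 1) / x`. -/
noncomputable def expSubOneDiv (K : Type*) [Field K] [CharZero K] : PowerSeries K :=
  PowerSeries.mk fun n => algebraMap ℚ K (1 / (n + 1).factorial)

section PowerSeries

variable (K : Type*) [Field K] [CharZero K]

open PowerSeries

theorem X_mul_expSubOneDiv : X * expSubOneDiv K = exp K - 1 := by
  ext n
  cases n with
  | zero => simp
  | succ n => simp [coeff_succ_X_mul, expSubOneDiv, coeff_exp, coeff_one]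

theorem exp_eq_one_add : exp K = 1 + X * expSubOneDiv K := by
  rw [X_mul_expSubOneDiv]; ring

theorem bernoulli_mul_expSubOneDiv : bernoulliPowerSeries K * expSubOneDiv K = 1 := by
  have h := bernoulliPowerSeries_mul_exp_sub_one K
  rw [← X_mul_expSubOneDiv, mul_left_comm] at h
  exact mul_left_cancel₀ X_ne_zero (h.trans (mul_one X).symm)

/-- The series B + x = x eˣ/(eˣ-1) is thus the right-hand side of the Magnus equation: if w' =
(B+x)(ad_w)(q), then ((eˣ-1)/x)(ad_w) takes w' to e^{ad_w}(q). -/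
theorem expSubOneDiv_mul_bernoulli_add_X :
    expSubOneDiv K * (bernoulliPowerSeries K + X) = exp K := by
  rw [mul_add, mul_comm, bernoulli_mul_expSubOneDiv, exp_eq_one_add, mul_comm X]

theorem rescale_exp_mul_exp : rescale (-1) (exp K) * exp K = 1 := by
  rw [mul_comm]
  exact exp_mul_exp_neg_eq_one

theorem rescale_exp_mul_expSubOneDiv :
    rescale (-1) (exp K) * expSubOneDiv K = rescale (-1) (expSubOneDiv K) := by
  have h := congrArg (rescale (-1 : K)) (X_mul_expSubOneDiv K)
  have h2 : rescale (-1 : K) X = -X := by rw [rescale_X]; simp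
  rw [map_mul, h2, map_sub, map_one] at h
  refine mul_left_cancel₀ (X_ne_zero (R := K)) ?_
  rw [mul_left_comm, X_mul_expSubOneDiv, mul_sub, rescale_exp_mul_exp]
  linear_combination h

end PowerSeries

/-! ### The gauge action and its flow -/

namespace DGL.Filtration

variable {K : Type u} [Field K] [CharZero K] {L : DGL.{u, v} K} {F : L.Filtration}

open PowerSeries

section

variable (hF : F.IsComplete) {w : L.obj 0} (hw : F.TopNilp w)

/-- The gauge action of `w` on `v`. -/
noncomputable def gaugeAct (v : L.obj (-1)) : L.obj (-1) :=
  F.act hF hw (exp K) (-1) v -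
    F.act hF hw (expSubOneDiv K) (-1) (L.d 0 (-1) (by norm_num) w)

theorem gauge_iff (v u : L.obj (-1)) : F.Gauge w v u ↔ F.gaugeAct hF hw v = u := by
  have h := (isSum_act hF hw (exp K) (-1) v).add ((isSum_act hF hw (expSubOneDiv K) (-1)
    (L.d 0 (-1) (by norm_num) w)).smul (-1 : K))
  have e : (fun i => PowerSeries.coeff i (exp K) • (L.ad w (-1) ^ i) v) +
      (-1 : K) • (fun i => PowerSeries.coeff i (expSubOneDiv K) • (L.ad w (-1) ^ i)
        (L.d 0 (-1) (by norm_num) w)) = fun i => (1 / (i.factorial : K)) • ((L.ad w (-1)) ^ i) v -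
      (1 / ((i + 1).factorial : K)) • ((L.ad w (-1)) ^ i) (L.d 0 (-1) (by norm_num) w) := by
    ext i
    simp [coeff_exp, expSubOneDiv, sub_eq_add_neg]
  rw [e, neg_one_smul, ← sub_eq_add_neg] at h
  exact ⟨fun h' => h.unique hF h', fun h' => h' ▸ h⟩

/-- The operator B(ad_w) is injective, with inverse ((eˣ-1)/x)(ad_w), and B eˣ = B + x. This is the
link between the gauge action and the Lawrence–Sullivan differential. -/
theorem gaugeAct_eq_iff (v u : L.obj (-1)) : F.gaugeAct hF hw v = u ↔
    L.d 0 (-1) (by norm_num) w = L.ad w (-1) v +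
      F.act hF hw (bernoulliPowerSeries K) (-1) (v - u) := by
  set dw := L.d 0 (-1) (by norm_num) w
  have key : F.act hF hw (bernoulliPowerSeries K) (-1) (F.gaugeAct hF hw v) =
      L.ad w (-1) v + F.act hF hw (bernoulliPowerSeries K) (-1) v - dw := by
    rw [gaugeAct, map_sub, ← act_mul, ← act_mul, bernoulli_mul_expSubOneDiv, act_one,
      exp_eq_one_add, mul_add, mul_one, mul_left_comm, bernoulli_mul_expSubOneDiv, mul_one,
      act_add, LinearMap.add_apply, act_X, add_comm]
  have inj : ∀ x y, F.act hF hw (bernoulliPowerSeries K) (-1) x =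
      F.act hF hw (bernoulliPowerSeries K) (-1) y → x = y := by
    intro x y h
    have := congrArg (F.act hF hw (expSubOneDiv K) (-1)) h
    rwa [← act_mul, ← act_mul, mul_comm, bernoulli_mul_expSubOneDiv, act_one, act_one] at this
  constructor
  · rintro rfl
    rw [map_sub, key]
    abel
  · intro h
    apply inj
    rw [key, h, map_sub]
    abel

/-- With E(x) = (eˣ-1)/x, the terms in ∂w cancel because e^{-x}E(x) = E(-x) and ∂(-w) = -∂w. -/
theorem gaugeAct_neg (v : L.obj (-1)) (hw' : F.TopNilp (-w)) :
    F.gaugeAct hF hw' (F.gaugeAct hF hw v) = v := by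
  rw [gaugeAct, act_neg_eq hF hw, act_neg_eq hF hw, gaugeAct, map_sub, ← act_mul, ← act_mul,
    rescale_exp_mul_exp, rescale_exp_mul_expSubOneDiv, act_one, map_neg, map_neg, sub_neg_eq_add,
    sub_add_cancel]

/-- The coefficients of the path `t ↦ (tw) * v`. -/
noncomputable def flow (hw : F.TopNilp w) (v : L.obj (-1)) : F.series (-1) :=
  -- In (tw)*v the factor ∂(tw) = t ∂w raises the exponent of t by one, so the second series is
  -- shifted and starts with 0.
  F.actSeries hw (exp K) (-1) v - ⟨fun i => match i with
    | 0 => 0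
    | i + 1 => (F.actSeries hw (expSubOneDiv K) (-1) (L.d 0 (-1) (by norm_num) w)).1 i, fun n => by
      obtain ⟨N, hN⟩ := (F.actSeries hw (expSubOneDiv K) (-1) (L.d 0 (-1) (by norm_num) w)).2 n
      refine ⟨N + 1, fun i hi => ?_⟩
      obtain ⟨i, rfl⟩ := Nat.exists_eq_succ_of_ne_zero (n := i) (by omega)
      exact hN i (by omega)⟩

theorem flow_zero (v : L.obj (-1)) : (F.flow hw v).1 0 = v := by
  simp [flow, actSeries_apply]

theorem sum_flow (v : L.obj (-1)) : F.sum hF (-1) (F.flow hw v) = F.gaugeAct hF hw v := by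
  rw [flow, map_sub]
  congr 1
  exact (IsSum.succ (isSum_sum hF _) rfl).unique hF (isSum_act hF hw _ _ _)

/-- This is the differential equation p' = [w,p] - ∂w of the path p(t) = (tw)*v, coefficient by
coefficient. -/
theorem flow_succ (v : L.obj (-1)) (n : ℕ) : ((n : K) + 1) • (F.flow hw v).1 (n + 1) =
    L.ad w (-1) ((F.flow hw v).1 n) - if n = 0 then L.d 0 (-1) (by norm_num) w else 0 := by
  have hn : ((n : K) + 1) ≠ 0 := by exact_mod_cast Nat.succ_ne_zero n
  have hf : ∀ m : ℕ, ((m : K) + 1) * ((m + 1).factorial : K)⁻¹ = ((m.factorial : K))⁻¹ := by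
    intro m
    have : ((m : K) + 1) ≠ 0 := by exact_mod_cast Nat.succ_ne_zero m
    rw [Nat.factorial_succ]
    push_cast
    field_simp
  have h1 : ((n : K) + 1) • (F.actSeries hw (exp K) (-1) v).1 (n + 1) =
      L.ad w (-1) ((F.actSeries hw (exp K) (-1) v).1 n) := by
    rw [actSeries_apply, actSeries_apply, smul_smul, map_smul, pow_succ', Module.End.mul_apply]
    congr 1
    simpa [coeff_exp] using hf n
  cases n with
  | zero =>
    simp only [flow, Submodule.coe_sub, Pi.sub_apply, smul_sub, h1, if_true]
    simp [actSeries_apply, expSubOneDiv]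
  | succ n =>
    simp only [flow, Submodule.coe_sub, Pi.sub_apply, smul_sub, h1, map_sub, if_neg n.succ_ne_zero,
      sub_zero]
    congr 1
    rw [actSeries_apply, actSeries_apply, smul_smul, map_smul, pow_succ', Module.End.mul_apply]
    congr 1
    simpa [expSubOneDiv] using hf (n + 1)

end

/-! ### Maurer–Cartan forms and paths of flat elements -/

omit [CharZero K] in
theorem series_ext {k : ℤ} {p q : F.series k} (h : ∀ n, p.1 n = q.1 n) : p = q :=
  Subtype.ext (funext h)

/-- A path that moves by infinitesimal gauge transformations consists of flat elements. -/
theorem seriesD_eq_of_seriesDeriv {o e : ℤ} (ho : o = 0) (he : e = -1) {p : F.series (-1)}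
    {q : F.series o} (h0 : L.IsMC (p.1 0))
    (h : F.seriesDeriv (-1) e he.symm p =
      F.seriesD o e (by omega) q - F.seriesBr o (-1) e (by omega) q p) :
    F.seriesD (-1) (-2) (by norm_num) p =
      -((1 / 2 : K) • F.seriesBr (-1) (-1) (-2) (by norm_num) p p) := by
  subst ho he
  set R : F.series (-2) := F.seriesD (-1) (-2) (by norm_num) p +
    (1 / 2 : K) • F.seriesBr (-1) (-1) (-2) (by norm_num) p p with hR
  have hsymm : ∀ x y, F.seriesBr (-1) (-1) (-2) (by norm_num) x y =
      F.seriesBr (-1) (-1) (-2) (by norm_num) y x := fun x y => by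
    rw [F.seriesBr_antisymm (-1) (-1) (-2) (by norm_num) (by norm_num) x y,
      show (-1 : K) ^ ((-1 : ℤ) * -1) = -1 by norm_num]
    module
  -- Differentiate the curvature R and substitute p' = ∂q - [q,p]. By ∂² = 0, Leibniz and Jacobi
  -- only -[q,R] survives.
  have hd : F.seriesDeriv (-2) (-2) rfl R = -F.seriesBr 0 (-2) (-2) (by norm_num) q R := by
    have h1 := F.seriesDeriv_D (-1) (-2) (-1) (-2) (by norm_num) (by norm_num) rfl rfl p
    have h2 := F.seriesDeriv_br (-1) (-1) (-2) (-1) (-1) (-2) (by norm_num) rfl rfl rfl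
      (by norm_num) (by norm_num) p p
    have h3 := F.seriesD_br 0 (-1) (-1) (-1) (-2) (-2) (by norm_num) (by norm_num) (by norm_num)
      (by norm_num) (by norm_num) (by norm_num) q p
    have h4 := F.seriesBr_jacobi 0 (-1) (-1) (-1) (-2) (-1) (-2) (by norm_num) (by norm_num)
      (by norm_num) (by norm_num) (by norm_num) (by norm_num) q p p
    have h5 := F.seriesD_sq 0 (-1) (-2) (by norm_num) (by norm_num) q
    rw [hsymm p (F.seriesDeriv _ _ _ p)] at h2
    rw [hsymm p (F.seriesBr _ _ _ _ q p)] at h4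
    simp only [zero_mul, zpow_zero, one_smul] at h3 h4
    rw [hR, map_add, map_smul, h2, ← h1, h, map_add, map_smul, h4, map_sub, map_sub, h5, h3,
      LinearMap.sub_apply]
    module
  -- In the linear equation R' = -[q,R] the coefficient of tⁿ⁺¹ depends only on earlier ones, and
  -- R(0) = 0 as the path starts at a flat element.
  have hz : ∀ n, R.1 n = 0 := by
    intro n
    induction n using Nat.strong_induction_on with
    | _ n ih =>
      cases n with
      | zero =>
        have := h0
        unfold IsMC at this
        simp [hR, seriesD_apply, seriesBr_apply, this]
      | succ n =>
        have := congrArg (fun p : F.series (-2) => p.1 n) hd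
        simp only [seriesDeriv_apply, Submodule.coe_neg, Pi.neg_apply, seriesBr_apply] at this
        rw [Finset.sum_eq_zero, neg_zero] at this
        · refine (smul_eq_zero.1 this).resolve_left ?_
          exact_mod_cast Nat.succ_ne_zero n
        · intro c hc
          rw [Finset.HasAntidiagonal.mem_antidiagonal] at hc
          rw [ih c.2 (by omega), map_zero]
  have : R = 0 := series_ext hz
  exact eq_neg_of_add_eq_zero_left this

/-- Separate the components without and with dt. The signs of the latter come from |p| = -1 and
[p,q] = -[q,p], as q has degree 0. -/
theorem forms_isMC_iff (p : F.series (-1)) (q : F.series (-1 + 1)) :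
    F.forms.IsMC (show F.forms.obj (-1) from (p, q)) ↔
      F.seriesD (-1) (-2) (by norm_num) p =
        -((1 / 2 : K) • F.seriesBr (-1) (-1) (-2) (by norm_num) p p) ∧
      F.seriesDeriv (-1) (-2 + 1) (by norm_num) p =
        F.seriesD (-1 + 1) (-2 + 1) (by norm_num) q -
          F.seriesBr (-1 + 1) (-1) (-2 + 1) (by norm_num) q p := by
  have hd : F.forms.d (-1) (-2) (by norm_num) (show F.forms.obj (-1) from (p, q)) =
    (show F.forms.obj (-2) from (F.seriesD (-1) (-2) (by norm_num) p,
      F.seriesD (-1 + 1) (-2 + 1) (by norm_num) q +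
      (-1 : K) ^ (-1 : ℤ) • F.seriesDeriv (-1) (-2 + 1) (by norm_num) p)) := rfl
  have hb : F.forms.br (-1) (-1) (-2) (by norm_num) (show F.forms.obj (-1) from (p, q))
      (show F.forms.obj (-1) from (p, q)) =
    (show F.forms.obj (-2) from (F.seriesBr (-1) (-1) (-2) (by norm_num) p p,
      F.seriesBr (-1) (-1 + 1) (-2 + 1) (by norm_num) p q +
      (-1 : K) ^ (-1 : ℤ) • F.seriesBr (-1 + 1) (-1) (-2 + 1) (by norm_num) q p)) := rfl
  unfold IsMC
  rw [hd, hb]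
  have hanti := F.seriesBr_antisymm (-1) (-1 + 1) (-2 + 1) (by norm_num) (by norm_num) p q
  rw [show (-1 : ℤ) * (-1 + 1) = 0 by norm_num, zpow_zero, one_smul] at hanti
  refine Iff.trans (Prod.ext_iff) (and_congr Iff.rfl ?_)
  show _ = -((1 / 2 : K) • (_ : F.series (-2 + 1))) ↔ _
  rw [hanti, show (-1 : K) ^ (-1 : ℤ) = -1 by norm_num]
  constructor
  · intro h
    rw [← sub_eq_zero] at h ⊢
    rw [← neg_eq_zero, ← h]
    module
  · intro h
    rw [h]
    module

omit [CharZero K] in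
theorem series_const_mem {k : ℤ} (x : L.obj k) :
    (fun i => if i = 0 then x else 0 : ℕ → L.obj k) ∈ F.series k := fun n =>
  ⟨1, fun i hi => by
    show (if i = 0 then x else 0) ∈ _
    rw [if_neg (by omega)]
    exact zero_mem _⟩

/-- The path from `v` to `u` given by a gauge transformation. -/
theorem homotopic_of_gauge (hF : F.IsComplete) {w : L.obj 0} (hw : F.TopNilp w)
    {u v : L.obj (-1)} (hu : L.IsMC u) (h : F.Gauge w v u) : F.Homotopic u v := by
  rw [gauge_iff hF hw] at h
  subst h
  set u := F.gaugeAct hF hw v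
  -- The path has to begin at u = w*v and end at v, so the flow of -w is run from u; the dt part of
  -- the form is then the constant w.
  let q : F.series (-1 + 1) := ⟨_, series_const_mem (k := 0) w⟩
  have hd : F.seriesDeriv (-1) (-2 + 1) (by norm_num) (F.flow hw.neg u) =
        F.seriesD (-1 + 1) (-2 + 1) (by norm_num) q -
          F.seriesBr (-1 + 1) (-1) (-2 + 1) (by norm_num) q (F.flow hw.neg u) := by
    refine series_ext (k := -1) fun n => ?_
    have hneg : L.ad (-w) (-1) = -L.ad w (-1) := map_neg (L.br 0 (-1) (-1) (zero_add _)) w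
    have e := flow_succ hw.neg u n
    rw [hneg, map_neg] at e
    refine e.trans ?_
    have e1 : (F.seriesBr (-1 + 1) (-1) (-2 + 1) (by norm_num) q (F.flow hw.neg u)).1 n =
        L.ad w (-1) ((F.flow hw.neg u).1 n) := by
      rw [seriesBr_apply, Finset.sum_eq_single (0, n)]
      · rfl
      · rintro ⟨a, b⟩ hab hne
        rw [Finset.HasAntidiagonal.mem_antidiagonal] at hab
        have : q.1 a = 0 := if_neg (by rintro rfl; simp_all)
        rw [this, map_zero, LinearMap.zero_apply]
      · simp
    have e2 : (F.seriesD (-1 + 1) (-2 + 1) (by norm_num) q).1 n =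
        if n = 0 then L.d 0 (-1) (by norm_num) w else 0 := by
      show L.d 0 (-1) (by norm_num) (if n = 0 then w else 0) = _
      split_ifs <;> simp
    refine Eq.trans ?_ (congrArg₂ (· - ·) e2 e1).symm
    simp only [LinearMap.neg_apply]
    split_ifs <;> abel
  refine ⟨(F.flow hw.neg u, q), (forms_isMC_iff _ _).2 ⟨seriesD_eq_of_seriesDeriv (by norm_num)
    (by norm_num) (by rwa [flow_zero]) hd, hd⟩, ?_, ?_⟩
  · have := isSum_single (F := F) (p := fun i => (0 : K) ^ i • (F.flow hw.neg u).1 i)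
      fun i hi => by simp [hi]
    simp only [pow_zero, one_smul, flow_zero] at this
    exact this
  · have := isSum_sum hF (F.flow hw.neg u)
    rw [sum_flow, gaugeAct_neg] at this
    simpa [EvalsTo] using this

/-- Gauge transformations preserve flat elements. -/
theorem isMC_gaugeAct (hF : F.IsComplete) {w : L.obj 0} (hw : F.TopNilp w)
    {v : L.obj (-1)} (hv : L.IsMC v) : L.IsMC (F.gaugeAct hF hw v) := by
  -- The flow of w is driven by the constant -w. It therefore stays flat, and its value at t = 1 is
  -- w*v.
  have hd : F.seriesDeriv (-1) (-1) rfl (F.flow hw v) =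
        F.seriesD 0 (-1) (by norm_num) ⟨_, series_const_mem (-w)⟩ -
          F.seriesBr 0 (-1) (-1) (by norm_num) ⟨_, series_const_mem (-w)⟩ (F.flow hw v) := by
    refine series_ext fun n => ?_
    refine (flow_succ hw v n).trans ?_
    rw [Submodule.coe_sub, Pi.sub_apply, seriesBr_apply, Finset.sum_eq_single (0, n)]
    · simp only [seriesD_apply, ad]
      split_ifs <;> simp; abel
    · rintro ⟨a, b⟩ hab hne
      rw [Finset.HasAntidiagonal.mem_antidiagonal] at hab
      have : (if a = 0 then -w else 0) = 0 := if_neg (by rintro rfl; simp_all)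
      simp only [this, map_zero, LinearMap.zero_apply]
    · simp
  have h := seriesD_eq_of_seriesDeriv rfl rfl (by rwa [flow_zero]) hd
  have h' := congrArg (F.sum hF (-2)) h
  rw [map_neg, map_smul, sum_d, sum_br, sum_flow] at h'
  exact h'

end DGL.Filtration

/-! ### Weighted iterated brackets and the Magnus equation -/

/-- A causal operator on sequences has a fixed point. -/
theorem exists_fixedPoint_of_causal {α : Type*} [Inhabited α] (P : (ℕ → α) → ℕ → α)
    (hP : ∀ f g n, (∀ m < n, f m = g m) → P f n = P g n) : ∃ f, P f = f := by
  -- Iterating from any starting sequence, entry n no longer changes after n + 1 steps; the fixed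
  -- point is the diagonal of the stable entries.
  let W : ℕ → ℕ → α := fun m => P^[m] default
  have hW : ∀ m, W (m + 1) = P (W m) := fun m => Function.iterate_succ_apply' P m default
  have key : ∀ m n, n < m → W (m + 1) n = W m n := by
    intro m
    induction m with
    | zero => intro n hn; omega
    | succ m ih =>
      intro n hn
      rw [hW (m + 1), hW m]
      exact hP _ _ _ fun l hl => (congrFun (hW m).symm l).symm ▸ ih l (by omega)
  have key2 : ∀ n m, n < m → W m n = W (n + 1) n := by
    intro n m hm
    induction m, hm using Nat.le_induction with
    | base => rfl
    | succ m hm ih => rw [key m n hm, ih]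
  refine ⟨fun n => W (n + 1) n, funext fun n => ?_⟩
  rw [hW n]
  exact hP _ _ _ fun m hm => (key2 m n hm).symm

namespace DGL

variable {K : Type u} [Field K] (L : DGL.{u, v} K)

/-- Iterated brackets of the `qᵢ`, where `qᵢ` has weight `i + 1`. -/
inductive IsAdWord (q : ℕ → L.obj 0) : ℕ → L.obj 0 → Prop
  | gen (i : ℕ) : IsAdWord q (i + 1) (q i)
  | br (i : ℕ) {n : ℕ} {x : L.obj 0} (hx : IsAdWord q n x) :
      IsAdWord q (n + (i + 1)) (L.ad (q i) 0 x)

/-- The span of the iterated brackets of weight `n` of the `qᵢ`. -/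
def adWordSpan (q : ℕ → L.obj 0) (n : ℕ) : Submodule K (L.obj 0) :=
  Submodule.span K {x | L.IsAdWord q n x}

/-- The span of the images of all products of `s` operators `ad_{qᵢ}`. -/
def adSpan (q : ℕ → L.obj 0) (k : ℤ) : ℕ → Submodule K (L.obj k)
  | 0 => ⊤
  | s + 1 => Submodule.span K {y | ∃ i, ∃ x ∈ adSpan q k s, L.ad (q i) k x = y}

variable {L} {q : ℕ → L.obj 0}

theorem ad_mem_adSpan (i : ℕ) {k : ℤ} {s : ℕ} {x : L.obj k} (hx : x ∈ L.adSpan q k s) :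
    L.ad (q i) k x ∈ L.adSpan q k (s + 1) :=
  Submodule.subset_span ⟨i, x, hx, rfl⟩

theorem adSpan_succ_le (k : ℤ) (s : ℕ) : L.adSpan q k (s + 1) ≤ L.adSpan q k s := by
  induction s with
  | zero => exact le_top
  | succ s ih =>
    refine Submodule.span_le.2 ?_
    rintro _ ⟨i, x, hx, rfl⟩
    exact ad_mem_adSpan i (ih hx)

theorem adSpan_anti (k : ℤ) {s t : ℕ} (h : s ≤ t) : L.adSpan q k t ≤ L.adSpan q k s := by
  induction t, h using Nat.le_induction with
  | base => exact le_rfl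
  | succ n _ ih => exact (adSpan_succ_le k n).trans ih

theorem ad_ad (x y : L.obj 0) (k : ℤ) (z : L.obj k) :
    L.ad (L.ad x 0 y) k z = L.ad x k (L.ad y k z) - L.ad y k (L.ad x k z) := by
  have := L.lie.jacobi 0 0 k 0 k k k (by norm_num) (by norm_num) (by norm_num) (by norm_num)
    (by norm_num) (by norm_num) x y z
  rw [zero_mul, zpow_zero, one_smul] at this
  exact eq_sub_of_add_eq this.symm

/-- The operator ad of an iterated bracket is an iterated commutator of the ad_{qᵢ}, hence a
combination of products of at least one of them, and `adSpan` decreases. -/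
theorem IsAdWord.ad_mem_adSpan {n : ℕ} {x : L.obj 0} (hx : L.IsAdWord q n x) :
    ∀ {k : ℤ} {s : ℕ} {y : L.obj k}, y ∈ L.adSpan q k s → L.ad x k y ∈ L.adSpan q k (s + 1) := by
  induction hx with
  | gen i => exact fun hy => DGL.ad_mem_adSpan i hy
  | br i _ ih =>
    intro k s y hy
    rw [ad_ad]
    exact sub_mem (adSpan_succ_le _ _ (DGL.ad_mem_adSpan i (ih hy)))
      (adSpan_succ_le _ _ (ih (DGL.ad_mem_adSpan i hy)))

theorem ad_mem_adSpan_of_mem {n : ℕ} {x : L.obj 0} (hx : x ∈ L.adWordSpan q n) {k : ℤ} {s : ℕ}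
    {y : L.obj k} (hy : y ∈ L.adSpan q k s) : L.ad x k y ∈ L.adSpan q k (s + 1) := by
  have : L.adWordSpan q n ≤ (L.adSpan q k (s + 1)).comap
      ((L.br 0 k k (zero_add k)).flip y) :=
    Submodule.span_le.2 fun x hx => IsAdWord.ad_mem_adSpan hx hy
  exact this hx

/-- The words are right-normed; by Jacobi their span is closed under all brackets, and weights add.
-/
theorem IsAdWord.ad_mem_adWordSpan {n : ℕ} {x : L.obj 0} (hx : L.IsAdWord q n x) :
    ∀ {m : ℕ} {y : L.obj 0}, y ∈ L.adWordSpan q m → L.ad x 0 y ∈ L.adWordSpan q (m + n) := by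
  have hgen : ∀ (i : ℕ) {m : ℕ} {y : L.obj 0}, y ∈ L.adWordSpan q m →
      L.ad (q i) 0 y ∈ L.adWordSpan q (m + (i + 1)) := by
    intro i m y hy
    have : L.adWordSpan q m ≤ (L.adWordSpan q (m + (i + 1))).comap (L.ad (q i) 0) :=
      Submodule.span_le.2 fun y hy => Submodule.subset_span (.br i hy)
    exact this hy
  induction hx with
  | gen i => exact hgen i
  | @br i n x _ ih =>
    intro m y hy
    rw [ad_ad]
    have h1 := hgen i (ih hy)
    have h2 := ih (hgen i hy)
    rw [add_assoc] at h1
    rw [add_assoc, add_comm (i + 1)] at h2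
    exact sub_mem h1 h2

theorem ad_mem_adWordSpan {m n : ℕ} {x y : L.obj 0} (hx : x ∈ L.adWordSpan q n)
    (hy : y ∈ L.adWordSpan q m) : L.ad x 0 y ∈ L.adWordSpan q (m + n) := by
  have : L.adWordSpan q n ≤ (L.adWordSpan q (m + n)).comap
      ((L.br 0 0 0 (zero_add 0)).flip y) :=
    Submodule.span_le.2 fun x hx => IsAdWord.ad_mem_adWordSpan hx hy
  exact this hx

variable (L) in
/-- `ad_w` for sequences `w` and `x`, as coefficients of power series. -/
def seqAd (w x : ℕ → L.obj 0) (n : ℕ) : L.obj 0 :=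
  ∑ c ∈ Finset.HasAntidiagonal.antidiagonal n, L.ad (w c.1) 0 (x c.2)

theorem seqAd_iterate_congr {w w' : ℕ → L.obj 0} (i : ℕ) {n : ℕ} (h : ∀ m ≤ n, w m = w' m) :
    (L.seqAd w)^[i] q n = (L.seqAd w')^[i] q n := by
  induction i generalizing n with
  | zero => rfl
  | succ i ih =>
    rw [Function.iterate_succ_apply', Function.iterate_succ_apply']
    refine Finset.sum_congr rfl fun c hc => ?_
    rw [Finset.HasAntidiagonal.mem_antidiagonal] at hc
    rw [h c.1 (by omega), ih fun m hm => h m (by omega)]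

/-- The coefficient `q n` has weight n + 1, one more than its index. This matches integration, which
moves the n-th coefficient of w' to place n + 1 of w. -/
theorem seqAd_iterate_mem {w : ℕ → L.obj 0} (i : ℕ) {n : ℕ}
    (h : ∀ m ≤ n, w m ∈ L.adWordSpan q m) :
    (L.seqAd w)^[i] q n ∈ L.adWordSpan q (n + 1) := by
  induction i generalizing n with
  | zero => exact Submodule.subset_span (.gen n)
  | succ i ih =>
    rw [Function.iterate_succ_apply']
    refine Submodule.sum_mem _ fun c hc => ?_
    rw [Finset.HasAntidiagonal.mem_antidiagonal] at hc
    have := ad_mem_adWordSpan (h c.1 (by omega)) (ih (n := c.2) fun m hm => h m (by omega))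
    rwa [show c.2 + 1 + c.1 = n + 1 by omega] at this

/-- The power series solution of `w' = g(ad_w)(q)`, `w(0) = 0`. -/
theorem exists_seqAd_solution [CharZero K] (q : ℕ → L.obj 0) (g : ℕ → K) : ∃ w : ℕ → L.obj 0,
    w 0 = 0 ∧ (∀ n, w n ∈ L.adWordSpan q n) ∧
    ∀ n : ℕ, ((n : K) + 1) • w (n + 1) =
      ∑ i ∈ Finset.range (n + 1), g i • (L.seqAd w)^[i] q n := by
  have : Inhabited (L.obj 0) := ⟨0⟩
  -- Only w₀, …, wₙ enter into wₙ₊₁. Stopping the sum at i = n loses nothing: since w₀ = 0, the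
  -- terms with i > n vanish (`seqAd_iterate_eq_zero`).
  obtain ⟨w, hw⟩ := exists_fixedPoint_of_causal (α := L.obj 0) (fun w (n : ℕ) => match n with
    | 0 => 0
    | n + 1 => ((n : K) + 1)⁻¹ • ∑ i ∈ Finset.range (n + 1), g i • (L.seqAd w)^[i] q n) (by
      intro w w' n h
      cases n with
      | zero => rfl
      | succ n =>
        simp only
        congr 1
        refine Finset.sum_congr rfl fun i _ => ?_
        rw [seqAd_iterate_congr i fun m hm => h m (by omega)])
  have h0 : w 0 = 0 := (congrFun hw 0).symm
  have hs : ∀ n, w (n + 1) =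
      ((n : K) + 1)⁻¹ • ∑ i ∈ Finset.range (n + 1), g i • (L.seqAd w)^[i] q n :=
    fun n => (congrFun hw (n + 1)).symm
  refine ⟨w, h0, fun n => ?_, fun n => ?_⟩
  · induction n using Nat.strong_induction_on with
    | _ n ih =>
      cases n with
      | zero => rw [h0]; exact zero_mem _
      | succ n =>
        rw [hs]
        exact Submodule.smul_mem _ _ (Submodule.sum_mem _ fun i _ => Submodule.smul_mem _ _
          (seqAd_iterate_mem i fun m hm => ih m (by omega)))
  · rw [hs, smul_smul, mul_inv_cancel₀, one_smul]
    exact_mod_cast Nat.succ_ne_zero n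

/-! ### Local topological nilpotency and the filtered DGL of forms -/

namespace Filtration

variable (F : L.Filtration)

/-- Long products of the operators `ad_{qᵢ}` tend to `0`, for every null sequence `q`. -/
def LocallyTopNilp : Prop :=
  ∀ q : F.series 0, ∀ n : ℕ, ∃ N : ℕ, ∀ k : ℤ, L.adSpan q.1 k N ≤ F.F n k

variable {F}

/-- All but finitely many `qᵢ` lie in the ideal `F.F n`. A word in the first `d` of them has weight
at most `d` per letter, so large weight forces many letters, and long products of the ad_{qᵢ} are
small. -/
theorem exists_adWordSpan_le (h : F.LocallyTopNilp) (q : F.series 0) (n : ℕ) :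
    ∃ N : ℕ, ∀ m ≥ N, L.adWordSpan q.1 m ≤ F.F n 0 := by
  obtain ⟨N, hN⟩ := h q n
  obtain ⟨d, hd⟩ := q.2 n
  have key : ∀ m x, L.IsAdWord q.1 m x →
      x ∈ F.F n 0 ∨ ∃ s, x ∈ L.adSpan q.1 0 s ∧ m ≤ (s + 1) * d := by
    intro m x hx
    induction hx with
    | gen i =>
      by_cases hi : d ≤ i
      · exact Or.inl (hd i hi)
      · exact Or.inr ⟨0, Submodule.mem_top, by omega⟩
    | @br i m x _ ih =>
      by_cases hi : d ≤ i
      · exact Or.inl (F.br_mem n 0 0 0 _ _ _ (hd i hi))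
      · obtain ih | ⟨s, hs, hm⟩ := ih
        · exact Or.inl (ad_mem _ ih)
        · refine Or.inr ⟨s + 1, DGL.ad_mem_adSpan i hs, ?_⟩
          rw [add_mul _ 1 d]
          omega
  refine ⟨(N + 1) * d + 1, fun m hm => Submodule.span_le.2 fun x hx => ?_⟩
  obtain hx | ⟨s, hs, hms⟩ := key m x hx
  · exact hx
  · refine hN 0 (adSpan_anti 0 ?_ hs)
    by_contra hlt
    have : (s + 1) * d ≤ (N + 1) * d := Nat.mul_le_mul_right d (by omega)
    omega

variable (F) in
/-- The series with coefficients in the `n`-th step of the filtration. -/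
def seriesF (n : ℕ) (k : ℤ) : Submodule K (F.series k) where
  carrier := {p | ∀ i, p.1 i ∈ F.F n k}
  zero_mem' _ := (F.F n k).zero_mem
  add_mem' hp hq i := (F.F n k).add_mem (hp i) (hq i)
  smul_mem' c _ hp i := (F.F n k).smul_mem c (hp i)

theorem seriesBr_mem {n : ℕ} {i j k : ℤ} (h : i + j = k) {p : F.series i} (q : F.series j)
    (hp : p ∈ F.seriesF n i) : F.seriesBr i j k h p q ∈ F.seriesF n k :=
  fun m => by
    rw [seriesBr_apply]
    exact Submodule.sum_mem _ fun c _ => F.br_mem n i j k h _ _ (hp c.1)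

theorem seriesDeriv_mem {n : ℕ} {i j : ℤ} (h : i = j) {p : F.series i}
    (hp : p ∈ F.seriesF n i) : F.seriesDeriv i j h p ∈ F.seriesF n j := by
  subst h
  exact fun _ => Submodule.smul_mem _ _ (hp _)

variable (F) in
/-- The coefficientwise filtration of the DGL of forms. -/
def formsFiltration : F.forms.Filtration where
  F n k := (F.seriesF n k).prod (F.seriesF n (k + 1))
  anti n k _ h := ⟨fun i => F.anti n k (h.1 i), fun i => F.anti n (k + 1) (h.2 i)⟩
  br_mem n i j k h x y hx := ⟨seriesBr_mem h _ hx.1,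
    add_mem (seriesBr_mem (by omega) _ hx.1)
      (Submodule.smul_mem _ _ (seriesBr_mem (by omega) _ hx.2))⟩
  d_mem n i j h x hx := ⟨fun m => F.d_mem n i j h _ (hx.1 m),
    add_mem (fun m => F.d_mem n (i + 1) (j + 1) (by omega) _ (hx.2 m))
      (Submodule.smul_mem _ _ (seriesDeriv_mem _ hx.1))⟩

/-- Sum coefficientwise. Modulo the `n`-th step all coefficients of the limit agree with those of
one fixed partial sum, which is why they again form a null sequence. -/
theorem exists_series_sum (hF : F.IsComplete) {k : ℤ} (P : ℕ → F.series k)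
    (hP : ∀ n, ∃ N, ∀ i ≥ N, P i ∈ F.seriesF n k) :
    ∃ s : F.series k, ∀ n, ∃ N, ∀ m ≥ N, ∑ i ∈ Finset.range m, P i - s ∈ F.seriesF n k := by
  let c : ℕ → F.series k := fun j => ⟨fun i => (P i).1 j, fun n => by
    obtain ⟨N, hN⟩ := hP n
    exact ⟨N, fun i hi => hN i hi j⟩⟩
  have hs : ∀ n, ∃ N, ∀ m ≥ N, ∀ j, (∑ i ∈ Finset.range m, (P i).1 j) - F.sum hF k (c j) ∈
      F.F n k := by
    intro n
    obtain ⟨N, hN⟩ := hP n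
    exact ⟨N, fun m hm j => (isSum_sum hF (c j)).mem_sub (fun i hi => hN i hi j) hm⟩
  refine ⟨⟨fun j => F.sum hF k (c j), fun n => ?_⟩, fun n => ?_⟩
  · obtain ⟨N, hN⟩ := hs n
    obtain ⟨M, hM⟩ := (∑ i ∈ Finset.range N, P i).2 n
    refine ⟨M, fun j hj => ?_⟩
    have h1 := hM j hj
    have h2 := hN N le_rfl j
    have e : (∑ i ∈ Finset.range N, P i).1 j = ∑ i ∈ Finset.range N, (P i).1 j := by
      rw [AddSubmonoidClass.coe_finsetSum, Finset.sum_apply]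
    rw [e] at h1
    have := sub_mem h1 h2
    rwa [sub_sub_cancel] at this
  · obtain ⟨N, hN⟩ := hs n
    refine ⟨N, fun m hm j => ?_⟩
    have e : (∑ i ∈ Finset.range m, P i).1 j = ∑ i ∈ Finset.range m, (P i).1 j := by
      rw [AddSubmonoidClass.coe_finsetSum, Finset.sum_apply]
    show (∑ i ∈ Finset.range m, P i).1 j - F.sum hF k (c j) ∈ _
    rw [e]
    exact hN m hm j

variable (F) in
/-- The component without `dt` of a form. -/
def formsFst (k : ℤ) : F.forms.obj k →ₗ[K] F.series k where
  toFun x := x.1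
  map_add' _ _ := rfl
  map_smul' _ _ := rfl

variable (F) in
/-- The component with `dt` of a form. -/
def formsSnd (k : ℤ) : F.forms.obj k →ₗ[K] F.series (k + 1) where
  toFun x := x.2
  map_add' _ _ := rfl
  map_smul' _ _ := rfl

theorem forms_fst_sum_sub (m : Finset ℕ) {k : ℤ} (P : ℕ → F.forms.obj k)
    (s : F.forms.obj k) : (∑ i ∈ m, P i - s).1 = ∑ i ∈ m, (P i).1 - s.1 :=
  (map_sub (F.formsFst k) _ _).trans (congrArg (· - s.1) (map_sum (F.formsFst k) _ _))

theorem forms_snd_sum_sub (m : Finset ℕ) {k : ℤ} (P : ℕ → F.forms.obj k)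
    (s : F.forms.obj k) : (∑ i ∈ m, P i - s).2 = ∑ i ∈ m, (P i).2 - s.2 :=
  (map_sub (F.formsSnd k) _ _).trans (congrArg (· - s.2) (map_sum (F.formsSnd k) _ _))

/-- This makes the gauge action available on forms themselves, so that a path can be transformed by
a t-dependent element. -/
theorem formsFiltration_isComplete (hF : F.IsComplete) : F.formsFiltration.IsComplete where
  hausdorff k x h := Prod.ext (series_ext fun i => hF.hausdorff k _ fun n => (h n).1 i)
    (series_ext fun i => hF.hausdorff (k + 1) _ fun n => (h n).2 i)
  exists_sum k P := by
    obtain ⟨s, hs⟩ := exists_series_sum hF (fun i => (P.1 i).1) fun n => by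
      obtain ⟨N, hN⟩ := P.2 n
      exact ⟨N, fun i hi => (hN i hi).1⟩
    obtain ⟨t, ht⟩ := exists_series_sum hF (fun i => (P.1 i).2) fun n => by
      obtain ⟨N, hN⟩ := P.2 n
      exact ⟨N, fun i hi => (hN i hi).2⟩
    refine ⟨(s, t), fun n => ?_⟩
    obtain ⟨N, hN⟩ := hs n
    obtain ⟨M, hM⟩ := ht n
    refine ⟨max N M, fun m hm => ⟨?_, ?_⟩⟩
    · have h := hN m (le_of_max_le_left hm)
      exact (forms_fst_sum_sub _ P.1 _).symm ▸ h
    · have h := hM m (le_of_max_le_right hm)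
      exact (forms_snd_sum_sub _ P.1 _).symm ▸ h

theorem isSum_forms_fst {k : ℤ} {P : ℕ → F.forms.obj k} {s : F.forms.obj k}
    (h : F.formsFiltration.IsSum P s) (j : ℕ) : F.IsSum (fun i => (P i).1.1 j) (s.1.1 j) := by
  intro n
  obtain ⟨N, hN⟩ := h n
  refine ⟨N, fun m hm => ?_⟩
  have := (hN m hm).1 j
  rw [forms_fst_sum_sub] at this
  simpa using this

theorem isSum_forms_snd {k : ℤ} {P : ℕ → F.forms.obj k} {s : F.forms.obj k}
    (h : F.formsFiltration.IsSum P s) (j : ℕ) : F.IsSum (fun i => (P i).2.1 j) (s.2.1 j) := by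
  intro n
  obtain ⟨N, hN⟩ := h n
  refine ⟨N, fun m hm => ?_⟩
  have := (hN m hm).2 j
  rw [forms_snd_sum_sub] at this
  simpa using this

theorem forms_ad_pow (w : F.series 0) (k : ℤ) (x : F.forms.obj k) (i : ℕ) :
    (F.forms.ad (show F.forms.obj 0 from (w, 0)) k ^ i) x =
      (((F.seriesBr 0 k k (zero_add k) w) ^ i : Module.End K (F.series k)) x.1,
       ((F.seriesBr 0 (k + 1) (k + 1) (zero_add _) w) ^ i :
          Module.End K (F.series (k + 1))) x.2) := by
  induction i with
  | zero => rfl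
  | succ i ih =>
    rw [pow_succ', Module.End.mul_apply, ih, pow_succ', pow_succ', Module.End.mul_apply,
      Module.End.mul_apply]
    refine Prod.ext rfl ?_
    show _ + (-1 : K) ^ k • F.seriesBr (0 + 1) k (k + 1) _ 0 _ = _
    rw [map_zero, LinearMap.zero_apply, smul_zero, add_zero]

theorem seriesBr_pow_mem {q : ℕ → L.obj 0} {w : F.series 0} (hw : ∀ n, w.1 n ∈ L.adWordSpan q n)
    (k : ℤ) (x : F.series k) (i n : ℕ) :
    (((F.seriesBr 0 k k (zero_add k) w) ^ i : Module.End K (F.series k)) x).1 n ∈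
      L.adSpan q k i := by
  induction i generalizing n with
  | zero => exact Submodule.mem_top
  | succ i ih =>
    rw [pow_succ', Module.End.mul_apply, seriesBr_apply]
    exact Submodule.sum_mem _ fun c _ => ad_mem_adSpan_of_mem (hw c.1) (ih c.2)

/-- Each application of ad_{w(t)} uses up at least one ad_{qᵢ}, so every coefficient of the N-th
power is spanned by images of N-fold products, uniformly in t. -/
theorem topNilp_forms (h : F.LocallyTopNilp) {q w : F.series 0}
    (hw : ∀ n, w.1 n ∈ L.adWordSpan q.1 n) :
    F.formsFiltration.TopNilp (show F.forms.obj 0 from (w, 0)) := by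
  intro n
  obtain ⟨N, hN⟩ := h q n
  refine ⟨N, fun k x => ?_⟩
  rw [forms_ad_pow]
  exact ⟨fun i => hN _ (seriesBr_pow_mem hw _ _ N i), fun i => hN _ (seriesBr_pow_mem hw _ _ N i)⟩

end Filtration

end DGL

/-! ### From a homotopy to a gauge transformation -/

namespace DGL.Filtration

variable {K : Type u} [Field K] {L : DGL.{u, v} K} {F : L.Filtration}

open PowerSeries

/-- Morphisms, even if not continuous, are compatible with gauge transformations. -/
theorem map_gaugeAct [CharZero K] {M : DGL.{u, w} K} {G : M.Filtration} (hF : F.IsComplete)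
    (hG : G.IsComplete) (Φ : ∀ i : ℤ, L.obj i →ₗ[K] M.obj i)
    (hΦ : ∀ (i j k : ℤ) (h : i + j = k) (x : L.obj i) (y : L.obj j),
      Φ k (L.br i j k h x y) = M.br i j k h (Φ i x) (Φ j y))
    (hd : ∀ (i j : ℤ) (h : j + 1 = i) (x : L.obj i), Φ j (L.d i j h x) = M.d i j h (Φ i x))
    {w : L.obj 0} (hw : F.TopNilp w) (hw' : G.TopNilp (Φ 0 w)) (v : L.obj (-1)) :
    Φ (-1) (F.gaugeAct hF hw v) = G.gaugeAct hG hw' (Φ (-1) v) := by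
  rw [gaugeAct, gaugeAct, map_sub, map_act hF hG Φ hΦ hw hw', map_act hF hG Φ hΦ hw hw', hd]

/-- Evaluation of forms at `t = 1`, `dt = 0`. -/
noncomputable def evalOne (hF : F.IsComplete) (k : ℤ) : F.forms.obj k →ₗ[K] L.obj k :=
  F.sum hF k ∘ₗ F.formsFst k

theorem evalOne_br (hF : F.IsComplete) (i j k : ℤ) (h : i + j = k) (x : F.forms.obj i)
    (y : F.forms.obj j) : F.evalOne hF k (F.forms.br i j k h x y) =
      L.br i j k h (F.evalOne hF i x) (F.evalOne hF j y) :=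
  sum_br hF i j k h _ _

theorem evalOne_d (hF : F.IsComplete) (i j : ℤ) (h : j + 1 = i) (x : F.forms.obj i) :
    F.evalOne hF j (F.forms.d i j h x) = L.d i j h (F.evalOne hF i x) :=
  sum_d hF i j h _

theorem act_forms_snd_eq_zero (hF : F.IsComplete) {w : F.series 0}
    (hw : F.formsFiltration.TopNilp (show F.forms.obj 0 from (w, 0))) (f : PowerSeries K) {k : ℤ}
    {x : F.forms.obj k} (hx : x.2 = 0) :
    (F.formsFiltration.act (formsFiltration_isComplete hF) hw f k x).2 = 0 := by
  refine series_ext fun j => ?_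
  have h := isSum_forms_snd (isSum_act (formsFiltration_isComplete hF) hw f k x) j
  refine h.unique hF ?_
  have e : (fun i => ((PowerSeries.coeff i f •
      (F.forms.ad (show F.forms.obj 0 from (w, 0)) k ^ i) x : F.forms.obj k).2.1 j)) = 0 := by
    funext i
    rw [forms_ad_pow, hx, map_zero]
    exact smul_zero (M := K) (A := L.obj (k + 1)) _
  rw [e]
  simpa using isSum_single (F := F) (p := (0 : ℕ → L.obj (k + 1))) fun _ _ => rfl

/-- Since w(0) = 0, every positive power of ad_{w(t)} vanishes at t = 0. -/
theorem act_forms_fst_zero (hF : F.IsComplete) {w : F.series 0} (h0 : w.1 0 = 0)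
    (hw : F.formsFiltration.TopNilp (show F.forms.obj 0 from (w, 0))) (f : PowerSeries K) (k : ℤ)
    (x : F.forms.obj k) :
    (F.formsFiltration.act (formsFiltration_isComplete hF) hw f k x).1.1 0 =
      coeff 0 f • x.1.1 0 := by
  have h := isSum_forms_fst (isSum_act (formsFiltration_isComplete hF) hw f k x) 0
  refine h.unique hF ?_
  have e := isSum_single (F := F) (k := k)
    (p := fun i => ((PowerSeries.coeff i f •
      (F.forms.ad (show F.forms.obj 0 from (w, 0)) k ^ i) x : F.forms.obj k).1.1 0)) ?_
  · exact e
  · intro i hi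
    obtain ⟨i, rfl⟩ := Nat.exists_eq_succ_of_ne_zero hi
    rw [forms_ad_pow, pow_succ']
    have : (F.seriesBr 0 k k (zero_add k) w
        ((F.seriesBr 0 k k (zero_add k) w ^ i : Module.End K (F.series k)) x.1)).1 0 = 0 := by
      rw [seriesBr_apply]
      simp [h0]
    exact (congrArg (coeff (i + 1) f • ·) this).trans (smul_zero _)

theorem seriesBr_pow_apply (w q : F.series 0) (i n : ℕ) :
    ((F.seriesBr 0 0 0 (zero_add 0) w ^ i : Module.End K (F.series 0)) q).1 n =
      (L.seqAd w.1)^[i] q.1 n := by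
  induction i generalizing n with
  | zero => rfl
  | succ i ih =>
    rw [pow_succ', Module.End.mul_apply, seriesBr_apply, Function.iterate_succ_apply']
    exact Finset.sum_congr rfl fun c _ => by rw [ih]; rfl

theorem seqAd_iterate_eq_zero {w : ℕ → L.obj 0} (h0 : w 0 = 0) (q : ℕ → L.obj 0) {i n : ℕ}
    (h : n < i) : (L.seqAd w)^[i] q n = 0 := by
  induction i generalizing n with
  | zero => omega
  | succ i ih =>
    rw [Function.iterate_succ_apply']
    refine Finset.sum_eq_zero fun c hc => ?_
    rw [Finset.HasAntidiagonal.mem_antidiagonal] at hc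
    rcases Nat.eq_zero_or_pos c.1 with hc0 | hc0
    · rw [hc0, h0, ad, map_zero, LinearMap.zero_apply]
    · rw [ih (by omega), map_zero]

/-- This reads the coefficient recursion for w as the equation g(ad_w)(q dt) = w' dt in the
completed DGL of forms; for each power of t only finitely many terms are nonzero. -/
theorem act_forms_dt (hF : F.IsComplete) {w : F.series 0} (h0 : w.1 0 = 0)
    (hw : F.formsFiltration.TopNilp (show F.forms.obj 0 from (w, 0))) (g : PowerSeries K)
    (q : F.series 0) (hg : ∀ n : ℕ, ((n : K) + 1) • w.1 (n + 1) =
      ∑ i ∈ Finset.range (n + 1), coeff i g • (L.seqAd w.1)^[i] q.1 n) :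
    F.formsFiltration.act (formsFiltration_isComplete hF) hw g (-1)
      (show F.forms.obj (-1) from (0, (show F.series (-1 + 1) from q))) =
    (show F.forms.obj (-1) from
      (0, (show F.series (-1 + 1) from F.seriesDeriv 0 0 rfl w))) := by
  have h := isSum_act (formsFiltration_isComplete hF) hw g (-1)
      (show F.forms.obj (-1) from (0, (show F.series (-1 + 1) from q)))
  refine Prod.ext (series_ext fun j => (isSum_forms_fst h j).unique hF ?_)
    (series_ext fun j => (isSum_forms_snd h j).unique hF ?_)
  · have e : (fun i => ((PowerSeries.coeff i g • (F.forms.ad (show F.forms.obj 0 from (w, 0)) (-1) ^ i)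
        (show F.forms.obj (-1) from (0, (show F.series (-1 + 1) from q))) :
          F.forms.obj (-1)).1.1 j)) = 0 := by
      funext i
      rw [forms_ad_pow, map_zero]
      exact smul_zero (M := K) (A := L.obj (-1)) _
    rw [e]
    simpa using isSum_single (F := F) (p := (0 : ℕ → L.obj (-1))) fun _ _ => rfl
  · have e : (fun i => ((PowerSeries.coeff i g • (F.forms.ad (show F.forms.obj 0 from (w, 0)) (-1) ^ i)
        (show F.forms.obj (-1) from (0, (show F.series (-1 + 1) from q))) :
          F.forms.obj (-1)).2.1 j)) = fun i => coeff i g • (L.seqAd w.1)^[i] q.1 j := by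
      funext i
      rw [forms_ad_pow]
      exact congrArg (coeff i g • ·) (seriesBr_pow_apply w q i j)
    rw [e]
    have := isSum_of_eq_zero (F := F) (k := 0) (N := j + 1)
      (p := fun i => coeff i g • (L.seqAd w.1)^[i] q.1 j) fun i hi => by
        rw [seqAd_iterate_eq_zero h0 _ (by omega), smul_zero]
    rw [← hg j] at this
    exact this

/-- The ends of a path are related by a gauge transformation, the value at `t = 1` of a solution of
the Magnus equation. -/
theorem exists_gauge_of_homotopic [CharZero K] (hF : F.IsComplete) (hL : F.LocallyTopNilp)
    (hT : ∀ w, F.TopNilp w) {u v : L.obj (-1)} (h : F.Homotopic u v) : ∃ w, F.Gauge w v u := by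
  obtain ⟨⟨p, q⟩, hmc, hu, hv⟩ := h
  have hp0 : p.1 0 = u := by
    have := isSum_single (F := F) (p := fun i => (0 : K) ^ i • p.1 i) fun i hi => by simp [hi]
    simp only [pow_zero, one_smul] at this
    exact this.unique hF hu
  have hp1 : F.sum hF (-1) p = v := by
    refine (isSum_sum hF p).unique hF ?_
    simpa [EvalsTo] using hv
  let q' : F.series 0 := q
  -- The series B + x is chosen so that the dt part w' dt of the differential of w, acted on by
  -- (eˣ-1)/x, cancels e^{ad_w}(q dt) in the gauge transform.
  obtain ⟨w', h0, hw', hsol⟩ := exists_seqAd_solution q'.1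
    fun i => coeff i (bernoulliPowerSeries K + X)
  let w : F.series 0 := ⟨w', fun n => by
    obtain ⟨N, hN⟩ := exists_adWordSpan_le hL q' n
    exact ⟨N, fun i hi => hN i hi (hw' i)⟩⟩
  have hW : F.formsFiltration.TopNilp (show F.forms.obj 0 from (w, 0)) :=
    topNilp_forms hL (q := q') hw'
  set W : F.forms.obj 0 := (w, 0)
  have hFF := formsFiltration_isComplete hF
  have hy := isMC_gaugeAct hFF hW hmc
  have hyeq : F.formsFiltration.gaugeAct hFF hW (show F.forms.obj (-1) from (p, q)) =
      F.formsFiltration.act hFF hW (exp K) (-1) (show F.forms.obj (-1) from (p, 0)) -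
      F.formsFiltration.act hFF hW (expSubOneDiv K) (-1)
        (show F.forms.obj (-1) from (F.seriesD 0 (-1) (by norm_num) w, 0)) := by
    have e1 : (show F.forms.obj (-1) from (p, q)) = (show F.forms.obj (-1) from (p, 0)) +
        (show F.forms.obj (-1) from (0, q)) :=
      Prod.ext (add_zero p).symm (zero_add q).symm
    have e2 : F.forms.d 0 (-1) (by norm_num) W =
        (show F.forms.obj (-1) from (F.seriesD 0 (-1) (by norm_num) w, 0)) +
        (show F.forms.obj (-1) from (0, (show F.series (-1 + 1) from F.seriesDeriv 0 0 rfl w))) := by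
      refine Prod.ext (add_zero _).symm ?_
      show F.seriesD (0 + 1) (-1 + 1) _ 0 + (-1 : K) ^ (0 : ℤ) • F.seriesDeriv 0 (-1 + 1) _ w =
        (0 : F.series (-1 + 1)) + F.seriesDeriv 0 (-1 + 1) _ w
      rw [map_zero, zpow_zero, one_smul]
    have e3 := act_forms_dt hF h0 hW _ q' hsol
    rw [gaugeAct, e1, e2, map_add, map_add, ← e3, ← act_mul, expSubOneDiv_mul_bernoulli_add_X]
    exact add_sub_add_right_eq_sub _ _ _
  set y := F.formsFiltration.gaugeAct hFF hW (show F.forms.obj (-1) from (p, q)) with hydef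
  have hy2 : y.2 = 0 := by
    rw [hyeq]
    refine (map_sub (F.formsSnd (-1)) _ _).trans ?_
    refine (congrArg₂ (· - ·) (act_forms_snd_eq_zero hF hW (exp K) ?_)
      (act_forms_snd_eq_zero hF hW (expSubOneDiv K) ?_)).trans (sub_zero _) <;> rfl
  have hy10 : y.1.1 0 = u := by
    have : y.1 = _ := (congrArg (F.formsFst (-1)) hyeq).trans (map_sub (F.formsFst (-1)) _ _)
    rw [this, Submodule.coe_sub, Pi.sub_apply]
    refine (congrArg₂ (· - ·) (act_forms_fst_zero hF h0 hW (exp K) _ _)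
      (act_forms_fst_zero hF h0 hW (expSubOneDiv K) _ _)).trans ?_
    have e : (F.seriesD 0 (-1) (by norm_num) w).1 0 = 0 := by
      rw [seriesD_apply]
      exact (congrArg _ h0).trans (map_zero _)
    show _ • p.1 0 - _ • (F.seriesD 0 (-1) _ w).1 0 = u
    rw [e, hp0]
    simp [coeff_exp]
  -- For a form without dt component, the dt part of the Maurer–Cartan equation says that the
  -- derivative in t is zero.
  have hy1 : ∀ n, y.1.1 (n + 1) = 0 := by
    intro n
    have h := ((forms_isMC_iff y.1 y.2).1 hy).2
    rw [hy2, map_zero, map_zero, LinearMap.zero_apply, sub_zero] at h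
    have h' := congrArg (fun p : F.series (-2 + 1) => p.1 n) h
    have h'' : ((n : K) + 1) • y.1.1 (n + 1) = 0 := h'
    refine (smul_eq_zero.1 h'').resolve_left ?_
    exact_mod_cast Nat.succ_ne_zero n
  have hsum : F.evalOne hF (-1) y = u := by
    refine (isSum_sum hF y.1).unique hF ?_
    rw [← hy10]
    refine isSum_single fun i hi => ?_
    obtain ⟨i, rfl⟩ := Nat.exists_eq_succ_of_ne_zero hi
    exact hy1 i
  -- The transformed form is the constant u. Evaluation at t = 1 respects brackets and
  -- differentials, hence gauge actions, and takes the original form to v.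
  refine ⟨F.evalOne hF 0 W, (gauge_iff hF (hT _) _ _).2 ?_⟩
  have e := map_gaugeAct hFF hF (F.evalOne hF) (evalOne_br hF) (evalOne_d hF) hW (hT _)
    (show F.forms.obj (-1) from (p, q))
  rw [← hydef, hsum] at e
  rw [e, ← hp1]
  rfl

end DGL.Filtration

/-! ### Evaluation of Lie elements by the Dynkin map -/

namespace DGL

variable {K : Type u} [Field K] {L : DGL.{u, v} K}

/-- The operator `[a, ·]` on the product of all the homogeneous components. -/
def adTotal {i : ℤ} (a : L.obj i) : Module.End K (∀ k, L.obj k) :=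
  LinearMap.pi fun k => (L.br i (k - i) k (by omega) a) ∘ₗ LinearMap.proj (k - i)

theorem adTotal_apply {i : ℤ} (a : L.obj i) (y : ∀ k, L.obj k) (j k : ℤ) (h : i + j = k) :
    adTotal a y k = L.br i j k h a (y j) := by
  obtain rfl : j = k - i := by omega
  rfl

variable {X : Type w} {deg : X → ℤ} (ψ : ∀ x, L.obj (deg x))

/-- The action of the tensor algebra through the operators `[ψ x, ·]`. -/
noncomputable def freeAd : FreeAlgebra K X →ₐ[K] Module.End K (∀ k, L.obj k) :=
  FreeAlgebra.lift K fun x => adTotal (ψ x)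

/-- Auxiliary: the action of the tensor algebra that defines `dynkin`. -/
noncomputable def dynkinHom : FreeAlgebra K X →ₐ[K] Module.End K (K × ∀ k, L.obj k) :=
  FreeAlgebra.lift K fun x => LinearMap.prod 0
    ((LinearMap.toSpanSingleton K _ (Pi.single (deg x) (ψ x))).coprod (adTotal (ψ x)))

/-- The Dynkin map `x₁ ⋯ xₙ ↦ [ψ x₁, [ψ x₂, [⋯, ψ xₙ]]]`. -/
noncomputable def dynkin : FreeAlgebra K X →ₗ[K] (∀ k, L.obj k) where
  toFun f := (dynkinHom ψ f (1, 0)).2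
  map_add' f g := by simp
  map_smul' c f := by simp

/-- The action is triangular: the scalar slot sees only the augmentation, the other slot the
operators [ψ x, ·]. The off-diagonal part, obtained from the seed (1, 0), is the Dynkin map. -/
theorem dynkinHom_apply (f : FreeAlgebra K X) (c : K) (y : ∀ k, L.obj k) :
    dynkinHom ψ f (c, y) =
      (c * FreeAlgebra.algebraMapInv f, c • dynkin ψ f + freeAd ψ f y) := by
  have h1 : dynkinHom ψ f (0, y) = (0, freeAd ψ f y) := by
    induction f using FreeAlgebra.induction generalizing y with
    | grade0 r => simp [Module.algebraMap_end_apply]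
    | grade1 x => simp [dynkinHom, freeAd]
    | mul f g hf hg => simp [hf, hg]
    | add f g hf hg => simp [hf, hg]
  have key : ∀ (f : FreeAlgebra K X) z, (dynkinHom ψ f z).1 =
      FreeAlgebra.algebraMapInv f * z.1 := by
    intro f
    induction f using FreeAlgebra.induction with
    | grade0 r => simp [Module.algebraMap_end_apply, FreeAlgebra.algebraMapInv]
    | grade1 x => simp [dynkinHom, FreeAlgebra.algebraMapInv]
    | add f g hf hg => simp [hf, hg, add_mul]
    | mul f g hf hg => simp [hf, hg, mul_assoc]
  have e : ((c, y) : K × ∀ k, L.obj k) = c • (1, 0) + (0, y) := by simp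
  rw [e, map_add, map_smul, h1]
  ext1
  · simp [key]
  · simp [dynkin]

theorem dynkin_mul (f g : FreeAlgebra K X) : dynkin ψ (f * g) =
    FreeAlgebra.algebraMapInv g • dynkin ψ f + freeAd ψ f (dynkin ψ g) := by
  have : dynkin ψ (f * g) = (dynkinHom ψ f (dynkinHom ψ g (1, 0))).2 := by
    simp [dynkin]
  rw [this, dynkinHom_apply ψ g, dynkinHom_apply]
  simp

theorem dynkin_ι (x : X) : dynkin ψ (FreeAlgebra.ι K x) = Pi.single (deg x) (ψ x) := by
  simp [dynkin, dynkinHom]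

/-- The value in `L_k` of a Lie element of length `n`. -/
noncomputable def lieEval (n : ℕ) (k : ℤ) : FreeAlgebra K X →ₗ[K] L.obj k :=
  (n : K)⁻¹ • (LinearMap.proj k ∘ₗ dynkin ψ)

theorem lieEval_ι (x : X) : lieEval ψ 1 (deg x) (FreeAlgebra.ι K x) = ψ x := by
  simp [lieEval, dynkin_ι]

theorem freeLie_zero (k : ℤ) : freeLie K deg 0 k = ⊥ := by
  have : ∀ n (f : FreeAlgebra K X), IsLieMonomial K deg n k f → n ≠ 0 := by
    intro n f hf
    induction hf <;> omega
  rw [freeLie, Submodule.span_eq_bot]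
  exact fun f hf => absurd rfl (this 0 f hf)

variable [CharZero K]

/-- The Dynkin–Specht–Wever argument: with values f̄, ḡ in L, the Dynkin map takes fg to n[f̄,ḡ] and
gf to m[ḡ,f̄]. By antisymmetry the graded commutator goes to (m+n)[f̄,ḡ], and dividing by the length
removes the factor. -/
theorem lieEval_br_aux {m n : ℕ} {i j k : ℤ} (h : i + j = k) {f g : FreeAlgebra K X} (hm : m ≠ 0)
    (hn : n ≠ 0) (hf0 : FreeAlgebra.algebraMapInv f = 0) (hg0 : FreeAlgebra.algebraMapInv g = 0)
    (hf : ∀ (j k : ℤ) (h : i + j = k) (y : ∀ k, L.obj k),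
      freeAd ψ f y k = L.br i j k h (lieEval ψ m i f) (y j))
    (hg : ∀ (i k : ℤ) (h : j + i = k) (y : ∀ k, L.obj k),
      freeAd ψ g y k = L.br j i k h (lieEval ψ n j g) (y i)) :
    lieEval ψ (m + n) k (f * g - (-1 : K) ^ (i * j) • (g * f)) =
      L.br i j k h (lieEval ψ m i f) (lieEval ψ n j g) := by
  have hm' : (m : K) ≠ 0 := Nat.cast_ne_zero.2 hm
  have hn' : (n : K) ≠ 0 := Nat.cast_ne_zero.2 hn
  have hmn : ((m + n : ℕ) : K) ≠ 0 := Nat.cast_ne_zero.2 (by omega)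
  have ef : dynkin ψ f i = (m : K) • lieEval ψ m i f := by simp [lieEval, hm']
  have eg : dynkin ψ g j = (n : K) • lieEval ψ n j g := by simp [lieEval, hn']
  have h1 : dynkin ψ (f * g) k = (n : K) • L.br i j k h (lieEval ψ m i f) (lieEval ψ n j g) := by
    rw [dynkin_mul, hg0, zero_smul, zero_add, hf j k h, eg, map_smul]
  have h2 : dynkin ψ (g * f) k =
      (m : K) • L.br j i k (by omega) (lieEval ψ n j g) (lieEval ψ m i f) := by
    rw [dynkin_mul, hf0, zero_smul, zero_add, hg i k (by omega), ef, map_smul]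
  have h3 := L.lie.antisymm i j k h (by omega) (lieEval ψ m i f) (lieEval ψ n j g)
  show ((m + n : ℕ) : K)⁻¹ • dynkin ψ _ k = _
  rw [inv_smul_eq_iff₀ hmn, map_sub, map_smul, Pi.sub_apply, Pi.smul_apply, h1, h2, smul_comm,
    sub_eq_add_neg, ← smul_neg]
  erw [← h3]
  rw [Nat.cast_add]
  module

/-- By induction on the monomial: once both factors act as ad of their values, `lieEval_br_aux`
gives the value of the bracket, and Jacobi shows that it acts as ad of that value. -/
theorem freeAd_apply_of_isLieMonomial {n : ℕ} {i : ℤ} {f : FreeAlgebra K X} (hf : IsLieMonomial K deg n i f) :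
    n ≠ 0 ∧ FreeAlgebra.algebraMapInv f = 0 ∧ ∀ (j k : ℤ) (h : i + j = k) (y : ∀ k, L.obj k),
      freeAd ψ f y k = L.br i j k h (lieEval ψ n i f) (y j) := by
  induction hf with
  | gen x =>
    refine ⟨one_ne_zero, by simp [FreeAlgebra.algebraMapInv], fun j k h y => ?_⟩
    rw [lieEval_ι]
    simp only [freeAd, FreeAlgebra.lift_ι_apply]
    exact adTotal_apply _ _ _ _ _
  | @br m n i j f g _ _ hf hg =>
    obtain ⟨hm, hf0, hf⟩ := hf
    obtain ⟨hn, hg0, hg⟩ := hg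
    refine ⟨by omega, by simp [hf0, hg0], fun l k h y => ?_⟩
    rw [lieEval_br_aux ψ rfl hm hn hf0 hg0 hf hg]
    have hj := L.lie.jacobi i j l (i + j) (j + l) (i + l) k rfl rfl rfl (by omega) h (by omega)
      (lieEval ψ m i f) (lieEval ψ n j g) (y l)
    rw [map_sub, map_smul, map_mul, map_mul, LinearMap.sub_apply, LinearMap.smul_apply,
      Module.End.mul_apply, Module.End.mul_apply, Pi.sub_apply, Pi.smul_apply,
      hf (j + l) k (by omega), hg l (j + l) rfl, hg (i + l) k (by omega), hf l (i + l) rfl]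
    exact sub_eq_of_eq_add hj

theorem freeAd_apply_of_mem_freeLie {n : ℕ} {i : ℤ} {f : FreeAlgebra K X} (hf : f ∈ freeLie K deg n i) :
    FreeAlgebra.algebraMapInv f = 0 ∧ ∀ (j k : ℤ) (h : i + j = k) (y : ∀ k, L.obj k),
      freeAd ψ f y k = L.br i j k h (lieEval ψ n i f) (y j) := by
  induction hf using Submodule.span_induction with
  | mem f hf => exact (freeAd_apply_of_isLieMonomial ψ hf).2
  | zero => simp
  | add f g _ _ hf hg =>
    refine ⟨by simp [hf.1, hg.1], fun j k h y => ?_⟩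
    simp [hf.2 j k h, hg.2 j k h]
  | smul c f _ hf =>
    refine ⟨by simp [hf.1], fun j k h y => ?_⟩
    simp [hf.2 j k h]

/-- Brackets of Lie elements are mapped to brackets. -/
theorem lieEval_br {m n : ℕ} {i j k : ℤ} (h : i + j = k) {f g : FreeAlgebra K X}
    (hf : f ∈ freeLie K deg m i) (hg : g ∈ freeLie K deg n j) :
    lieEval ψ (m + n) k (f * g - (-1 : K) ^ (i * j) • (g * f)) =
      L.br i j k h (lieEval ψ m i f) (lieEval ψ n j g) := by
  rcases Nat.eq_zero_or_pos m with rfl | hm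
  · rw [freeLie_zero, Submodule.mem_bot] at hf
    simp [hf]
  rcases Nat.eq_zero_or_pos n with rfl | hn
  · rw [freeLie_zero, Submodule.mem_bot] at hg
    simp [hg]
  obtain ⟨hf0, hf⟩ := freeAd_apply_of_mem_freeLie ψ hf
  obtain ⟨hg0, hg⟩ := freeAd_apply_of_mem_freeLie ψ hg
  exact lieEval_br_aux ψ h hm.ne' hn.ne' hf0 hg0 hf hg

end DGL

/-! ### Convergence of the evaluation, by counting letters -/

/-- The span of the words of length `n` and degree `k`. -/
noncomputable def wordSpan (K : Type u) [Field K] {X : Type w} (deg : X → ℤ) (n : ℕ) (k : ℤ) :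
    Submodule K (FreeAlgebra K X) :=
  Submodule.span K {f | ∃ l : List X, l.length = n ∧ (l.map deg).sum = k ∧
    f = (l.map (FreeAlgebra.ι K)).prod}

theorem mul_mem_wordSpan {K : Type u} [Field K] {X : Type w} {deg : X → ℤ} {m n : ℕ} {i j : ℤ}
    {f g : FreeAlgebra K X} (hf : f ∈ wordSpan K deg m i) (hg : g ∈ wordSpan K deg n j) :
    f * g ∈ wordSpan K deg (m + n) (i + j) := by
  induction hf, hg using Submodule.span_induction₂ with
  | mem_mem f g hf hg =>
    obtain ⟨l, rfl, rfl, rfl⟩ := hf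
    obtain ⟨l', rfl, rfl, rfl⟩ := hg
    exact Submodule.subset_span ⟨l ++ l', by simp, by simp, by simp⟩
  | zero_left g hg => simp
  | zero_right f hf => simp
  | add_left f f' g _ _ _ h h' => rw [add_mul]; exact add_mem h h'
  | add_right f g g' _ _ _ h h' => rw [mul_add]; exact add_mem h h'
  | smul_left c f g _ _ h => rw [smul_mul_assoc]; exact Submodule.smul_mem _ c h
  | smul_right c f g _ _ h => rw [mul_smul_comm]; exact Submodule.smul_mem _ c h

theorem freeLie_le_wordSpan {K : Type u} [Field K] {X : Type w} {deg : X → ℤ} (n : ℕ) (k : ℤ) :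
    freeLie K deg n k ≤ wordSpan K deg n k := by
  refine Submodule.span_le.2 fun f hf => ?_
  induction hf with
  | gen x => exact Submodule.subset_span ⟨[x], by simp, by simp, by simp⟩
  | @br m n i j f g _ _ hf hg =>
    have h := mul_mem_wordSpan hg hf
    rw [add_comm n, add_comm j] at h
    exact sub_mem (mul_mem_wordSpan hf hg) (Submodule.smul_mem _ _ h)

namespace DGL.Filtration

variable {K : Type u} [Field K] {L : DGL.{u, v} K} {F : L.Filtration}

theorem adTotal_mem {i : ℤ} (a : L.obj i) {n : ℕ} {y : ∀ k, L.obj k} (hy : ∀ k, y k ∈ F.F n k)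
    (k : ℤ) : adTotal a y k ∈ F.F n k :=
  F.br_mem_right n i (k - i) k (by omega) a _ (hy _)

/-- Here `j` counts the outermost run of ad_z. A letter a or b resets it and lowers the degree by
one, so for given degree the length is bounded unless some run reaches N + 1; after that the value
stays in the ideal. -/
theorem dynkin_word_mem (ψ : ∀ x : LSGen, L.obj x.deg) {n N : ℕ}
    (hN : ∀ (k : ℤ) (x : L.obj k), ((L.ad (ψ .z) k) ^ (N + 1)) x ∈ F.F n k) (l : List LSGen) :
    (∀ k, dynkin ψ (l.map (FreeAlgebra.ι K)).prod k ∈ F.F n k) ∨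
    ∃ j ≤ N, ∃ y : ∀ k, L.obj k,
      (∀ k, dynkin ψ (l.map (FreeAlgebra.ι K)).prod k = (L.ad (ψ .z) k ^ j) (y k)) ∧
      (l.length : ℤ) ≤ j + 1 - (l.map LSGen.deg).sum * (N + 1) := by
  induction l with
  | nil =>
    left
    intro k
    have : dynkin ψ (1 : FreeAlgebra K LSGen) = 0 := by simp [dynkin]
    simp [this]
  | cons x l ih =>
    have hdeg : (LSGen.deg x = 0 ∧ x = .z) ∨ LSGen.deg x = -1 := by cases x <;> simp [LSGen.deg]
    -- The last letter is the argument of the brackets and not an operator, even if it is z. This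
    -- accounts for the `+ 1` in the bound.
    rcases List.eq_nil_or_concat' l with rfl | ⟨l', y, rfl⟩
    · right
      refine ⟨0, Nat.zero_le _, _, fun k => rfl, ?_⟩
      have : 0 ≤ (N : ℤ) := Nat.cast_nonneg N
      rcases hdeg with ⟨h, -⟩ | h <;> simp [h]
    · set l := l' ++ [y]
      have hc : dynkin ψ ((x :: l).map (FreeAlgebra.ι K)).prod =
          adTotal (ψ x) (dynkin ψ (l.map (FreeAlgebra.ι K)).prod) := by
        rw [List.map_cons, List.prod_cons, dynkin_mul]
        simp [l, freeAd, FreeAlgebra.algebraMapInv]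
      rw [hc]
      rcases ih with ih | ⟨j, hj, y, hy, hlen⟩
      · exact Or.inl (adTotal_mem _ ih)
      · rcases hdeg with ⟨h, rfl⟩ | h
        · have e : ∀ k, adTotal (ψ .z) (dynkin ψ (l.map (FreeAlgebra.ι K)).prod) k =
              (L.ad (ψ .z) k ^ (j + 1)) (y k) := by
            intro k
            rw [adTotal_apply (L := L) (ψ .z) _ k k (zero_add k), hy, pow_succ',
              Module.End.mul_apply]
            rfl
          rcases hj.lt_or_eq with hj | rfl
          · refine Or.inr ⟨j + 1, hj, y, e, ?_⟩
            rw [List.map_cons, List.sum_cons, h, List.length_cons]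
            push_cast
            rw [zero_add]
            linarith
          · exact Or.inl fun k => by rw [e]; exact hN _ _
        · refine Or.inr ⟨0, Nat.zero_le _, _, fun k => rfl, ?_⟩
          rw [List.map_cons, List.sum_cons, h, List.length_cons]
          push_cast
          have : (j : ℤ) ≤ N := by exact_mod_cast hj
          linarith

theorem exists_lieEval_mem (ψ : ∀ x : LSGen, L.obj x.deg) (hw : F.TopNilp (ψ .z)) (n : ℕ) (k : ℤ) :
    ∃ M : ℕ, ∀ m ≥ M, ∀ f ∈ freeLie K LSGen.deg m k, lieEval ψ m k f ∈ F.F n k := by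
  obtain ⟨N, hN⟩ := hw.exists_le n
  -- One more than the largest length j + 1 - k(N + 1), with j ≤ N, that the second alternative of
  -- `dynkin_word_mem` allows in degree k.
  refine ⟨(N + 2 - k * (N + 1)).toNat, fun m hm f hf => ?_⟩
  refine Submodule.smul_mem _ _ ?_
  have hle : wordSpan K LSGen.deg m k ≤ (F.F n k).comap (LinearMap.proj k ∘ₗ dynkin ψ) := by
    refine Submodule.span_le.2 ?_
    rintro _ ⟨l, hl, hk, rfl⟩
    rcases dynkin_word_mem ψ (hN (N + 1) (by omega)) l with h | ⟨j, hj, y, -, hlen⟩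
    · exact h k
    · rw [hl, hk] at hlen
      have h2 := Int.toNat_le.1 hm
      have : (j : ℤ) ≤ N := by exact_mod_cast hj
      omega
  exact hle (freeLie_le_wordSpan m k hf)

end DGL.Filtration

/-- The component of length `m`, as a linear map. -/
noncomputable def hatCoeff {K : Type u} [Field K] {X : Type w} {deg : X → ℤ} (k : ℤ) (m : ℕ) :
    (completeFreeLie K deg).obj k →ₗ[K] FreeAlgebra K X where
  toFun φ := PowerSeries.coeff m (φ : hatLie K deg k).1
  map_add' φ χ := map_add (PowerSeries.coeff m) (φ : hatLie K deg k).1 (χ : hatLie K deg k).1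
  map_smul' c φ := PowerSeries.coeff_smul m (φ : hatLie K deg k).1 c

namespace DGL.Filtration

/-! ### The length filtration -/

section length

variable {K : Type u} [Field K] {X : Type w} {deg : X → ℤ}
  {δ : (completeFreeLie K deg).Differential} (hδ : IsContinuousDifferential δ)

theorem lengthFiltration_isComplete : (lengthFiltration δ hδ).IsComplete where
  hausdorff k x h := Subtype.ext (PowerSeries.ext fun n =>
    (h (n + 1) n (Nat.lt_succ_self n)).trans (map_zero _).symm)
  exists_sum k P := by
    choose N hN using P.2
    let p : ℕ → PowerSeries (FreeAlgebra K X) := fun i => (P.1 i : hatLie K deg k).1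
    have hp : ∀ n i, N n ≤ i → ∀ j < n, PowerSeries.coeff j (p i) = 0 := fun n i hi j hj =>
      hN n i hi j hj
    -- From index `N (n + 1)` on, the terms have no component of length n, so this component of the
    -- sum is a finite sum.
    let s : hatLie K deg k := ⟨PowerSeries.mk fun n =>
        ∑ i ∈ Finset.range (N (n + 1)), PowerSeries.coeff n (p i), fun n => by
      rw [PowerSeries.coeff_mk]
      exact Submodule.sum_mem _ fun i _ => (P.1 i : hatLie K deg k).2 n⟩
    refine ⟨s, fun n => ⟨N n, fun m hm j hj => ?_⟩⟩
    have e : PowerSeries.coeff j (show hatLie K deg k from ∑ i ∈ Finset.range m, P.1 i -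
        (show (completeFreeDGL δ).obj k from s)).1 =
        ∑ i ∈ Finset.range m, PowerSeries.coeff j (p i) -
          ∑ i ∈ Finset.range (N (j + 1)), PowerSeries.coeff j (p i) := by
      refine (map_sub (hatCoeff (deg := deg) k j)
        _ _).trans (congrArg₂ (· - ·) ?_ ?_)
      · exact map_sum (hatCoeff (deg := deg) k j) _ _
      · exact PowerSeries.coeff_mk j fun n =>
          ∑ i ∈ Finset.range (N (n + 1)), PowerSeries.coeff n (p i)
    refine e.trans (sub_eq_zero.2 ?_)
    have h1 : ∀ a b, a ≤ b → (∀ i, a ≤ i → PowerSeries.coeff j (p i) = 0) →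
        ∑ i ∈ Finset.range a, PowerSeries.coeff j (p i) =
          ∑ i ∈ Finset.range b, PowerSeries.coeff j (p i) := by
      intro a b hab h
      refine Finset.sum_subset (Finset.range_mono hab) fun i _ hi => h i ?_
      simpa using hi
    rw [h1 m (max m (N (j + 1))) (le_max_left _ _) fun i hi => hp n i (hm.trans hi) j hj,
      h1 (N (j + 1)) (max m (N (j + 1))) (le_max_right _ _) fun i hi => hp (j + 1) i hi j (by omega)]

/-- Lie elements have no component of length 0, so a bracket is strictly longer than its factors.
Both nilpotency conditions follow, with no assumption on δ beyond continuity. -/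
theorem ad_mem_lengthFiltration (w : (completeFreeDGL δ).obj 0) {k : ℤ} {n : ℕ}
    {x : (completeFreeDGL δ).obj k} (hx : x ∈ (lengthFiltration δ hδ).F n k) :
    (completeFreeDGL δ).ad w k x ∈ (lengthFiltration δ hδ).F (n + 1) k := by
  have hw : PowerSeries.coeff 0 (w : hatLie K deg 0).1 = 0 := by
    have := (w : hatLie K deg 0).2 0
    rwa [freeLie_zero, Submodule.mem_bot] at this
  intro m hm
  show PowerSeries.coeff m ((w : hatLie K deg 0).1 * (x : hatLie K deg k).1 -
    (-1 : K) ^ (0 * k) • ((x : hatLie K deg k).1 * (w : hatLie K deg 0).1)) = 0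
  rw [map_sub, PowerSeries.coeff_smul, PowerSeries.coeff_mul, PowerSeries.coeff_mul,
    Finset.sum_eq_zero, Finset.sum_eq_zero, smul_zero, sub_zero]
  · intro c hc
    rw [Finset.HasAntidiagonal.mem_antidiagonal] at hc
    by_cases h : c.1 < n
    · rw [hx c.1 h, zero_mul]
    · rw [show c.2 = 0 by omega, hw, mul_zero]
  · intro c hc
    rw [Finset.HasAntidiagonal.mem_antidiagonal] at hc
    by_cases h : c.2 < n
    · rw [hx c.2 h, mul_zero]
    · rw [show c.1 = 0 by omega, hw, zero_mul]

theorem topNilp_lengthFiltration (w : (completeFreeDGL δ).obj 0) :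
    (lengthFiltration δ hδ).TopNilp w := by
  refine fun n => ⟨n, fun k x => ?_⟩
  induction n with
  | zero => exact fun m hm => absurd hm (Nat.not_lt_zero m)
  | succ n ih =>
    rw [pow_succ', Module.End.mul_apply]
    exact ad_mem_lengthFiltration hδ w ih

theorem locallyTopNilp_lengthFiltration : (lengthFiltration δ hδ).LocallyTopNilp := by
  refine fun q n => ⟨n, fun k => ?_⟩
  induction n with
  | zero => exact fun x _ m hm => absurd hm (Nat.not_lt_zero m)
  | succ n ih =>
    refine Submodule.span_le.2 ?_
    rintro _ ⟨i, x, hx, rfl⟩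
    exact ad_mem_lengthFiltration hδ _ (ih hx)

end length

/-! ### The discrete filtration -/

section discrete

variable {K : Type u} [Field K] (L : DGL.{u, v} K)

theorem discrete_isComplete : (discrete L).IsComplete where
  hausdorff k x h := (Submodule.mem_bot K).1 (h 0)
  exists_sum k p := by
    obtain ⟨N, hN⟩ := p.2 0
    exact ⟨_, isSum_of_eq_zero fun i hi => (Submodule.mem_bot K).1 (hN i hi)⟩

variable {L}

theorem topNilp_discrete (h : L.AdNilpotent) (w : L.obj 0) : (discrete L).TopNilp w := by
  intro n
  obtain ⟨N, hN⟩ := h w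
  exact ⟨N, fun k x => (Submodule.mem_bot K).2 (by rw [hN, LinearMap.zero_apply])⟩

open Classical in
theorem locallyTopNilp_discrete (h : L.AdLocallyNilpotent) : (discrete L).LocallyTopNilp := by
  intro q n
  obtain ⟨d, hd⟩ := q.2 0
  -- A null sequence is finitely supported here, so its terms form a finite set once 0 is added for
  -- the tail.
  obtain ⟨N, hN⟩ := h (insert 0 ((Finset.range d).image q.1))
  have hq : ∀ i, q.1 i ∈ insert 0 ((Finset.range d).image q.1) := by
    intro i
    rw [Finset.mem_insert, Finset.mem_image]
    by_cases hi : i < d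
    · exact Or.inr ⟨i, Finset.mem_range.2 hi, rfl⟩
    · exact Or.inl ((Submodule.mem_bot K).1 (hd i (by omega)))
  -- Induction on s moves the outermost operator of an element of `adSpan` into the list, until N
  -- operators are there and their product is zero.
  have key : ∀ (k : ℤ) (s : ℕ) (l : List (L.obj 0)), l.length + s = N →
      (∀ x ∈ l, x ∈ insert 0 ((Finset.range d).image q.1)) →
      L.adSpan q.1 k s ≤ LinearMap.ker (l.map fun x => L.ad x k).prod := by
    intro k s
    induction s with
    | zero =>
      intro l hl hlS x _
      rw [LinearMap.mem_ker, hN l hl hlS, LinearMap.zero_apply]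
    | succ s ih =>
      intro l hl hlS
      refine Submodule.span_le.2 ?_
      rintro _ ⟨i, x, hx, rfl⟩
      have := ih (l ++ [q.1 i]) (by simp; omega) (fun y hy => by
        rcases List.mem_append.1 hy with hy | hy
        · exact hlS y hy
        · rw [List.mem_singleton.1 hy]; exact hq i) hx
      simpa using this
  refine ⟨N, fun k x hx => ?_⟩
  have := key k N [] (by simp) (by simp) hx
  exact (Submodule.mem_bot K).2 (by simpa using this)

end discrete

/-! ### The continuous Lie morphism with given values on a, b, z -/

section freeEval

variable {K : Type u} [Field K] [CharZero K] {L : DGL.{u, v} K} {F : L.Filtration}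

/-- The series of the values of the components of an element of the complete free Lie algebra. -/
noncomputable def freeSeries (ψ : ∀ x : LSGen, L.obj x.deg) (hw : F.TopNilp (ψ .z)) (k : ℤ) :
    (completeFreeLie K LSGen.deg).obj k →ₗ[K] F.series k where
  toFun φ := ⟨fun n => lieEval ψ n k (PowerSeries.coeff n (φ : hatLie K LSGen.deg k).1), fun n => by
    obtain ⟨M, hM⟩ := exists_lieEval_mem ψ hw n k
    exact ⟨M, fun m hm => hM m hm _ ((φ : hatLie K LSGen.deg k).2 m)⟩⟩
  map_add' φ φ' := series_ext fun n => map_add (lieEval ψ n k) _ _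
  map_smul' c φ := series_ext fun n => by
    refine Eq.trans ?_ (map_smul (lieEval ψ n k) c _)
    exact congrArg (lieEval ψ n k) (PowerSeries.coeff_smul _ _ _)

/-- The continuous morphism from the complete free Lie algebra on `a`, `b`, `z` with given values on
the generators. -/
noncomputable def freeEval (hF : F.IsComplete) (ψ : ∀ x : LSGen, L.obj x.deg)
    (hw : F.TopNilp (ψ .z)) (k : ℤ) : (completeFreeLie K LSGen.deg).obj k →ₗ[K] L.obj k :=
  F.sum hF k ∘ₗ freeSeries ψ hw k

variable (hF : F.IsComplete) (ψ : ∀ x : LSGen, L.obj x.deg) (hw : F.TopNilp (ψ .z))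

theorem freeEval_br (i j k : ℤ) (h : i + j = k) (x : (completeFreeLie K LSGen.deg).obj i)
    (y : (completeFreeLie K LSGen.deg).obj j) :
    freeEval hF ψ hw k ((completeFreeLie K LSGen.deg).br i j k h x y) =
      L.br i j k h (freeEval hF ψ hw i x) (freeEval hF ψ hw j y) := by
  refine Eq.trans (congrArg (F.sum hF k) ?_) (sum_br hF i j k h _ _)
  refine series_ext fun n => ?_
  let φ : hatLie K LSGen.deg i := x
  let χ : hatLie K LSGen.deg j := y
  show lieEval ψ n k (PowerSeries.coeff n (φ.1 * χ.1 - (-1 : K) ^ (i * j) • (χ.1 * φ.1))) =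
    ∑ c ∈ Finset.HasAntidiagonal.antidiagonal n, L.br i j k h
      (lieEval ψ c.1 i (PowerSeries.coeff c.1 φ.1)) (lieEval ψ c.2 j (PowerSeries.coeff c.2 χ.1))
  rw [map_sub, PowerSeries.coeff_smul, PowerSeries.coeff_mul, PowerSeries.coeff_mul,
    ← Finset.Nat.sum_antidiagonal_swap (f := fun c => PowerSeries.coeff c.1 χ.1 * _),
    Finset.smul_sum, ← Finset.sum_sub_distrib, map_sum]
  refine Finset.sum_congr rfl fun c hc => ?_
  rw [Finset.HasAntidiagonal.mem_antidiagonal] at hc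
  subst hc
  exact lieEval_br ψ h (φ.2 c.1) (χ.2 c.2)

omit [CharZero K] in
theorem freeEval_gen (x : LSGen) :
    freeEval hF ψ hw x.deg (completeFreeGen K LSGen.deg x) = ψ x := by
  refine (isSum_sum hF _).unique hF ?_
  have h := (isSum_of_eq_zero (F := F) (N := 2)
    (p := (freeSeries ψ hw x.deg (completeFreeGen K LSGen.deg x)).1) fun i hi => ?_)
  · have e : ∀ i, (freeSeries ψ hw x.deg (completeFreeGen K LSGen.deg x)).1 i =
      lieEval ψ i x.deg (PowerSeries.coeff i (PowerSeries.monomial 1 (FreeAlgebra.ι K x))) :=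
      fun i => rfl
    rw [Finset.sum_range_succ, Finset.sum_range_one, e, e, PowerSeries.coeff_monomial_same,
      PowerSeries.coeff_monomial, if_neg (by norm_num), map_zero, zero_add, lieEval_ι] at h
    exact h
  · show lieEval ψ i x.deg (PowerSeries.coeff i (PowerSeries.monomial 1 (FreeAlgebra.ι K x))) = 0
    rw [PowerSeries.coeff_monomial, if_neg (by omega), map_zero]

omit [CharZero K] in
theorem exists_freeEval_mem (n : ℕ) (k : ℤ) : ∃ M : ℕ,
    ∀ x : hatLie K LSGen.deg k, (∀ m < M, PowerSeries.coeff m x.1 = 0) →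
      freeEval hF ψ hw k x ∈ F.F n k := by
  obtain ⟨M, hM⟩ := exists_lieEval_mem ψ hw n k
  refine ⟨M, fun x hx => (isSum_sum hF (freeSeries ψ hw k x)).mem fun i => ?_⟩
  show lieEval ψ i k (PowerSeries.coeff i x.1) ∈ _
  by_cases hi : i < M
  · rw [hx i hi, map_zero]
    exact zero_mem _
  · exact hM i (by omega) _ (x.2 i)

end freeEval

/-! ### Compatibility with differentials, checked on generators -/

section

variable {K : Type u} [Field K] {X : Type w} {deg : X → ℤ}

/-- A homogeneous Lie element, as an element of the complete free Lie algebra. -/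
noncomputable def freeLieIncl (n : ℕ) (k : ℤ) :
    freeLie K deg n k →ₗ[K] (completeFreeLie K deg).obj k where
  toFun f := (⟨PowerSeries.monomial n f.1, fun m => by
    rw [PowerSeries.coeff_monomial]
    split_ifs with h
    · subst h
      exact f.2
    · exact zero_mem _⟩ : hatLie K deg k)
  map_add' f g := Subtype.ext (map_add (PowerSeries.monomial n) f.1 g.1)
  map_smul' c f := Subtype.ext (by
    refine PowerSeries.ext fun m => ?_
    show PowerSeries.coeff m (PowerSeries.monomial n (c • f.1)) =
      PowerSeries.coeff m (c • PowerSeries.monomial n f.1)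
    rw [PowerSeries.coeff_smul, PowerSeries.coeff_monomial, PowerSeries.coeff_monomial]
    split_ifs <;> simp)

theorem freeLieIncl_br {m n : ℕ} {i j : ℤ} {f g : FreeAlgebra K X} (hf : f ∈ freeLie K deg m i)
    (hg : g ∈ freeLie K deg n j) :
    freeLieIncl (m + n) (i + j) ⟨_, freeLie_br hf hg⟩ =
      (completeFreeLie K deg).br i j (i + j) rfl (freeLieIncl m i ⟨f, hf⟩)
        (freeLieIncl n j ⟨g, hg⟩) := by
  refine Subtype.ext ?_
  show PowerSeries.monomial (m + n) (f * g - (-1 : K) ^ (i * j) • (g * f)) =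
    PowerSeries.monomial m f * PowerSeries.monomial n g -
      (-1 : K) ^ (i * j) • (PowerSeries.monomial n g * PowerSeries.monomial m f)
  rw [PowerSeries.monomial_mul_monomial, PowerSeries.monomial_mul_monomial, map_sub, add_comm n m]
  congr 1
  ext l
  rw [PowerSeries.coeff_smul, PowerSeries.coeff_monomial, PowerSeries.coeff_monomial]
  split_ifs <;> simp

/-- A continuous morphism of Lie algebras from a complete free DGL is a morphism of DGL's if it is
compatible with the differential on the generators. -/
theorem map_d_of_gen {δ : (completeFreeLie K deg).Differential} (hδ : IsContinuousDifferential δ)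
    {L : DGL.{u, v} K} {F : L.Filtration} (hF : F.IsComplete)
    (Φ : ∀ i : ℤ, (completeFreeLie K deg).obj i →ₗ[K] L.obj i)
    (hΦ : ∀ (i j k : ℤ) (h : i + j = k) (x : (completeFreeLie K deg).obj i)
      (y : (completeFreeLie K deg).obj j),
      Φ k ((completeFreeLie K deg).br i j k h x y) = L.br i j k h (Φ i x) (Φ j y))
    (hc : ∀ (n : ℕ) (k : ℤ), ∃ M : ℕ, ∀ x : hatLie K deg k,
      (∀ m < M, PowerSeries.coeff m x.1 = 0) → Φ k x ∈ F.F n k)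
    (hg : ∀ (x : X) (j : ℤ) (h : j + 1 = deg x),
      Φ j (δ.d _ j h (completeFreeGen K deg x)) = L.d _ j h (Φ _ (completeFreeGen K deg x)))
    (i j : ℤ) (h : j + 1 = i) (x : (completeFreeLie K deg).obj i) :
    Φ j (δ.d i j h x) = L.d i j h (Φ i x) := by
  have h1 : ∀ (n : ℕ) (i : ℤ) (f : FreeAlgebra K X) (hf : IsLieMonomial K deg n i f) (j : ℤ)
      (h : j + 1 = i), Φ j (δ.d i j h (freeLieIncl n i ⟨f, Submodule.subset_span hf⟩)) =
        L.d i j h (Φ i (freeLieIncl n i ⟨f, Submodule.subset_span hf⟩)) := by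
    intro n i f hf
    induction hf with
    | gen x => exact hg x
    | @br m n i i' f g hf hg ihf ihg =>
      intro j h
      have e := freeLieIncl_br (K := K) (deg := deg) (Submodule.subset_span hf)
        (Submodule.subset_span hg)
      rw [e, δ.leibniz i i' (i + i') (i - 1) (i' - 1) j rfl (by omega) (by omega) h (by omega)
        (by omega), map_add, map_smul, hΦ, hΦ, hΦ, ihf, ihg,
        ← L.diff.leibniz i i' (i + i') (i - 1) (i' - 1) j rfl (by omega) (by omega) h (by omega)
        (by omega)]
  have h2 : ∀ (n : ℕ) (f : freeLie K deg n i),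
      Φ j (δ.d i j h (freeLieIncl n i f)) = L.d i j h (Φ i (freeLieIncl n i f)) := by
    rintro n ⟨f, hf⟩
    induction hf using Submodule.span_induction with
    | mem f hf => exact h1 n i f hf j h
    | zero =>
      have : (⟨0, Submodule.zero_mem _⟩ : freeLie K deg n i) = 0 := rfl
      rw [this]
      simp
    | add f g hf hg ihf ihg =>
      have : (⟨f + g, Submodule.add_mem _ hf hg⟩ : freeLie K deg n i) = ⟨f, hf⟩ + ⟨g, hg⟩ := rfl
      rw [this]
      simp only [map_add, ihf, ihg]
    | smul c f hf ihf =>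
      have : (⟨c • f, Submodule.smul_mem _ c hf⟩ : freeLie K deg n i) = c • ⟨f, hf⟩ := rfl
      rw [this]
      simp only [map_smul, ihf]
  rw [← sub_eq_zero]
  refine hF.hausdorff j _ fun n => ?_
  obtain ⟨M, hM⟩ := hc n i
  obtain ⟨M', hM'⟩ := hc n j
  set N := max M M'
  set φ : hatLie K deg i := x
  -- Cut off at length N: on σ, a finite sum of homogeneous Lie elements, the claim is algebraic. On
  -- the remainder both sides lie in the `n`-th step, by continuity of `Φ` and of δ.
  set σ : (completeFreeLie K deg).obj i :=
    ∑ m ∈ Finset.range N, freeLieIncl m i ⟨PowerSeries.coeff m φ.1, φ.2 m⟩ with hσ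
  have hs : Φ j (δ.d i j h σ) = L.d i j h (Φ i σ) := by
    simp only [hσ, map_sum, h2]
  have hr : ∀ m < N, PowerSeries.coeff m (x - σ : hatLie K deg i).1 = 0 := by
    intro m hm
    refine (map_sub (hatCoeff (deg := deg) i m)
      _ _).trans (sub_eq_zero.2 ?_)
    refine Eq.trans ?_
      (map_sum (hatCoeff (deg := deg) i m) _ _).symm
    refine Eq.symm ((Finset.sum_eq_single m ?_ ?_).trans ?_)
    · intro l _ hl
      show PowerSeries.coeff m (PowerSeries.monomial l _) = 0
      rw [PowerSeries.coeff_monomial, if_neg hl.symm]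
    · intro hm'
      exact absurd (Finset.mem_range.2 hm) hm'
    · exact PowerSeries.coeff_monomial_same m _
  have e : Φ j (δ.d i j h x) - L.d i j h (Φ i x) =
      Φ j (δ.d i j h (x - σ)) - L.d i j h (Φ i (x - σ)) := by
    simp only [map_sub, hs, sub_sub_sub_cancel_right]
  rw [e]
  refine sub_mem (hM' _ fun m hm => hδ N i j h (x - σ) hr m (lt_of_lt_of_le hm (le_max_right _ _)))
    (F.d_mem n i j h _ (hM _ fun m hm => hr m (lt_of_lt_of_le hm (le_max_left _ _))))

end

end DGL.Filtration

open DGL.Filtration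

/-! ### The Lawrence–Sullivan differential as the gauge equation z*b = a -/

section LS

variable (K : Type u) [Field K] [CharZero K]

theorem isContinuous_lsDifferential : IsContinuousDifferential (lsDifferential K) := by
  intro n i j h φ hφ m hm
  show PowerSeries.coeff m (seriesDer LSGen.deg (lsValue K) φ.1) = 0
  rw [coeff_seriesDer]
  refine Finset.sum_eq_zero fun c hc => ?_
  rw [Finset.HasAntidiagonal.mem_antidiagonal] at hc
  rw [hφ c.1 (by omega), map_zero]

variable {K}

omit [CharZero K] in
theorem coeff_seriesDer_gen (x : LSGen) (n : ℕ) : PowerSeries.coeff n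
    (seriesDer LSGen.deg (lsValue K) (PowerSeries.monomial 1 (FreeAlgebra.ι K x))) =
      if n = 0 then 0 else lsValue K (n - 1) x := by
  rw [coeff_seriesDer]
  split_ifs with h
  · subst h
    simp [PowerSeries.coeff_monomial]
  · rw [Finset.sum_eq_single (1, n - 1)]
    · rw [PowerSeries.coeff_monomial_same, gradedDer_ι]
    · rintro ⟨p, q⟩ hpq hne
      rw [Finset.HasAntidiagonal.mem_antidiagonal] at hpq
      rw [PowerSeries.coeff_monomial, if_neg, map_zero]
      rintro rfl
      exact hne (Prod.ext rfl (by simp at hpq ⊢; omega))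
    · intro hn
      exact absurd (Finset.HasAntidiagonal.mem_antidiagonal.2 (by simp; omega)) hn

theorem lsDifferential_flat (x : LSGen)
    (hv : ∀ r, lsValue K r x = if r = 1 then -(FreeAlgebra.ι K x * FreeAlgebra.ι K x) else 0)
    (y : (completeFreeLie K LSGen.deg).obj (-1))
    (hy : (y : hatLie K LSGen.deg (-1)).1 = PowerSeries.monomial 1 (FreeAlgebra.ι K x)) :
    (LSModel K).IsMC y := by
  refine Subtype.ext (PowerSeries.ext fun n => ?_)
  have hL : PowerSeries.coeff n (seriesDer LSGen.deg (lsValue K)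
      (y : hatLie K LSGen.deg (-1)).1) =
      PowerSeries.coeff n (-(PowerSeries.monomial 2 (FreeAlgebra.ι K x * FreeAlgebra.ι K x))) := by
    rw [hy, coeff_seriesDer_gen, map_neg, PowerSeries.coeff_monomial]
    simp only [hv]
    rcases n with _ | _ | _ | n <;> simp
  refine hL.trans (congrArg (PowerSeries.coeff n) (Eq.symm ?_))
  show -((1 / 2 : K) • ((y : hatLie K LSGen.deg (-1)).1 * (y : hatLie K LSGen.deg (-1)).1 -
    (-1 : K) ^ ((-1 : ℤ) * -1) •
      ((y : hatLie K LSGen.deg (-1)).1 * (y : hatLie K LSGen.deg (-1)).1))) = _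
  rw [hy, PowerSeries.monomial_mul_monomial, show (-1 : K) ^ ((-1 : ℤ) * -1) = -1 by norm_num]
  module

theorem isMC_lsA : (LSModel K).IsMC (lsA K) :=
  lsDifferential_flat .a (fun _ => rfl) _ rfl

theorem isMC_lsB : (LSModel K).IsMC (lsB K) :=
  lsDifferential_flat .b (fun _ => rfl) _ rfl

omit [CharZero K] in
theorem ad_lsZ_pow {δ : (completeFreeLie K LSGen.deg).Differential} (i : ℕ) :
    (show hatLie K LSGen.deg (-1) from ((completeFreeDGL δ).ad (lsZ K) (-1) ^ i)
      (lsB K - lsA K : (completeFreeLie K LSGen.deg).obj (-1))).1 =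
    PowerSeries.monomial (i + 1) ((fun f => FreeAlgebra.ι K LSGen.z * f -
      f * FreeAlgebra.ι K LSGen.z)^[i] (FreeAlgebra.ι K .b - FreeAlgebra.ι K .a)) := by
  induction i with
  | zero => exact (map_sub (PowerSeries.monomial 1) _ _).symm
  | succ i ih =>
    rw [Function.iterate_succ_apply']
    set y := ((completeFreeDGL δ).ad (lsZ K) (-1) ^ i)
      (lsB K - lsA K : (completeFreeLie K LSGen.deg).obj (-1))
    have e : ((completeFreeDGL δ).ad (lsZ K) (-1) ^ (i + 1))
        (lsB K - lsA K : (completeFreeLie K LSGen.deg).obj (-1)) =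
        (completeFreeDGL δ).ad (lsZ K) (-1) y := by
      rw [pow_succ']
      rfl
    refine (congrArg (fun y : hatLie K LSGen.deg (-1) => y.1) e).trans ?_
    change (y : hatLie K LSGen.deg (-1)).1 = _ at ih
    show PowerSeries.monomial 1 (FreeAlgebra.ι K LSGen.z) * (y : hatLie K LSGen.deg (-1)).1 -
      (-1 : K) ^ ((0 : ℤ) * -1) • ((y : hatLie K LSGen.deg (-1)).1 *
        PowerSeries.monomial 1 (FreeAlgebra.ι K LSGen.z)) = _
    rw [ih, PowerSeries.monomial_mul_monomial, PowerSeries.monomial_mul_monomial, zero_mul,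
      zpow_zero, one_smul, add_comm 1, ← map_sub]

/-- The right-hand side involves only brackets and the length topology, so an arbitrary continuous δ
may be used to write it. The proof compares lengths: ad_zⁱ(b-a) is concentrated in length i + 1. -/
theorem lsDifferential_lsZ {δ : (completeFreeLie K LSGen.deg).Differential}
    (hδ : IsContinuousDifferential δ) :
    (lsDifferential K).d 0 (-1) (by norm_num) (lsZ K) =
      (completeFreeDGL δ).ad (lsZ K) (-1) (lsB K) +
      (lengthFiltration δ hδ).act (lengthFiltration_isComplete hδ)
        (topNilp_lengthFiltration hδ (lsZ K)) (bernoulliPowerSeries K) (-1) (lsB K - lsA K) := by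
  refine (sub_eq_iff_eq_add' (G := (completeFreeDGL δ).obj (-1))).1 ?_
  refine IsSum.unique (lengthFiltration_isComplete hδ) ?_ (isSum_act _ _ _ _ _)
  refine fun n => ⟨n, fun m hm j hj => ?_⟩
  let c : (completeFreeLie K LSGen.deg).obj (-1) →ₗ[K] FreeAlgebra K LSGen := hatCoeff (-1) j
  let A : ℕ → FreeAlgebra K LSGen := fun i => (fun f => FreeAlgebra.ι K LSGen.z * f -
      f * FreeAlgebra.ι K LSGen.z)^[i] (FreeAlgebra.ι K .b - FreeAlgebra.ι K .a)
  have h1 : ∀ i, c (PowerSeries.coeff i (bernoulliPowerSeries K) •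
      ((completeFreeDGL δ).ad (lsZ K) (-1) ^ i)
      (lsB K - lsA K : (completeFreeLie K LSGen.deg).obj (-1))) =
      if j = i + 1 then ((bernoulli i / i.factorial : ℚ) : K) • A i else 0 := by
    intro i
    refine (map_smul c _ _).trans ?_
    have : c (((completeFreeDGL δ).ad (lsZ K) (-1) ^ i)
      (lsB K - lsA K : (completeFreeLie K LSGen.deg).obj (-1))) =
      PowerSeries.coeff j (PowerSeries.monomial (i + 1) (A i)) :=
      congrArg (PowerSeries.coeff j) (ad_lsZ_pow i)
    rw [this, PowerSeries.coeff_monomial, bernoulliPowerSeries, PowerSeries.coeff_mk, eq_ratCast]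
    split_ifs <;> simp
  have h2 : c ((lsDifferential K).d 0 (-1) (by norm_num) (lsZ K)) =
      if j = 0 then 0 else lsValue K (j - 1) .z := coeff_seriesDer_gen .z j
  have h3 : c ((completeFreeDGL δ).ad (lsZ K) (-1) (lsB K)) = if j = 2 then
      FreeAlgebra.ι K .z * FreeAlgebra.ι K .b - FreeAlgebra.ι K .b * FreeAlgebra.ι K .z else 0 := by
    show PowerSeries.coeff j (PowerSeries.monomial 1 (FreeAlgebra.ι K LSGen.z) *
      PowerSeries.monomial 1 (FreeAlgebra.ι K LSGen.b) -
      (-1 : K) ^ ((0 : ℤ) * -1) • (PowerSeries.monomial 1 (FreeAlgebra.ι K LSGen.b) *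
        PowerSeries.monomial 1 (FreeAlgebra.ι K LSGen.z))) = _
    rw [PowerSeries.monomial_mul_monomial, PowerSeries.monomial_mul_monomial, zero_mul,
      zpow_zero, one_smul, ← map_sub, PowerSeries.coeff_monomial]
  have e := (map_sub c (∑ i ∈ Finset.range m, PowerSeries.coeff i (bernoulliPowerSeries K) •
      ((completeFreeDGL δ).ad (lsZ K) (-1) ^ i)
      (lsB K - lsA K : (completeFreeLie K LSGen.deg).obj (-1))) ((lsDifferential K).d 0 (-1)
        (by norm_num) (lsZ K) -
          (show (completeFreeLie K LSGen.deg).obj (-1) from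
            (completeFreeDGL δ).ad (lsZ K) (-1) (lsB K))))
  refine e.trans ?_
  refine (congrArg₂ (· - ·) (map_sum c _ _) (map_sub c _ _)).trans ?_
  simp only [h1, h2, h3]
  cases j with
  | zero => simp
  | succ j =>
    simp only [Nat.add_right_cancel_iff, Finset.sum_ite_eq, Finset.mem_range]
    rw [if_pos (by omega), if_neg (by omega), Nat.add_sub_cancel]
    show _ - ((_ + _) - _) = _
    by_cases h : j = 1 <;> simp [h, A]

theorem gauge_lsZ_iff {δ : (completeFreeLie K LSGen.deg).Differential}
    (hδ : IsContinuousDifferential δ) :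
    (lengthFiltration δ hδ).Gauge (lsZ K) (lsB K) (lsA K) ↔
      δ.d 0 (-1) (by norm_num) (lsZ K) =
        (lsDifferential K).d 0 (-1) (by norm_num) (lsZ K) := by
  refine (gauge_iff (lengthFiltration_isComplete hδ) (topNilp_lengthFiltration hδ _) _ _).trans
    ((gaugeAct_eq_iff _ _ _ _).trans (Iff.of_eq ?_))
  exact congrArg (δ.d 0 (-1) (by norm_num) (lsZ K) = ·) (lsDifferential_lsZ hδ).symm

/-- The differential of the Lawrence–Sullivan construction is the only one with `z * b = a`. -/
theorem gauge_lsZ_iff_eq {δ : (completeFreeLie K LSGen.deg).Differential}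
    (hδ : IsContinuousDifferential δ) (ha : (completeFreeDGL δ).IsMC (lsA K))
    (hb : (completeFreeDGL δ).IsMC (lsB K)) :
    (lengthFiltration δ hδ).Gauge (lsZ K) (lsB K) (lsA K) ↔ δ = lsDifferential K := by
  rw [gauge_lsZ_iff]
  refine ⟨fun h => ?_, fun h => h ▸ rfl⟩
  have hd : δ.d = (lsDifferential K).d := by
    funext i j hij
    refine LinearMap.ext fun x => ?_
    -- The identity map, seen as a Lie morphism between the two DGLs, commutes with the
    -- differentials because it does so on a, b (both flat) and on z (the gauge equation).
    refine map_d_of_gen hδ (L := LSModel K)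
      (lengthFiltration_isComplete (isContinuous_lsDifferential K))
      (fun i => LinearMap.id) (fun _ _ _ _ _ _ => rfl) (fun n k => ⟨n, fun x hx => hx⟩)
      (fun x j h' => ?_) i j hij x
    cases x with
    | a =>
      obtain rfl : j = -2 := by simp [LSGen.deg] at h'; omega
      exact ha.trans isMC_lsA.symm
    | b =>
      obtain rfl : j = -2 := by simp [LSGen.deg] at h'; omega
      exact hb.trans isMC_lsB.symm
    | z =>
      obtain rfl : j = -1 := by simp [LSGen.deg] at h'; omega
      exact h
  cases δ
  cases hls : lsDifferential K
  simp_all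

theorem gauge_lsModel :
    (lengthFiltration _ (isContinuous_lsDifferential K)).Gauge (lsZ K) (lsB K) (lsA K) :=
  (gauge_lsZ_iff _).2 rfl

end LS

/-! ### Morphisms from 𝔏 and gauge equations -/

namespace DGL.Filtration

variable {K : Type u} [Field K] [CharZero K] {L : DGL.{u, v} K} {F : L.Filtration}

/-- The image under Φ of the universal equation z*b = a; `map_gaugeAct` applies although Φ need not
be continuous. -/
theorem gauge_of_hom (hF : F.IsComplete) (Φ : DGL.Hom (LSModel K) L)
    (hw : F.TopNilp (Φ.toFun 0 (lsZ K))) :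
    F.Gauge (Φ.toFun 0 (lsZ K)) (Φ.toFun (-1) (lsB K)) (Φ.toFun (-1) (lsA K)) := by
  have hc := isContinuous_lsDifferential K
  have h := (gauge_iff (lengthFiltration_isComplete hc) (topNilp_lengthFiltration hc _) _ _).1
    gauge_lsModel
  rw [gauge_iff hF hw, ← h]
  exact (map_gaugeAct (lengthFiltration_isComplete hc) hF Φ.toFun Φ.map_br Φ.map_d
    (topNilp_lengthFiltration hc _) hw _).symm

/-- Extend the values to a continuous Lie morphism and compare differentials on generators: on a and
b this is flatness, on z it is the gauge equation solved for ∂w. -/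
theorem exists_hom_of_gauge (hF : F.IsComplete) {w : L.obj 0} (hw : F.TopNilp w)
    {u v : L.obj (-1)} (hu : L.IsMC u) (hv : L.IsMC v) (h : F.Gauge w v u) :
    ∃ Φ : DGL.Hom (LSModel K) L, Φ.toFun (-1) (lsA K) = u ∧ Φ.toFun (-1) (lsB K) = v ∧
      Φ.toFun 0 (lsZ K) = w := by
  let ψ : ∀ x : LSGen, L.obj x.deg := fun x => match x with
    | .a => u
    | .b => v
    | .z => w
  have hψ : F.TopNilp (ψ .z) := hw
  have hc := isContinuous_lsDifferential K
  let Φ := freeEval hF ψ hψ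
  have ea : Φ (-1) (lsA K) = u := freeEval_gen hF ψ hψ .a
  have eb : Φ (-1) (lsB K) = v := freeEval_gen hF ψ hψ .b
  have ez : Φ 0 (lsZ K) = w := freeEval_gen hF ψ hψ .z
  have hflat : ∀ (x : (LSModel K).obj (-1)), (LSModel K).IsMC x → L.IsMC (Φ (-1) x) →
      Φ (-2) ((lsDifferential K).d (-1) (-2) (by norm_num) x) =
        L.d (-1) (-2) (by norm_num) (Φ (-1) x) := by
    intro x hx hx'
    refine (congrArg (Φ (-2)) hx).trans ((map_neg (Φ (-2)) _).trans (Eq.trans ?_ hx'.symm))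
    exact congrArg Neg.neg ((map_smul (Φ (-2)) _ _).trans
      (congrArg ((1 / 2 : K) • ·) (freeEval_br hF ψ hψ _ _ _ _ x x)))
  refine ⟨⟨Φ, freeEval_br hF ψ hψ, map_d_of_gen hc hF Φ (freeEval_br hF ψ hψ)
    (exists_freeEval_mem hF ψ hψ) fun x j h' => ?_⟩, ea, eb, ez⟩
  cases x with
  | a =>
    obtain rfl : j = -2 := by simp [LSGen.deg] at h'; omega
    exact hflat (lsA K) isMC_lsA (ea ▸ hu)
  | b =>
    obtain rfl : j = -2 := by simp [LSGen.deg] at h'; omega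
    exact hflat (lsB K) isMC_lsB (eb ▸ hv)
  | z =>
    obtain rfl : j = -1 := by simp [LSGen.deg] at h'; omega
    rw [gauge_iff hF hw, gaugeAct_eq_iff] at h
    have hz : L.d 0 (-1) (by norm_num) (Φ 0 (lsZ K)) = L.ad w (-1) v +
      F.act hF hw (bernoulliPowerSeries K) (-1) (v - u) := by rw [ez, h]
    refine Eq.trans ?_ hz.symm
    refine (congrArg (Φ (-1)) (lsDifferential_lsZ hc)).trans ?_
    have hact := map_act (lengthFiltration_isComplete hc) hF Φ (freeEval_br hF ψ hψ)
      (topNilp_lengthFiltration hc (lsZ K)) (ez ▸ hw) (bernoulliPowerSeries K) (-1)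
      (lsB K - lsA K)
    refine (map_add (Φ (-1)) _ _).trans (congrArg₂ (· + ·) ?_ (hact.trans ?_))
    · refine (freeEval_br hF ψ hψ 0 (-1) (-1) (zero_add _) (lsZ K) (lsB K)).trans ?_
      show L.br 0 (-1) (-1) _ (Φ 0 (lsZ K)) (Φ (-1) (lsB K)) = _
      rw [ez, eb]
      rfl
    · have e1 : Φ (-1) (lsB K - lsA K) = v - u := by rw [map_sub, ea, eb]
      refine Eq.trans (congrArg _ e1) ?_
      congr 1
      congr 1

end DGL.Filtration

theorem mainTheorem3 (K : Type u) [Field K] [CharZero K] :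
    -- `L` is a DGL such that `L₀` acts nilpotently
    (∀ L : DGL.{u, v} K, L.AdNilpotent →
      ∀ u v : L.obj (-1), L.IsMC u → L.IsMC v →
        (L.AdLocallyNilpotent → ((DGL.Filtration.discrete L).Homotopic u v ↔
          ∃ Φ : DGL.Hom (LSModel K) L, Φ.toFun (-1) (lsA K) = u ∧ Φ.toFun (-1) (lsB K) = v)) ∧
        (∀ Φ : DGL.Hom (LSModel K) L, Φ.toFun (-1) (lsA K) = u → Φ.toFun (-1) (lsB K) = v →
          (DGL.Filtration.discrete L).Homotopic u v) ∧
        ∀ w : L.obj 0, (DGL.Filtration.discrete L).Gauge w v u ↔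
          ∃ Φ : DGL.Hom (LSModel K) L, Φ.toFun (-1) (lsA K) = u ∧ Φ.toFun (-1) (lsB K) = v ∧
            Φ.toFun 0 (lsZ K) = w) ∧
    -- `L` is a complete free DGL
    (∀ (X : Type w) (deg : X → ℤ) (δ : (completeFreeLie K deg).Differential)
      (hδ : IsContinuousDifferential δ),
      ∀ u v : (completeFreeDGL δ).obj (-1), (completeFreeDGL δ).IsMC u →
        (completeFreeDGL δ).IsMC v →
        ((lengthFiltration δ hδ).Homotopic u v ↔
          ∃ Φ : DGL.Hom (LSModel K) (completeFreeDGL δ),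
            Φ.toFun (-1) (lsA K) = u ∧ Φ.toFun (-1) (lsB K) = v) ∧
        ∀ w : (completeFreeDGL δ).obj 0, (lengthFiltration δ hδ).Gauge w v u ↔
          ∃ Φ : DGL.Hom (LSModel K) (completeFreeDGL δ),
            Φ.toFun (-1) (lsA K) = u ∧ Φ.toFun (-1) (lsB K) = v ∧ Φ.toFun 0 (lsZ K) = w) ∧
    -- among the differentials for which `a`, `b` are flat, only that of `𝔏` satisfies `z * b = a`
    (∀ (δ : (completeFreeLie K LSGen.deg).Differential) (hδ : IsContinuousDifferential δ),
      (completeFreeDGL δ).IsMC (lsA K) → (completeFreeDGL δ).IsMC (lsB K) →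
        ((lengthFiltration δ hδ).Gauge (lsZ K) (lsB K) (lsA K) ↔ δ = lsDifferential K)) := by

  refine ⟨fun L hL u v hu hv => ?_, fun X deg δ hδ u v hu hv => ?_, fun δ hδ => gauge_lsZ_iff_eq hδ⟩
  · have hF := discrete_isComplete L
    have hT := topNilp_discrete hL
    refine ⟨fun hloc => ⟨fun h => ?_, ?_⟩, ?_, fun w => ⟨exists_hom_of_gauge hF (hT w) hu hv, ?_⟩⟩
    · obtain ⟨w, hw⟩ := exists_gauge_of_homotopic hF (locallyTopNilp_discrete hloc) hT h
      obtain ⟨Φ, ha, hb, -⟩ := exists_hom_of_gauge hF (hT w) hu hv hw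
      exact ⟨Φ, ha, hb⟩
    · rintro ⟨Φ, rfl, rfl⟩
      exact homotopic_of_gauge hF (hT _) hu (gauge_of_hom hF Φ (hT _))
    · rintro Φ rfl rfl
      exact homotopic_of_gauge hF (hT _) hu (gauge_of_hom hF Φ (hT _))
    · rintro ⟨Φ, rfl, rfl, rfl⟩
      exact gauge_of_hom hF Φ (hT _)
  · have hF := lengthFiltration_isComplete hδ
    have hT := topNilp_lengthFiltration hδ
    refine ⟨⟨fun h => ?_, ?_⟩, fun w => ⟨exists_hom_of_gauge hF (hT w) hu hv, ?_⟩⟩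
    · obtain ⟨w, hw⟩ := exists_gauge_of_homotopic hF (locallyTopNilp_lengthFiltration hδ) hT h
      obtain ⟨Φ, ha, hb, -⟩ := exists_hom_of_gauge hF (hT w) hu hv hw
      exact ⟨Φ, ha, hb⟩
    · rintro ⟨Φ, rfl, rfl⟩
      exact homotopic_of_gauge hF (hT _) hu (gauge_of_hom hF Φ (hT _))
    · rintro ⟨Φ, rfl, rfl, rfl⟩
      exact gauge_of_hom hF Φ (hT _)
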